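/- Let $V$ be a finite set with distinguished vertices $s\neq t$, and let $A=\{(u,v)\in V\times V: u\neq v\}$ be the set of arcs of the complete digraph on $V$. For $U\subseteq V$ let $\partial^+(U)$ (resp. $\partial^-(U)$) be the set of arcs leaving (resp. entering) $U$, and for $x\in\mathbb R^A$ and $B\subseteq A$ let $x(B)=\sum_{a\in B}x_a$. Let $x^*\in\mathbb R^A$ be a feasible solution (for instance an optimal solution, for any arc costs) of the subtour elimination linear program for $s$-$t$ paths, that is: \begin{itemize} \item $x^*(\partial^+(s))=x^*(\partial^-(t))=1$ and $x^*(\partial^-(s))=x^*(\partial^+(t))=0$; \item $x^*(\partial^+(v))=x^*(\partial^-(v))=1$ for all $v\in V\setminus\{s,t\}$; \item $x^*(\partial^+(U))\geq 1$ for all $\{s\}\subseteq U\subsetneq V$; \item $x^*_a\ge 0$ for all $a\in A$. \end{itemize} An $s$-$t$ cut is a set $U$ with $\{s\}\subseteq U\subseteq V\setminus\{t\}$; for $\tau\ge 0$ it is called $\tau$-narrow if $x^*(\partial^+(U))<1+\tau$. Let $H=(V,E)$ be the undirected multigraph obtained from $(V,A)$ by forgetting the orientation of each arc (so that any two distinct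 vertices are joined by exactly two parallel edges, and $|E|=|A|$), and for $w\in\mathbb R^A$ let $\kappa(w)\in\mathbb R^E$ be the corresponding vector. The spanning tree polytope of $H$ is the convex hull of the characteristic vectors of the spanning trees of $H$. Then for every $\tau\in[0,1/4]$ there is a vector $z\in[0,1]^A$ such that \begin{enumerate} \item[(a)] $\kappa(z)$ lies in the spanning tree polytope of $H$; \item[(b)] $z_a\le \frac{1}{1-3\tau}\,x^*_a$ for every $a\in A$; \item[(c)] $z(\partial^+(U))=1$ and $z(\partial^-(U))=0$ for every $\tau$-narrow $s$-$t$ cut $U$. \end{enumerate} Moreover, such a $z$ can be found in polynomial time: there are a single algorithm and a polynomial $P$ such that for every $n$, all distinct $s,t\in V=\{0,\dots,n-1\}$, every rational $\tau\in[0,1/4]$ and every rational feasible $x^*$, the algorithm, given $n,s,t,\tau,x^*$ (each rational number as a numerator and a denominator in binary), outputs a rational vector $z\in[0,1]^A$ with (a), (b) and (c) in time at most $P(N)$, where $N$ is the binary length of the input. Time is measured on a random access machine with integer addition, subtraction, multiplication and division under logarithmic cost (every operation is charged the binary length of the numbers involved). -/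

import Mathlib

namespace ATSPP

/-! ### Arcs, cuts and the subtour elimination relaxation -/

/-- The arcs of the complete digraph on `V`: all ordered pairs of distinct vertices. -/
abbrev Arc (V : Type*) := {p : V × V // p.1 ≠ p.2}

section Graph

variable {V : Type*} [Fintype V] [DecidableEq V]

/-- `∂⁺(U)`: the arcs that leave `U`. -/
def outArcs (U : Finset V) : Finset (Arc V) :=
  Finset.univ.filter fun a => a.1.1 ∈ U ∧ a.1.2 ∉ U

/-- `∂⁻(U)`: the arcs that enter `U`. -/
def inArcs (U : Finset V) : Finset (Arc V) :=
  Finset.univ.filter fun a => a.1.1 ∉ U ∧ a.1.2 ∈ U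

/-- `x(B)`: the sum of `x` over a set of arcs `B`. -/
def mass (x : Arc V → ℝ) (B : Finset (Arc V)) : ℝ := ∑ a ∈ B, x a

/-- `x` is a feasible solution of the subtour elimination linear program for `s`-`t` paths. -/
structure IsFeasible (s t : V) (x : Arc V → ℝ) : Prop where
  out_s : mass x (outArcs {s}) = 1
  in_t : mass x (inArcs {t}) = 1
  in_s : mass x (inArcs {s}) = 0
  out_t : mass x (outArcs {t}) = 0
  out_v : ∀ v, v ≠ s → v ≠ t → mass x (outArcs {v}) = 1
  in_v : ∀ v, v ≠ s → v ≠ t → mass x (inArcs {v}) = 1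
  cut : ∀ U : Finset V, s ∈ U → U ≠ Finset.univ → 1 ≤ mass x (outArcs U)
  nonneg : ∀ a, 0 ≤ x a

/-- `U` is an `s`-`t` cut: `{s} ⊆ U ⊆ V \ {t}`. -/
def IsCut (s t : V) (U : Finset V) : Prop := s ∈ U ∧ t ∉ U

/-- `U` is a `τ`-narrow `s`-`t` cut with respect to `x`. -/
def IsNarrow (s t : V) (x : Arc V → ℝ) (τ : ℝ) (U : Finset V) : Prop :=
  IsCut s t U ∧ mass x (outArcs U) < 1 + τ

/-! ### The undirected multigraph and its spanning tree polytope -/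

/-- The edges of the undirected multigraph `H`: one edge for each arc, so that any two
distinct vertices `u`, `v` are joined by exactly two parallel edges. -/
abbrev Edge (V : Type*) := Arc V

/-- The unordered pair of end vertices of an edge of `H`. -/
def ends (e : Edge V) : Sym2 V := s(e.1.1, e.1.2)

/-- `T` is the edge set of a spanning tree of the multigraph `H`: it contains no two parallel
edges (these would form a cycle), and the simple graph on `V` that it forms is a tree. -/
def IsSpanningTree (T : Finset (Edge V)) : Prop :=
  Set.InjOn ends (T : Set (Edge V)) ∧
    (SimpleGraph.fromEdgeSet (ends '' (T : Set (Edge V)))).IsTree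

/-- The characteristic vector of a set of edges. -/
def chi (T : Finset (Edge V)) : Edge V → ℝ := fun e => if e ∈ T then 1 else 0

/-- The spanning tree polytope of `H`. -/
def spanningTreePolytope (V : Type*) [Fintype V] [DecidableEq V] : Set (Edge V → ℝ) :=
  convexHull ℝ {y | ∃ T : Finset (Edge V), IsSpanningTree T ∧ y = chi T}

/-- `κ(w)`: the undirected version of `w`. -/
def kappa (w : Arc V → ℝ) : Edge V → ℝ := fun e => w e

/-- `z` lies in `[0,1]^A`, its undirected version is in the spanning tree polytope of `H`, it is
dominated by `x / (1 - 3τ)`, and it crosses each `τ`-narrow `s`-`t` cut of `x` to an extent of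
exactly `1` forwards and `0` backwards. -/
structure IsTightened (s t : V) (x : Arc V → ℝ) (τ : ℝ) (z : Arc V → ℝ) : Prop where
  mem_Icc : ∀ a, z a ∈ Set.Icc (0 : ℝ) 1
  mem_polytope : kappa z ∈ spanningTreePolytope V
  le : ∀ a, z a ≤ 1 / (1 - 3 * τ) * x a
  out_narrow : ∀ U, IsNarrow s t x τ U → mass z (outArcs U) = 1
  in_narrow : ∀ U, IsNarrow s t x τ U → mass z (inArcs U) = 0

end Graph

/-! ### Random access programs with logarithmic cost

Programs act on integer variables and integer arrays. Every evaluation of a subexpression is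
charged the binary length of its value, so that a polynomial bound on the cost is a polynomial
bound on the running time of a Turing machine, and conversely. -/

/-- The binary length of an integer. -/
def bits (z : ℤ) : ℕ := Nat.size z.natAbs

/-- A memory: the variable `i` holds `var i`, the array `a` holds `arr a j` at the index `j`. -/
structure Mem where
  var : ℕ → ℤ
  arr : ℕ → ℤ → ℤ

/-- Integer expressions. -/
inductive Expr where
  | lit (c : ℤ)
  | var (i : ℕ)
  | get (a : ℕ) (e : Expr)
  | add (e f : Expr)
  | sub (e f : Expr)
  | mul (e f : Expr)
  | div (e f : Expr)

/-- The value of an expression. -/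
def Expr.eval (m : Mem) : Expr → ℤ
  | .lit c => c
  | .var i => m.var i
  | .get a e => m.arr a (e.eval m)
  | .add e f => e.eval m + f.eval m
  | .sub e f => e.eval m - f.eval m
  | .mul e f => e.eval m * f.eval m
  | .div e f => e.eval m / f.eval m

/-- The cost of evaluating an expression: each node costs `1` plus the binary length of its
value. -/
def Expr.cost (m : Mem) : Expr → ℕ
  | .lit c => 1 + bits c
  | .var i => 1 + bits (m.var i)
  | .get a e => 1 + bits (m.arr a (e.eval m)) + e.cost m
  | .add e f => 1 + bits (e.eval m + f.eval m) + e.cost m + f.cost m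
  | .sub e f => 1 + bits (e.eval m - f.eval m) + e.cost m + f.cost m
  | .mul e f => 1 + bits (e.eval m * f.eval m) + e.cost m + f.cost m
  | .div e f => 1 + bits (e.eval m / f.eval m) + e.cost m + f.cost m

/-- Programs. -/
inductive Prog where
  | skip
  | assign (i : ℕ) (e : Expr)
  | store (a : ℕ) (j e : Expr)
  | seq (p q : Prog)
  | ifPos (e : Expr) (p q : Prog)
  | whilePos (e : Expr) (p : Prog)

/-- The memory after the assignment `var i := v`. -/
def Mem.setVar (m : Mem) (i : ℕ) (v : ℤ) : Mem :=
  { m with var := Function.update m.var i v }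

/-- The memory after the assignment `arr a j := v`. -/
def Mem.setArr (m : Mem) (a : ℕ) (j v : ℤ) : Mem :=
  { m with arr := Function.update m.arr a (Function.update (m.arr a) j v) }

/-- `Runs p m c m'`: started in the memory `m`, the program `p` halts with the memory `m'`, at
the total cost `c`. -/
inductive Runs : Prog → Mem → ℕ → Mem → Prop where
  | skip (m : Mem) : Runs .skip m 1 m
  | assign (m : Mem) (i : ℕ) (e : Expr) :
      Runs (.assign i e) m (1 + e.cost m) (m.setVar i (e.eval m))
  | store (m : Mem) (a : ℕ) (j e : Expr) :
      Runs (.store a j e) m (1 + j.cost m + e.cost m) (m.setArr a (j.eval m) (e.eval m))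
  | seq {p q : Prog} {m m' m'' : Mem} {c d : ℕ} :
      Runs p m c m' → Runs q m' d m'' → Runs (.seq p q) m (c + d) m''
  | ifTrue {e : Expr} {p q : Prog} {m m' : Mem} {c : ℕ} :
      0 < e.eval m → Runs p m c m' → Runs (.ifPos e p q) m (1 + e.cost m + c) m'
  | ifFalse {e : Expr} {p q : Prog} {m m' : Mem} {c : ℕ} :
      ¬ 0 < e.eval m → Runs q m c m' → Runs (.ifPos e p q) m (1 + e.cost m + c) m'
  | whileTrue {e : Expr} {p : Prog} {m m' m'' : Mem} {c d : ℕ} :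
      0 < e.eval m → Runs p m c m' → Runs (.whilePos e p) m' d m'' →
      Runs (.whilePos e p) m (1 + e.cost m + c + d) m''
  | whileFalse {e : Expr} {p : Prog} {m : Mem} :
      ¬ 0 < e.eval m → Runs (.whilePos e p) m (1 + e.cost m) m

/-- The initial memory on the input `l`: the variable `0` holds the length of `l`, the array `0`
holds its entries, and everything else is `0`. -/
def Mem.init (l : List ℤ) : Mem where
  var i := if i = 0 then l.length else 0
  arr a j := if a = 0 ∧ 0 ≤ j then l.getD j.toNat 0 else 0

/-- The output in the memory `m` is `l`: the variable `0` holds the length of `l`, and the array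
`1` holds its entries. -/
def Mem.HasOutput (m : Mem) (l : List ℤ) : Prop :=
  m.var 0 = l.length ∧ ∀ i (h : i < l.length), m.arr 1 i = l[i]

/-- The binary length of an input. -/
def inputSize (l : List ℤ) : ℕ := (l.map fun z => 1 + bits z).sum

/-- On the input `l`, the program `p` outputs `l'` at a cost of at most `B`. -/
def Computes (p : Prog) (l l' : List ℤ) (B : ℕ) : Prop :=
  ∃ c m, Runs p (Mem.init l) c m ∧ m.HasOutput l' ∧ c ≤ B

/-! ### Encodings -/

/-- A rational number, given by a numerator and a positive denominator (not necessarily in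
lowest terms). -/
structure Frac where
  num : ℤ
  den : ℤ
  den_pos : 0 < den

/-- The value of a fraction. -/
noncomputable def Frac.val (r : Frac) : ℝ := r.num / r.den

/-- A vector of fractions on the arcs over `Fin n`, written row by row as an `n × n` matrix of
pairs (numerator, denominator), with `0 / 1` on the diagonal. -/
def encodeVec {n : ℕ} (x : Arc (Fin n) → Frac) : List ℤ :=
  (List.finRange n).flatMap fun u => (List.finRange n).flatMap fun v =>
    if h : u ≠ v then [(x ⟨(u, v), h⟩).num, (x ⟨(u, v), h⟩).den] else [0, 1]

/-- An input: the number of vertices, the vertices `s` and `t`, the fraction `τ`, the vector `x`. -/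
def encodeInput {n : ℕ} (s t : Fin n) (τ : Frac) (x : Arc (Fin n) → Frac) : List ℤ :=
  [(n : ℤ), ((s : ℕ) : ℤ), ((t : ℕ) : ℤ), τ.num, τ.den] ++ encodeVec x

end ATSPP

/-! Existence. Write c = 1/(1-3τ). If two narrow cuts U, W were incomparable, then U \ W and W \ U
would avoid both s and t, so each would have in-weight and out-weight at least 1. Posimodularity of
the undirected cut function would give 4 < 2 + 4τ, which is false. So the narrow cuts form a chain
and divide V into consecutive layers. Counting weights shows that a layer L carries at least |L| - 1
- 2τ inside (`PathLP.le_wt_layer`), and that the weight from a layer to the next one is at least 1 -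
3τ (`PathLP.le_wt_layer_layer`).

The vector z is built greedily inside the independence polytope of the graphic matroid, z(S) ≤ |S| -
1, below the cap c·x. Pairs inside layers are raised as far as possible first, and then pairs from a
layer to the next; everything else stays 0. Since c(1-2τ) ≥ 1, `tight_of_saturated` makes every
layer tight after the first round. In the second round the weight between consecutive layers is at
most 1, because the union of two tight layers must stay independent. It is at least 1, because
either all pairs are at their caps, of total c(1-3τ) = 1 or more, or some pair lies in a tight set,
and a tight set that meets both sides of a narrow cut carries weight at least 1 across it. Hence
each narrow cut is crossed by exactly 1 forwards and 0 backwards, unions of consecutive layers are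
tight, and by uncrossing V is tight (`PathLP.tightMatrix`). Edmonds' description of the spanning
tree polytope (`mem_spanningTreePolytope`) finishes: a separating hyperplane would contradict the
optimality of a maximum weight tree (`TreeOn.weight_le`).

Algorithm. The greedy argument works for any order of the pairs within a round, so it can be
executed. The layers are determined by the cardinalities of the sets below and above each vertex,
and these come from deciding for each pair (y, z) whether a narrow cut contains y but not z. That is
a minimum cut problem, and so is the computation of the slack min |S| - 1 - z(S) over the sets S
that contain a given pair. With a common denominator D of x and τ = p/q, the integers Dq·x serve as
capacities, D(q+p) as the threshold for narrow cuts, and M = D(q-3p) as the scale. Dividing by M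
instead of Dq applies the factor c, so the greedy algorithm stays integral at scale M. Minimum cuts
are found by capacity scaling (`minCut_spec`).

Running time. Nearly everything is written in a language of bounded loops with a total semantics,
whose products have a second factor that is a constant, a read-only variable or an input entry.
Numbers then gain a bounded number of bits per step, so that cost and size obey polynomial bounds
that compose (`Code.exists_polyBound`). The only other loop finds a power of two above the threshold
and is analysed directly (`runs_doubling`). -/

namespace ATSPP

/-! ### Spanning trees and the spanning tree polytope -/

section Trees

set_option linter.unusedSectionVars false

variable {V : Type*} [Fintype V] [DecidableEq V]

/-- The arc `a` joins the vertex sets `S₁` and `S₂`, in either direction. -/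
def Joins (a : Arc V) (S₁ S₂ : Finset V) : Prop :=
  (a.1.1 ∈ S₁ ∧ a.1.2 ∈ S₂) ∨ (a.1.1 ∈ S₂ ∧ a.1.2 ∈ S₁)

/-- `T` is the edge set of a tree with the vertex set `S`: trees are single vertices, or arise from
two disjoint trees by adding an edge that joins them. -/
inductive TreeOn : Finset (Arc V) → Finset V → Prop
  | single (v : V) : TreeOn ∅ {v}
  | join {T₁ T₂ : Finset (Arc V)} {S₁ S₂ : Finset V} (a : Arc V) :
      TreeOn T₁ S₁ → TreeOn T₂ S₂ → Disjoint S₁ S₂ → Joins a S₁ S₂ →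
      TreeOn (insert a (T₁ ∪ T₂)) (S₁ ∪ S₂)

lemma Joins.symm {a : Arc V} {S₁ S₂ : Finset V} (h : Joins a S₁ S₂) : Joins a S₂ S₁ := Or.symm h

lemma Joins.mono {a : Arc V} {S₁ S₂ R₁ R₂ : Finset V} (h : Joins a S₁ S₂) (h₁ : S₁ ⊆ R₁)
    (h₂ : S₂ ⊆ R₂) : Joins a R₁ R₂ := by
  rcases h with ⟨h, h'⟩ | ⟨h, h'⟩
  · exact Or.inl ⟨h₁ h, h₂ h'⟩
  · exact Or.inr ⟨h₂ h, h₁ h'⟩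

lemma Joins.mem_union {a : Arc V} {S₁ S₂ : Finset V} (h : Joins a S₁ S₂) :
    a.1.1 ∈ S₁ ∪ S₂ ∧ a.1.2 ∈ S₁ ∪ S₂ := by
  rcases h with ⟨h, h'⟩ | ⟨h, h'⟩ <;> simp [h, h']

lemma TreeOn.inside {T : Finset (Arc V)} {S : Finset V} (h : TreeOn T S) :
    ∀ a ∈ T, a.1.1 ∈ S ∧ a.1.2 ∈ S := by
  induction h with
  | single v => simp
  | join a _ _ _ ha ih₁ ih₂ =>
    intro b hb
    rcases Finset.mem_insert.1 hb with rfl | hb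
    · exact ha.mem_union
    rcases Finset.mem_union.1 hb with hb | hb
    · exact ⟨Finset.mem_union_left _ (ih₁ b hb).1, Finset.mem_union_left _ (ih₁ b hb).2⟩
    · exact ⟨Finset.mem_union_right _ (ih₂ b hb).1, Finset.mem_union_right _ (ih₂ b hb).2⟩

lemma not_joins_of_mem {a : Arc V} {S₁ S₂ : Finset V} (hd : Disjoint S₁ S₂)
    (h : Joins a S₁ S₂) : ¬ (a.1.1 ∈ S₁ ∧ a.1.2 ∈ S₁) ∧ ¬ (a.1.1 ∈ S₂ ∧ a.1.2 ∈ S₂) := by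
  have := Finset.disjoint_left.1 hd
  rcases h with ⟨h, h'⟩ | ⟨h, h'⟩
  · exact ⟨fun g => this g.2 h', fun g => this h g.1⟩
  · exact ⟨fun g => this g.1 h, fun g => this h' g.2⟩

lemma TreeOn.not_mem_join {T₁ T₂ : Finset (Arc V)} {S₁ S₂ : Finset V} {a : Arc V}
    (h₁ : TreeOn T₁ S₁) (h₂ : TreeOn T₂ S₂) (hd : Disjoint S₁ S₂) (ha : Joins a S₁ S₂) :
    a ∉ T₁ ∪ T₂ := by
  intro h
  rcases Finset.mem_union.1 h with h | h
  · exact (not_joins_of_mem hd ha).1 (h₁.inside a h)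
  · exact (not_joins_of_mem hd ha).2 (h₂.inside a h)

lemma TreeOn.disjoint {T₁ T₂ : Finset (Arc V)} {S₁ S₂ : Finset V}
    (h₁ : TreeOn T₁ S₁) (h₂ : TreeOn T₂ S₂) (hd : Disjoint S₁ S₂) : Disjoint T₁ T₂ :=
  Finset.disjoint_left.2 fun a h h' =>
    Finset.disjoint_left.1 hd (h₁.inside a h).1 (h₂.inside a h').1

/-- A sum over the edges of a join of two trees. -/
lemma TreeOn.sum_join {T₁ T₂ : Finset (Arc V)} {S₁ S₂ : Finset V} {a : Arc V}
    (h₁ : TreeOn T₁ S₁) (h₂ : TreeOn T₂ S₂) (hd : Disjoint S₁ S₂) (ha : Joins a S₁ S₂)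
    {M : Type*} [AddCommMonoid M] (c : Arc V → M) :
    ∑ b ∈ insert a (T₁ ∪ T₂), c b = c a + (∑ b ∈ T₁, c b + ∑ b ∈ T₂, c b) := by
  rw [Finset.sum_insert (h₁.not_mem_join h₂ hd ha), Finset.sum_union (h₁.disjoint h₂ hd)]

lemma TreeOn.card {T : Finset (Arc V)} {S : Finset V} (h : TreeOn T S) :
    T.card + 1 = S.card := by
  induction h with
  | single v => simp
  | join a h₁ h₂ hd ha ih₁ ih₂ =>
    rw [Finset.card_insert_of_notMem (h₁.not_mem_join h₂ hd ha),
      Finset.card_union_of_disjoint (h₁.disjoint h₂ hd), Finset.card_union_of_disjoint hd]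
    omega

lemma TreeOn.nonempty {T : Finset (Arc V)} {S : Finset V} (h : TreeOn T S) : S.Nonempty := by
  rw [← Finset.card_pos, ← h.card]; omega

/-- Removing an edge of a tree leaves two trees. -/
lemma TreeOn.split {T : Finset (Arc V)} {S : Finset V} (h : TreeOn T S) :
    ∀ a ∈ T, ∃ T₁ T₂ S₁ S₂, TreeOn T₁ S₁ ∧ TreeOn T₂ S₂ ∧ Disjoint S₁ S₂ ∧ Joins a S₁ S₂ ∧
      T = insert a (T₁ ∪ T₂) ∧ S = S₁ ∪ S₂ := by
  induction h with
  | single v => simp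
  | @join T₁ T₂ S₁ S₂ b h₁ h₂ hd hb ih₁ ih₂ =>
    -- When the removed edge `a` lies in the first tree, the old joining edge `b` has its end there
    -- in one of the two pieces. The second tree is attached to that piece by `b`. The other case is
    -- symmetric.
    have key : ∀ {T₁ T₂ : Finset (Arc V)} {S₁ S₂ : Finset V} (a b : Arc V), TreeOn T₁ S₁ →
        TreeOn T₂ S₂ → Disjoint S₁ S₂ → Joins b S₁ S₂ →
        (∃ P₁ P₂ R₁ R₂, TreeOn P₁ R₁ ∧ TreeOn P₂ R₂ ∧ Disjoint R₁ R₂ ∧ Joins a R₁ R₂ ∧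
          T₁ = insert a (P₁ ∪ P₂) ∧ S₁ = R₁ ∪ R₂) →
        ∃ P₁ P₂ R₁ R₂, TreeOn P₁ R₁ ∧ TreeOn P₂ R₂ ∧ Disjoint R₁ R₂ ∧ Joins a R₁ R₂ ∧
          insert b (T₁ ∪ T₂) = insert a (P₁ ∪ P₂) ∧ S₁ ∪ S₂ = R₁ ∪ R₂ := by
      rintro T₁ T₂ S₁ S₂ a b - h₂ hd hb ⟨P₁, P₂, R₁, R₂, p₁, p₂, hR, ha, rfl, rfl⟩
      rw [Finset.disjoint_union_left] at hd
      have hb' : Joins b R₁ S₂ ∨ Joins b R₂ S₂ := by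
        unfold Joins at hb ⊢
        simp only [Finset.mem_union] at hb
        tauto
      rcases hb' with hb' | hb'
      · refine ⟨_, _, _, _, .join b p₁ h₂ hd.1 hb', p₂, ?_,
          ha.mono Finset.subset_union_left subset_rfl, ?_, ?_⟩
        · rw [Finset.disjoint_union_left]; exact ⟨hR, hd.2.symm⟩
        · ext x; simp only [Finset.mem_insert, Finset.mem_union]; tauto
        · ext x; simp only [Finset.mem_union]; tauto
      · refine ⟨_, _, _, _, p₁, .join b p₂ h₂ hd.2 hb', ?_,
          ha.mono subset_rfl Finset.subset_union_left, ?_, ?_⟩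
        · rw [Finset.disjoint_union_right]; exact ⟨hR, hd.1⟩
        · ext x; simp only [Finset.mem_insert, Finset.mem_union]; tauto
        · ext x; simp only [Finset.mem_union]; tauto
    intro a ha
    rcases Finset.mem_insert.1 ha with rfl | ha
    · exact ⟨_, _, _, _, h₁, h₂, hd, hb, rfl, rfl⟩
    rcases Finset.mem_union.1 ha with ha | ha
    · exact key a b h₁ h₂ hd hb (ih₁ a ha)
    · rw [Finset.union_comm T₁, Finset.union_comm S₁]
      exact key a b h₂ h₁ hd.symm hb.symm (ih₂ a ha)

lemma exists_treeOn {S : Finset V} (hS : S.Nonempty) : ∃ T, TreeOn T S := by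
  induction hS using Finset.Nonempty.cons_induction with
  | singleton v => exact ⟨∅, .single v⟩
  | cons v S hv hS ih =>
    obtain ⟨T, hT⟩ := ih
    obtain ⟨w, hw⟩ := hS
    have hne : v ≠ w := fun h => hv (h ▸ hw)
    have := TreeOn.join ⟨(v, w), hne⟩ (.single v) hT (Finset.disjoint_singleton_left.2 hv)
      (Or.inl ⟨Finset.mem_singleton_self v, hw⟩)
    rw [Finset.cons_eq_insert, Finset.insert_eq]
    exact ⟨_, this⟩

/-- Parallel edges lie inside the same vertex sets. The edges of the two joined trees lie inside
disjoint sets and the joining edge lies inside neither, so a join creates no parallel pair. -/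
lemma TreeOn.injOn_ends {T : Finset (Arc V)} {S : Finset V} (h : TreeOn T S) :
    Set.InjOn ends (T : Set (Arc V)) := by
  have swap : ∀ {a b : Arc V} {R : Finset V}, ends a = ends b → a.1.1 ∈ R ∧ a.1.2 ∈ R →
      b.1.1 ∈ R ∧ b.1.2 ∈ R := by
    intro a b R hab ha
    rcases Sym2.eq_iff.1 hab with ⟨h, h'⟩ | ⟨h, h'⟩
    · rw [← h, ← h']; exact ha
    · rw [← h, ← h']; exact ha.symm
  induction h with
  | single v => simp
  | @join T₁ T₂ S₁ S₂ b h₁ h₂ hd hb ih₁ ih₂ =>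
    have hn := not_joins_of_mem hd hb
    have hdis := Finset.disjoint_left.1 hd
    intro x hx y hy hxy
    simp only [Finset.coe_insert, Finset.coe_union, Set.mem_insert_iff, Set.mem_union,
      Finset.mem_coe] at hx hy
    rcases hx with rfl | hx | hx <;> rcases hy with rfl | hy | hy
    · rfl
    · exact absurd (swap hxy.symm (h₁.inside y hy)) hn.1
    · exact absurd (swap hxy.symm (h₂.inside y hy)) hn.2
    · exact absurd (swap hxy (h₁.inside x hx)) hn.1
    · exact ih₁ hx hy hxy
    · exact absurd (h₂.inside y hy).1 (hdis (swap hxy (h₁.inside x hx)).1)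
    · exact absurd (swap hxy (h₂.inside x hx)) hn.2
    · exact absurd (swap hxy (h₂.inside x hx)).1 (hdis (h₁.inside y hy).1)
    · exact ih₂ hx hy hxy

lemma TreeOn.reachable {T : Finset (Arc V)} {S : Finset V} (h : TreeOn T S) :
    ∀ u ∈ S, ∀ v ∈ S, (SimpleGraph.fromEdgeSet (ends '' (T : Set (Arc V)))).Reachable u v := by
  induction h with
  | single v => intro u hu w hw; rw [Finset.mem_singleton.1 hu, Finset.mem_singleton.1 hw]
  | @join T₁ T₂ S₁ S₂ b h₁ h₂ hd hb ih₁ ih₂ =>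
    set G := SimpleGraph.fromEdgeSet (ends '' ((insert b (T₁ ∪ T₂) : Finset (Arc V)) :
      Set (Arc V))) with hG
    have e₁ : ∀ u ∈ S₁, ∀ v ∈ S₁, G.Reachable u v := fun u hu v hv =>
      (ih₁ u hu v hv).mono (SimpleGraph.fromEdgeSet_mono (Set.image_mono (by
        intro x hx; simp only [Finset.mem_coe] at hx ⊢; simp [hx])))
    have e₂ : ∀ u ∈ S₂, ∀ v ∈ S₂, G.Reachable u v := fun u hu v hv =>
      (ih₂ u hu v hv).mono (SimpleGraph.fromEdgeSet_mono (Set.image_mono (by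
        intro x hx; simp only [Finset.mem_coe] at hx ⊢; simp [hx])))
    have eb : G.Reachable b.1.1 b.1.2 := by
      apply SimpleGraph.Adj.reachable
      rw [hG, SimpleGraph.fromEdgeSet_adj]
      exact ⟨⟨b, by simp, rfl⟩, b.2⟩
    have e₁₂ : ∀ u ∈ S₁, ∀ v ∈ S₂, G.Reachable u v := by
      intro u hu v hv
      rcases hb with ⟨h, h'⟩ | ⟨h, h'⟩
      · exact ((e₁ u hu _ h).trans eb).trans (e₂ _ h' v hv)
      · exact ((e₁ u hu _ h').trans eb.symm).trans (e₂ _ h v hv)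
    intro u hu v hv
    rcases Finset.mem_union.1 hu with hu | hu <;> rcases Finset.mem_union.1 hv with hv | hv
    · exact e₁ u hu v hv
    · exact e₁₂ u hu v hv
    · exact (e₁₂ v hv u hu).symm
    · exact e₂ u hu v hv

/-- Uses the characterisation of trees as connected graphs with |V| - 1 edges; `injOn_ends` ensures
that passing to unordered pairs loses no edge. -/
lemma TreeOn.isSpanningTree {T : Finset (Arc V)} (h : TreeOn T Finset.univ) :
    IsSpanningTree T := by
  have : Nonempty V := h.nonempty.to_type
  refine ⟨h.injOn_ends, SimpleGraph.isTree_iff_connected_and_card.2 ⟨?_, ?_⟩⟩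
  · exact ⟨fun u v => h.reachable u (Finset.mem_univ u) v (Finset.mem_univ v)⟩
  · have hs : (SimpleGraph.fromEdgeSet (ends '' (T : Set (Arc V)))).edgeSet =
        ends '' (T : Set (Arc V)) := by
      rw [SimpleGraph.edgeSet_fromEdgeSet, sdiff_eq_left, Set.disjoint_left]
      rintro _ ⟨a, -, rfl⟩ hd
      exact a.2 (by simpa [ends, Sym2.mk_isDiag_iff] using hd)
    rw [hs, Nat.card_coe_set_eq, h.injOn_ends.ncard_image, Set.ncard_coe_finset,
      h.card, Finset.card_univ, Nat.card_eq_fintype_card]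

/-- The arcs with both ends in `S`. -/
def insideArcs (S : Finset V) : Finset (Arc V) :=
  Finset.univ.filter fun a => a.1.1 ∈ S ∧ a.1.2 ∈ S

/-- `z` satisfies the rank inequalities of the graphic matroid. -/
def RankBounded (z : Arc V → ℝ) : Prop :=
  ∀ S : Finset V, S.Nonempty → mass z (insideArcs S) ≤ (S.card : ℝ) - 1

/-- A tree on `S` of maximum weight dominates every vector that satisfies the rank inequalities. -/
lemma TreeOn.weight_le {z : Arc V → ℝ} (hz : ∀ a, 0 ≤ z a) (hr : RankBounded z)
    (c : Arc V → ℝ) : ∀ (k : ℕ) (T : Finset (Arc V)) (S : Finset V), T.card = k → TreeOn T S →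
    (∀ T', TreeOn T' S → ∑ a ∈ T', c a ≤ ∑ a ∈ T, c a) → ∀ η : ℝ, (∀ a ∈ T, η ≤ c a) →
    ∑ a ∈ insideArcs S, (c a - η) * z a ≤ ∑ a ∈ T, (c a - η) := by
  intro k
  induction k using Nat.strong_induction_on with
  | _ k ih =>
  intro T S hk hT hopt η hη
  rcases T.eq_empty_or_nonempty with rfl | hne
  · have hS : S.card = 1 := by have := hT.card; simpa using this.symm
    obtain ⟨v, rfl⟩ := Finset.card_eq_one.1 hS
    have : insideArcs ({v} : Finset V) = ∅ := by
      rw [insideArcs, Finset.filter_eq_empty_iff]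
      rintro a - ⟨h, h'⟩
      exact a.2 ((Finset.mem_singleton.1 h).trans (Finset.mem_singleton.1 h').symm)
    simp [this]
  obtain ⟨a, haT, hmin⟩ := Finset.exists_min_image T c hne
  obtain ⟨T₁, T₂, S₁, S₂, h₁, h₂, hd, ha, rfl, rfl⟩ := hT.split a haT
  have hc1 : T₁.card + T₂.card + 1 = k := by
    rw [← hk, Finset.card_insert_of_notMem (h₁.not_mem_join h₂ hd ha),
      Finset.card_union_of_disjoint (h₁.disjoint h₂ hd)]
  -- A heavier tree on one side could be exchanged for the present one inside the whole tree, and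
  -- likewise (`cross`) a heavier joining edge for `a`.
  have opt₁ : ∀ T', TreeOn T' S₁ → ∑ b ∈ T', c b ≤ ∑ b ∈ T₁, c b := by
    intro T' hT'
    have := hopt _ (.join a hT' h₂ hd ha)
    rw [hT'.sum_join h₂ hd ha, h₁.sum_join h₂ hd ha] at this
    linarith
  have opt₂ : ∀ T', TreeOn T' S₂ → ∑ b ∈ T', c b ≤ ∑ b ∈ T₂, c b := by
    intro T' hT'
    have := hopt _ (.join a h₁ hT' hd ha)
    rw [h₁.sum_join hT' hd ha, h₁.sum_join h₂ hd ha] at this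
    linarith
  have cross : ∀ b, Joins b S₁ S₂ → c b ≤ c a := by
    intro b hb
    have := hopt _ (.join b h₁ h₂ hd hb)
    rw [h₁.sum_join h₂ hd hb, h₁.sum_join h₂ hd ha] at this
    linarith
  -- Induction with the threshold `c a`, which is admissible since `a` is a lightest edge. With this
  -- threshold the edges across contribute at most 0.
  have i₁ := ih T₁.card (by omega) T₁ S₁ rfl h₁ opt₁ (c a) fun b hb => hmin b (by simp [hb])
  have i₂ := ih T₂.card (by omega) T₂ S₂ rfl h₂ opt₂ (c a) fun b hb => hmin b (by simp [hb])
  have hdis := Finset.disjoint_left.1 hd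
  have hin : ∑ b ∈ insideArcs (S₁ ∪ S₂), (c b - c a) * z b ≤
      ∑ b ∈ insideArcs S₁, (c b - c a) * z b + ∑ b ∈ insideArcs S₂, (c b - c a) * z b := by
    have hdi : Disjoint (insideArcs S₁) (insideArcs S₂) := by
      rw [Finset.disjoint_left]
      intro b hb hb'
      simp only [insideArcs, Finset.mem_filter] at hb hb'
      exact hdis hb.2.1 hb'.2.1
    rw [← Finset.sum_union hdi]
    have hsub : insideArcs S₁ ∪ insideArcs S₂ ⊆ insideArcs (S₁ ∪ S₂) := by
      intro b hb
      simp only [insideArcs, Finset.mem_filter, Finset.mem_union, Finset.mem_univ, true_and] at hb ⊢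
      tauto
    rw [← Finset.sum_sdiff hsub, add_le_iff_nonpos_left]
    refine Finset.sum_nonpos fun b hb => ?_
    have hb' : Joins b S₁ S₂ := by
      simp only [insideArcs, Finset.mem_filter, Finset.mem_union, Finset.mem_sdiff, Finset.mem_univ,
        true_and] at hb
      unfold Joins
      tauto
    exact mul_nonpos_of_nonpos_of_nonneg (by linarith [cross b hb']) (hz b)
  have hrank := hr (S₁ ∪ S₂) hT.nonempty
  have hη' : η ≤ c a := hη a (by simp)
  -- Lowering the threshold from `c a` to `η` adds (c a - η) z(S) on the left and (c a - η)(|S| - 1)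
  -- on the right, so the rank inequality of S completes the step.
  have e1 : ∑ b ∈ insideArcs (S₁ ∪ S₂), (c b - η) * z b =
      ∑ b ∈ insideArcs (S₁ ∪ S₂), (c b - c a) * z b + (c a - η) * mass z (insideArcs (S₁ ∪ S₂)) := by
    rw [mass, Finset.mul_sum, ← Finset.sum_add_distrib]
    exact Finset.sum_congr rfl fun b _ => by ring
  have e2 : ∑ b ∈ insert a (T₁ ∪ T₂), (c b - η) =
      (∑ b ∈ T₁, (c b - c a) + ∑ b ∈ T₂, (c b - c a)) +
        (c a - η) * (((S₁ ∪ S₂).card : ℝ) - 1) := by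
    have hc : ((S₁ ∪ S₂).card : ℝ) - 1 = ∑ b ∈ insert a (T₁ ∪ T₂), (1 : ℝ) := by
      rw [← hT.card]; simp
    rw [hc, Finset.mul_sum]
    have := h₁.sum_join h₂ hd ha fun b => c b - c a
    rw [sub_self, zero_add] at this
    rw [← this, ← Finset.sum_add_distrib]
    exact Finset.sum_congr rfl fun b _ => by ring
  rw [e1, e2]
  have := mul_le_mul_of_nonneg_left hrank (sub_nonneg.2 hη')
  linarith

/-- A nonnegative vector that satisfies the rank inequalities, the one for `V` with equality, lies in
the spanning tree polytope. -/
theorem mem_spanningTreePolytope [Nonempty V] {z : Arc V → ℝ} (hz : ∀ a, 0 ≤ z a)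
    (hr : RankBounded z) (htot : mass z Finset.univ = (Fintype.card V : ℝ) - 1) :
    z ∈ spanningTreePolytope V := by
  by_contra hmem
  -- Finiteness makes the convex hull closed, as the strict separation theorem requires.
  have hfin : {y : Edge V → ℝ | ∃ T : Finset (Edge V), IsSpanningTree T ∧ y = chi T}.Finite := by
    refine (Set.finite_range (chi (V := V))).subset ?_
    rintro _ ⟨T, -, rfl⟩
    exact ⟨T, rfl⟩
  obtain ⟨f, u, hf, hu⟩ := geometric_hahn_banach_closed_point (convex_convexHull ℝ _)
    (hfin.isClosed_convexHull (𝕜 := ℝ)) hmem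
  set c : Arc V → ℝ := fun a => f (Pi.single a 1) with hc
  have hfy : ∀ y : Edge V → ℝ, f y = ∑ a, c a * y a := by
    intro y
    have := LinearMap.pi_apply_eq_sum_univ (f : (Edge V → ℝ) →ₗ[ℝ] ℝ) y
    rw [ContinuousLinearMap.coe_coe] at this
    rw [this]
    refine Finset.sum_congr rfl fun a _ => ?_
    rw [smul_eq_mul, mul_comm, hc]
    congr 2
    ext b
    simp [Pi.single_apply, eq_comm]
  classical
  obtain ⟨T, hT, hopt⟩ : ∃ T : Finset (Arc V), TreeOn T Finset.univ ∧
      ∀ T', TreeOn T' Finset.univ → ∑ a ∈ T', c a ≤ ∑ a ∈ T, c a := by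
    obtain ⟨T₀, hT₀⟩ := exists_treeOn (Finset.univ_nonempty (α := V))
    obtain ⟨T, hT, hmax⟩ := Finset.exists_max_image
      (Finset.univ.filter fun T : Finset (Arc V) => TreeOn T Finset.univ)
      (fun T => ∑ a ∈ T, c a) ⟨T₀, by simp [hT₀]⟩
    exact ⟨T, (Finset.mem_filter.1 hT).2, fun T' hT' => hmax T' (by simp [hT'])⟩
  -- Any lower bound serves: `z` and every tree have total |V| - 1, so the terms with `η` cancel.
  obtain ⟨η, hη⟩ : ∃ η, ∀ a, η ≤ c a := by
    obtain ⟨η, hη⟩ := (Set.finite_range c).bddBelow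
    exact ⟨η, fun a => hη ⟨a, rfl⟩⟩
  have hle := hT.weight_le hz hr c T.card T _ rfl hopt η fun a _ => hη a
  have hins : insideArcs (Finset.univ : Finset V) = Finset.univ := by ext; simp [insideArcs]
  rw [hins] at hle
  have h1 : ∑ a, (c a - η) * z a = f z - η * ((Fintype.card V : ℝ) - 1) := by
    rw [hfy, ← htot, mass, Finset.mul_sum, ← Finset.sum_sub_distrib]
    exact Finset.sum_congr rfl fun a _ => by ring
  have h2 : ∑ a ∈ T, (c a - η) = f (chi T) - η * ((Fintype.card V : ℝ) - 1) := by
    have hcT : (Fintype.card V : ℝ) - 1 = T.card := by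
      rw [← Finset.card_univ, ← hT.card]; simp
    rw [Finset.sum_sub_distrib, hfy, hcT, Finset.sum_const, nsmul_eq_mul]
    simp only [chi, mul_ite, mul_one, mul_zero, Finset.sum_ite_mem, Finset.univ_inter]
    ring
  have h3 := hf (chi T) (subset_convexHull ℝ _ ⟨T, hT.isSpanningTree, rfl⟩)
  linarith

end Trees

/-! ### Weights between vertex sets -/

section Weights

set_option linter.unusedSectionVars false

variable {V : Type*} [Fintype V] [DecidableEq V]

/-- The total weight of the pairs from `A` to `B`. -/
def wt (X : V → V → ℝ) (A B : Finset V) : ℝ := ∑ u ∈ A, ∑ v ∈ B, X u v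

/-- A vector on the arcs as a matrix with zero diagonal. -/
def toMat (x : Arc V → ℝ) (u v : V) : ℝ := if h : u ≠ v then x ⟨(u, v), h⟩ else 0

lemma wt_eq_sum (X : V → V → ℝ) (A B : Finset V) :
    wt X A B = ∑ u, ∑ v, if u ∈ A ∧ v ∈ B then X u v else 0 := by
  unfold wt
  rw [← Finset.sum_filter_add_sum_filter_not Finset.univ (· ∈ A)]
  rw [Finset.filter_univ_mem, Finset.sum_congr (g := fun _ => 0)
    (s₁ := Finset.univ.filter fun x => ¬ x ∈ A) rfl, Finset.sum_const_zero, add_zero]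
  · refine Finset.sum_congr rfl fun u hu => ?_
    simp [hu]
  · intro u hu
    simp [(Finset.mem_filter.1 hu).2]

lemma wt_nonneg {X : V → V → ℝ} (hX : ∀ u v, 0 ≤ X u v) (A B : Finset V) : 0 ≤ wt X A B :=
  Finset.sum_nonneg fun u _ => Finset.sum_nonneg fun v _ => hX u v

lemma wt_mono {X : V → V → ℝ} (hX : ∀ u v, 0 ≤ X u v) {A B A' B' : Finset V} (hA : A ⊆ A')
    (hB : B ⊆ B') : wt X A B ≤ wt X A' B' :=
  (Finset.sum_le_sum fun u _ => Finset.sum_le_sum_of_subset_of_nonneg hB fun v _ _ => hX u v).trans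
    (Finset.sum_le_sum_of_subset_of_nonneg hA fun u _ _ => Finset.sum_nonneg fun v _ => hX u v)

lemma wt_congr {X Y : V → V → ℝ} {A B : Finset V} (h : ∀ u ∈ A, ∀ v ∈ B, X u v = Y u v) :
    wt X A B = wt Y A B :=
  Finset.sum_congr rfl fun u hu => Finset.sum_congr rfl fun v hv => h u hu v hv

lemma wt_eq_zero {X : V → V → ℝ} {A B : Finset V} (h : ∀ u ∈ A, ∀ v ∈ B, X u v = 0) :
    wt X A B = 0 :=
  Finset.sum_eq_zero fun u hu => Finset.sum_eq_zero fun v hv => h u hu v hv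

lemma wt_union_left (X : V → V → ℝ) {A B : Finset V} (h : Disjoint A B) (C : Finset V) :
    wt X (A ∪ B) C = wt X A C + wt X B C := Finset.sum_union h

lemma wt_union_right (X : V → V → ℝ) (A : Finset V) {B C : Finset V} (h : Disjoint B C) :
    wt X A (B ∪ C) = wt X A B + wt X A C := by
  unfold wt
  rw [← Finset.sum_add_distrib]
  exact Finset.sum_congr rfl fun u _ => Finset.sum_union h

lemma wt_comm (X : V → V → ℝ) (A B : Finset V) : wt X A B = ∑ v ∈ B, ∑ u ∈ A, X u v :=
  Finset.sum_comm

lemma wt_union_self (X : V → V → ℝ) {A B : Finset V} (h : Disjoint A B) :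
    wt X (A ∪ B) (A ∪ B) = wt X A A + wt X B B + wt X A B + wt X B A := by
  rw [wt_union_left X h, wt_union_right X A h, wt_union_right X B h]; ring

lemma wt_compl_left (X : V → V → ℝ) (A B : Finset V) :
    wt X A B + wt X Aᶜ B = wt X Finset.univ B := by
  rw [← wt_union_left X disjoint_compl_right, Finset.union_compl]

lemma wt_compl_right (X : V → V → ℝ) (A B : Finset V) :
    wt X A B + wt X A Bᶜ = wt X A Finset.univ := by
  rw [← wt_union_right X A disjoint_compl_right, Finset.union_compl]

lemma sum_arcs_filter (x : Arc V → ℝ) (A B : Finset V) :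
    ∑ a ∈ Finset.univ.filter (fun a : Arc V => a.1.1 ∈ A ∧ a.1.2 ∈ B), x a =
      wt (toMat x) A B := by
  have h1 : wt (toMat x) A B = ∑ p ∈ (A ×ˢ B).filter fun p => p.1 ≠ p.2,
      toMat x p.1 p.2 := by
    rw [wt, ← Finset.sum_product', Finset.sum_filter]
    refine Finset.sum_congr rfl fun p _ => ?_
    split_ifs with h
    · rfl
    · simp [toMat, h]
  rw [h1]
  refine Finset.sum_bij (fun a _ => a.1) ?_ ?_ ?_ ?_
  · intro a ha
    simp only [Finset.mem_filter, Finset.mem_univ, true_and] at ha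
    simp only [Finset.mem_filter, Finset.mem_product]
    exact ⟨ha, a.2⟩
  · intro a _ b _ h
    exact Subtype.ext h
  · intro p hp
    simp only [Finset.mem_filter, Finset.mem_product] at hp
    exact ⟨⟨p, hp.2⟩, by simp [hp.1], rfl⟩
  · intro a _
    have := a.2
    simp only [toMat, ne_eq, this, not_false_eq_true, dite_true]

lemma mass_outArcs (x : Arc V → ℝ) (U : Finset V) : mass x (outArcs U) = wt (toMat x) U Uᶜ := by
  rw [← sum_arcs_filter]; simp [mass, outArcs]

lemma mass_inArcs (x : Arc V → ℝ) (U : Finset V) : mass x (inArcs U) = wt (toMat x) Uᶜ U := by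
  rw [← sum_arcs_filter]; simp [mass, inArcs]

lemma mass_insideArcs (x : Arc V → ℝ) (U : Finset V) :
    mass x (insideArcs U) = wt (toMat x) U U := by
  rw [← sum_arcs_filter]; rfl

lemma toMat_self (x : Arc V → ℝ) (v : V) : toMat x v v = 0 := by simp [toMat]

lemma toMat_of_ne (x : Arc V → ℝ) {u v : V} (h : u ≠ v) : toMat x u v = x ⟨(u, v), h⟩ := by
  simp [toMat, h]

end Weights

/-! ### Narrow cuts -/

section Narrow

set_option linter.unusedSectionVars false

variable {V : Type*} [Fintype V] [DecidableEq V]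

/-- The constraints of the subtour elimination linear program, for a matrix. -/
structure PathLP (s t : V) (X : V → V → ℝ) : Prop where
  nonneg : ∀ u v, 0 ≤ X u v
  diag : ∀ v, X v v = 0
  in_one : ∀ v, v ≠ s → wt X Finset.univ {v} = 1
  in_s : wt X Finset.univ {s} = 0
  out_one : ∀ v, v ≠ t → wt X {v} Finset.univ = 1
  out_t : wt X {t} Finset.univ = 0
  cut : ∀ U : Finset V, s ∈ U → U ≠ Finset.univ → 1 ≤ wt X U Uᶜ

lemma IsFeasible.pathLP {s t : V} {x : Arc V → ℝ} (h : IsFeasible s t x) :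
    PathLP s t (toMat x) := by
  have hin : ∀ v, wt (toMat x) Finset.univ {v} = mass x (inArcs {v}) := by
    intro v
    rw [mass_inArcs, ← wt_compl_left _ {v}, add_eq_right]
    simp [wt, toMat_self]
  have hout : ∀ v, wt (toMat x) {v} Finset.univ = mass x (outArcs {v}) := by
    intro v
    rw [mass_outArcs, ← wt_compl_right _ _ {v}, add_eq_right]
    simp [wt, toMat_self]
  refine ⟨fun u v => ?_, toMat_self x, fun v hv => ?_, ?_, fun v hv => ?_, ?_, fun U hs hU => ?_⟩
  · unfold toMat
    split_ifs
    · exact h.nonneg _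
    · exact le_rfl
  · rw [hin]
    by_cases hvt : v = t
    · rw [hvt]; exact h.in_t
    · exact h.in_v v hv hvt
  · rw [hin]; exact h.in_s
  · rw [hout]
    by_cases hvs : v = s
    · rw [hvs]; exact h.out_s
    · exact h.out_v v hvs hv
  · rw [hout]; exact h.out_t
  · rw [← mass_outArcs]; exact h.cut U hs hU

/-- The `τ`-narrow `s`-`t` cuts of a matrix. -/
def narrowCuts (s t : V) (X : V → V → ℝ) (τ : ℝ) : Set (Finset V) :=
  {U | s ∈ U ∧ t ∉ U ∧ wt X U Uᶜ < 1 + τ}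

lemma isNarrow_iff {s t : V} {x : Arc V → ℝ} {τ : ℝ} {U : Finset V} :
    IsNarrow s t x τ U ↔ U ∈ narrowCuts s t (toMat x) τ := by
  rw [IsNarrow, mass_outArcs, IsCut, and_assoc]; rfl

namespace PathLP

variable {s t : V} {X : V → V → ℝ} (h : PathLP s t X)

include h

/-! ### Flow conservation and its consequences for cuts -/

lemma in_total (S : Finset V) :
    wt X Finset.univ S = (S.card : ℝ) - if s ∈ S then 1 else 0 := by
  have e : ∀ v, ∑ u, X u v = 1 - if v = s then 1 else 0 := by
    intro v
    have : ∑ u, X u v = wt X Finset.univ {v} := by simp [wt]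
    rw [this]
    split_ifs with hv
    · rw [hv, h.in_s]; norm_num
    · rw [h.in_one v hv]; norm_num
  rw [wt_comm, Finset.sum_congr rfl fun v _ => e v, Finset.sum_sub_distrib]
  simp

lemma out_total (S : Finset V) :
    wt X S Finset.univ = (S.card : ℝ) - if t ∈ S then 1 else 0 := by
  have e : ∀ v, ∑ u, X v u = 1 - if v = t then 1 else 0 := by
    intro v
    have : ∑ u, X v u = wt X {v} Finset.univ := by simp [wt]
    rw [this]
    split_ifs with hv
    · rw [hv, h.out_t]; norm_num
    · rw [h.out_one v hv]; norm_num
  rw [wt, Finset.sum_congr rfl fun v _ => e v, Finset.sum_sub_distrib]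
  simp

lemma out_sub_in (S : Finset V) : wt X S Sᶜ - wt X Sᶜ S =
    (if s ∈ S then 1 else 0) - if t ∈ S then 1 else 0 := by
  have h1 := h.in_total S
  have h2 := h.out_total S
  have h3 := wt_compl_left X S S
  have h4 := wt_compl_right X S S
  linarith

lemma one_le_in {S : Finset V} (hS : S.Nonempty) (hs : s ∉ S) : 1 ≤ wt X Sᶜ S := by
  have := h.cut Sᶜ (Finset.mem_compl.2 hs) (by
    rw [ne_eq, Finset.compl_eq_univ_iff]; exact hS.ne_empty)
  rwa [compl_compl] at this

/-- A feasible solution satisfies the rank inequalities of the graphic matroid. -/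
lemma wt_self_le {S : Finset V} (hS : S.Nonempty) : wt X S S ≤ (S.card : ℝ) - 1 := by
  have h1 := h.in_total S
  have h3 := wt_compl_left X S S
  by_cases hs : s ∈ S
  · rw [if_pos hs] at h1
    have := wt_nonneg h.nonneg Sᶜ S
    linarith
  · rw [if_neg hs] at h1
    have := h.one_le_in hS hs
    linarith

/-- By flow conservation the out-weight of an s-t cut exceeds its in-weight by exactly 1. -/
lemma in_lt_of_narrow {τ : ℝ} {U : Finset V} (hU : U ∈ narrowCuts s t X τ) :
    wt X Uᶜ U < τ := by
  obtain ⟨h1, h2, h3⟩ := hU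
  have := h.out_sub_in U
  rw [if_pos h1, if_neg h2] at this
  linarith

/-- Narrow cuts form a chain. -/
lemma narrow_chain {τ : ℝ} (hτ : τ ≤ 1 / 4) {U W : Finset V} (hU : U ∈ narrowCuts s t X τ)
    (hW : W ∈ narrowCuts s t X τ) : U ⊆ W ∨ W ⊆ U := by
  by_contra! hcon
  obtain ⟨h1, h2⟩ := hcon
  have hA : (U \ W).Nonempty := Finset.sdiff_nonempty.2 h1
  have hB : (W \ U).Nonempty := Finset.sdiff_nonempty.2 h2
  have hsA : s ∉ U \ W := by simp [hW.1]
  have hsB : s ∉ W \ U := by simp [hU.1]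
  have htA : t ∉ U \ W := by simp [hU.2.1]
  have htB : t ∉ W \ U := by simp [hW.2.1]
  have a1 := h.one_le_in hA hsA
  have b1 := h.one_le_in hB hsB
  have a2 := h.out_sub_in (U \ W)
  have b2 := h.out_sub_in (W \ U)
  rw [if_neg hsA, if_neg htA] at a2
  rw [if_neg hsB, if_neg htB] at b2
  have u1 := h.in_lt_of_narrow hU
  have w1 := h.in_lt_of_narrow hW
  have u2 := hU.2.2
  have w2 := hW.2.2
  -- Posimodularity, checked pair by pair. The left side is at least 4, since both differences avoid
  -- s and t and so have in-weight = out-weight ≥ 1. The right side is below 2 + 4τ ≤ 3.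
  have key : wt X (U \ W) (U \ W)ᶜ + wt X (U \ W)ᶜ (U \ W) + (wt X (W \ U) (W \ U)ᶜ +
      wt X (W \ U)ᶜ (W \ U)) ≤ wt X U Uᶜ + wt X Uᶜ U + (wt X W Wᶜ + wt X Wᶜ W) := by
    simp only [wt_eq_sum, ← Finset.sum_add_distrib]
    refine Finset.sum_le_sum fun u _ => Finset.sum_le_sum fun v _ => ?_
    have := h.nonneg u v
    by_cases p1 : u ∈ U <;> by_cases p2 : u ∈ W <;> by_cases p3 : v ∈ U <;>
      by_cases p4 : v ∈ W <;> simp [p1, p2, p3, p4, this]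
  linarith

end PathLP

/-! ### The layers of a chain of cuts -/

/-- Some member of the family `𝓝` contains `y` but not `v`. -/
def Separates (𝓝 : Set (Finset V)) (y v : V) : Prop := ∃ U ∈ 𝓝, y ∈ U ∧ v ∉ U

open Classical in
/-- The union of the members of `𝓝` that do not contain `v`. -/
noncomputable def below (𝓝 : Set (Finset V)) (v : V) : Finset V :=
  Finset.univ.filter fun y => Separates 𝓝 y v

open Classical in
/-- The intersection of the members of `𝓝` that contain `u`. -/
noncomputable def above (𝓝 : Set (Finset V)) (u : V) : Finset V :=
  Finset.univ.filter fun y => ¬ Separates 𝓝 u y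

variable {𝓝 : Set (Finset V)}

lemma mem_below {y v : V} : y ∈ below 𝓝 v ↔ Separates 𝓝 y v := by simp [below]

lemma mem_above {y u : V} : y ∈ above 𝓝 u ↔ ¬ Separates 𝓝 u y := by simp [above]

lemma self_notMem_below (v : V) : v ∉ below 𝓝 v := by
  rw [mem_below]; rintro ⟨U, -, h, h'⟩; exact h' h

lemma self_mem_above (v : V) : v ∈ above 𝓝 v := by
  rw [mem_above]; rintro ⟨U, -, h, h'⟩; exact h' h

lemma subset_below {U : Finset V} (hU : U ∈ 𝓝) {v : V} (hv : v ∉ U) : U ⊆ below 𝓝 v :=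
  fun _ hy => mem_below.2 ⟨U, hU, hy, hv⟩

lemma above_subset {U : Finset V} (hU : U ∈ 𝓝) {u : V} (hu : u ∈ U) : above 𝓝 u ⊆ U := by
  intro y hy
  by_contra hyU
  exact mem_above.1 hy ⟨U, hU, hu, hyU⟩

/-- `𝓝` is a chain with respect to inclusion. -/
def IsNested (𝓝 : Set (Finset V)) : Prop := ∀ U ∈ 𝓝, ∀ W ∈ 𝓝, U ⊆ W ∨ W ⊆ U

/-- In a chain the union of the members that avoid `v` is the largest of them, if there is one. -/
lemma IsNested.below_eq_empty_or_mem (hc : IsNested 𝓝) (v : V) :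
    below 𝓝 v = ∅ ∨ below 𝓝 v ∈ 𝓝 := by
  classical
  by_cases hex : ∃ U ∈ 𝓝, v ∉ U
  · right
    obtain ⟨U₀, hU₀, hv₀⟩ := hex
    obtain ⟨U, hU, hmax⟩ := Finset.exists_max_image
      (Finset.univ.filter fun U : Finset V => U ∈ 𝓝 ∧ v ∉ U) Finset.card ⟨U₀, by simp [hU₀, hv₀]⟩
    simp only [Finset.mem_filter, Finset.mem_univ, true_and] at hU hmax
    have : below 𝓝 v = U := by
      refine (Finset.Subset.antisymm ?_ (subset_below hU.1 hU.2))
      intro y hy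
      obtain ⟨W, hW, hyW, hvW⟩ := mem_below.1 hy
      rcases hc U hU.1 W hW with h | h
      · rwa [Finset.eq_of_subset_of_card_le h (hmax W ⟨hW, hvW⟩)]
      · exact h hyW
    rw [this]; exact hU.1
  · left
    rw [Finset.eq_empty_iff_forall_notMem]
    rintro y hy
    obtain ⟨W, hW, -, hvW⟩ := mem_below.1 hy
    exact hex ⟨W, hW, hvW⟩

lemma IsNested.above_eq_univ_or_mem (hc : IsNested 𝓝) (u : V) :
    above 𝓝 u = Finset.univ ∨ above 𝓝 u ∈ 𝓝 := by
  classical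
  by_cases hex : ∃ U ∈ 𝓝, u ∈ U
  · right
    obtain ⟨U₀, hU₀, hu₀⟩ := hex
    obtain ⟨U, hU, hmin⟩ := Finset.exists_min_image
      (Finset.univ.filter fun U : Finset V => U ∈ 𝓝 ∧ u ∈ U) Finset.card ⟨U₀, by simp [hU₀, hu₀]⟩
    simp only [Finset.mem_filter, Finset.mem_univ, true_and] at hU hmin
    have : above 𝓝 u = U := by
      refine (Finset.Subset.antisymm (above_subset hU.1 hU.2) ?_)
      intro y hy
      rw [mem_above]
      rintro ⟨W, hW, huW, hyW⟩
      rcases hc U hU.1 W hW with h | h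
      · exact hyW (h hy)
      · rw [Finset.eq_of_subset_of_card_le h (hmin W ⟨hW, huW⟩)] at hyW
        exact hyW hy
    rw [this]; exact hU.1
  · left
    rw [Finset.eq_univ_iff_forall]
    intro y
    rw [mem_above]
    rintro ⟨W, hW, huW, -⟩
    exact hex ⟨W, hW, huW⟩

lemma below_subset_above (hc : IsNested 𝓝) (v : V) : below 𝓝 v ⊆ above 𝓝 v := by
  intro y hy
  obtain ⟨U, hU, hyU, hvU⟩ := mem_below.1 hy
  rw [mem_above]
  rintro ⟨W, hW, hvW, hyW⟩
  rcases hc U hU W hW with h | h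
  · exact hyW (h hyU)
  · exact hvU (h hvW)

/-- Two vertices are in the same layer. -/
def SameLayer (𝓝 : Set (Finset V)) (u v : V) : Prop := below 𝓝 u = below 𝓝 v

/-- The vertex `v` is in the layer that follows the layer of `u`. -/
def NextLayer (𝓝 : Set (Finset V)) (u v : V) : Prop := below 𝓝 v = above 𝓝 u

/-- The layer of the vertex `v`. -/
noncomputable def layer (𝓝 : Set (Finset V)) (v : V) : Finset V := above 𝓝 v \ below 𝓝 v

lemma mem_layer {u v : V} : u ∈ layer 𝓝 v ↔ SameLayer 𝓝 u v := by
  rw [layer, Finset.mem_sdiff, mem_above, mem_below, SameLayer]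
  constructor
  · rintro ⟨h1, h2⟩
    ext y
    rw [mem_below, mem_below]
    constructor
    · rintro ⟨U, hU, hy, hu⟩
      exact ⟨U, hU, hy, fun hv => h1 ⟨U, hU, hv, hu⟩⟩
    · rintro ⟨U, hU, hy, hv⟩
      exact ⟨U, hU, hy, fun hu => h2 ⟨U, hU, hu, hv⟩⟩
  · intro e
    refine ⟨fun hs => ?_, fun hs => ?_⟩
    · rw [← mem_below, e] at hs; exact self_notMem_below v hs
    · rw [← mem_below, ← e] at hs; exact self_notMem_below u hs

lemma self_mem_layer (v : V) : v ∈ layer 𝓝 v := mem_layer.2 rfl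

/-- The sets `below` are comparable, so their cardinalities tell them apart. This and
`nextLayer_iff_card` let the algorithm store one number per vertex instead of a set. -/
lemma IsNested.sameLayer_iff_card (hc : IsNested 𝓝) (u v : V) :
    SameLayer 𝓝 u v ↔ (below 𝓝 u).card = (below 𝓝 v).card := by
  refine ⟨fun h => congrArg _ h, fun h => ?_⟩
  have : below 𝓝 u ⊆ below 𝓝 v ∨ below 𝓝 v ⊆ below 𝓝 u := by
    rcases hc.below_eq_empty_or_mem u with h1 | h1
    · rw [h1]; simp
    rcases hc.below_eq_empty_or_mem v with h2 | h2
    · rw [h2]; simp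
    exact hc _ h1 _ h2
  rcases this with h' | h'
  · exact Finset.eq_of_subset_of_card_le h' h.ge
  · exact (Finset.eq_of_subset_of_card_le h' h.le).symm

lemma IsNested.nextLayer_iff_card (hc : IsNested 𝓝) (u v : V) :
    NextLayer 𝓝 u v ↔ (below 𝓝 v).card = (above 𝓝 u).card := by
  refine ⟨fun h => congrArg _ h, fun h => ?_⟩
  have : below 𝓝 v ⊆ above 𝓝 u ∨ above 𝓝 u ⊆ below 𝓝 v := by
    rcases hc.below_eq_empty_or_mem v with h1 | h1
    · rw [h1]; simp
    rcases hc.above_eq_univ_or_mem u with h2 | h2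
    · rw [h2]; simp
    exact hc _ h1 _ h2
  rcases this with h' | h'
  · exact Finset.eq_of_subset_of_card_le h' h.ge
  · exact (Finset.eq_of_subset_of_card_le h' h.le).symm

/-- Provides a vertex of the last layer inside `U`. Otherwise all sets `above u` with u ∈ U would be
proper subsets of `U`; a largest one would miss some w ∈ U, and then `above w`, being comparable to
it and containing w, would be larger. -/
lemma IsNested.exists_above_eq (hc : IsNested 𝓝) {U : Finset V} (hU : U ∈ 𝓝) (hne : U.Nonempty) :
    ∃ u ∈ U, above 𝓝 u = U := by
  by_contra! hcon
  have hss : ∀ u ∈ U, above 𝓝 u ∈ 𝓝 ∧ above 𝓝 u ⊂ U := by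
    intro u hu
    have h1 := above_subset hU hu
    refine ⟨(hc.above_eq_univ_or_mem u).resolve_left fun h => ?_, h1.ssubset_of_ne (hcon u hu)⟩
    rw [h] at h1
    exact hcon u hu (h.trans (Finset.univ_subset_iff.1 h1).symm)
  obtain ⟨u, hu, hmax⟩ := Finset.exists_max_image U (fun u => (above 𝓝 u).card) hne
  obtain ⟨w, hw, hwu⟩ := Finset.exists_of_ssubset (hss u hu).2
  rcases hc _ (hss u hu).1 _ (hss w hw).1 with h | h
  · exact hwu (Finset.eq_of_subset_of_card_le h (hmax w hw) ▸ self_mem_above w)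
  · exact hwu (h (self_mem_above w))

/-- The dual of `exists_above_eq`: a vertex of the first layer outside `U`, found from a smallest
set `below v`. -/
lemma IsNested.exists_below_eq (hc : IsNested 𝓝) {U : Finset V} (hU : U ∈ 𝓝)
    (hne : U ≠ Finset.univ) : ∃ v, v ∉ U ∧ below 𝓝 v = U := by
  by_contra! hcon
  have hss : ∀ v ∉ U, below 𝓝 v ∈ 𝓝 ∧ U ⊂ below 𝓝 v := by
    intro v hv
    have h1 := subset_below hU hv
    refine ⟨(hc.below_eq_empty_or_mem v).resolve_left fun h => ?_,
      h1.ssubset_of_ne fun e => hcon v hv e.symm⟩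
    rw [h] at h1
    exact hcon v hv (h.trans (Finset.subset_empty.1 h1).symm)
  have hne' : Uᶜ.Nonempty := by
    rw [Finset.nonempty_iff_ne_empty, ne_eq, Finset.compl_eq_empty_iff]; exact hne
  obtain ⟨v, hv, hmin⟩ := Finset.exists_min_image Uᶜ (fun v => (below 𝓝 v).card) hne'
  rw [Finset.mem_compl] at hv
  obtain ⟨w, hw, hwU⟩ := Finset.exists_of_ssubset (hss v hv).2
  have hmw := hmin w (Finset.mem_compl.2 hwU)
  rcases hc _ (hss v hv).1 _ (hss w hwU).1 with h | h
  · exact self_notMem_below w (h hw)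
  · exact self_notMem_below w (by rw [Finset.eq_of_subset_of_card_le h hmw]; exact hw)

end Narrow

/-! ### Greedy vectors in the independence polytope of the graphic matroid -/

section Greedy

set_option linter.unusedSectionVars false

variable {V : Type*} [Fintype V] [DecidableEq V]

/-- `z` satisfies the rank inequalities of the graphic matroid. -/
def Indep (z : V → V → ℝ) : Prop := ∀ S : Finset V, S.Nonempty → wt z S S ≤ (S.card : ℝ) - 1

/-- The rank inequality of `S` holds with equality. -/
def Tight (z : V → V → ℝ) (S : Finset V) : Prop := wt z S S = (S.card : ℝ) - 1

/-- Uncrossing: the weight inside a set is supermodular for nonnegative `z`, while |S| - 1 is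
modular on intersecting sets. The intersection must be nonempty for its rank inequality to be
available. -/
lemma Tight.union {z : V → V → ℝ} (hz : ∀ u v, 0 ≤ z u v) (hi : Indep z) {A B : Finset V}
    (hA : Tight z A) (hB : Tight z B) (hAB : (A ∩ B).Nonempty) : Tight z (A ∪ B) := by
  have h1 := hi (A ∪ B) (hAB.mono (Finset.inter_subset_left.trans Finset.subset_union_left))
  have h2 := hi _ hAB
  have h3 : ((A ∪ B).card : ℝ) + (A ∩ B).card = A.card + B.card := by
    exact_mod_cast Finset.card_union_add_card_inter A B
  have key : wt z A A + wt z B B ≤ wt z (A ∪ B) (A ∪ B) + wt z (A ∩ B) (A ∩ B) := by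
    simp only [wt_eq_sum, ← Finset.sum_add_distrib]
    refine Finset.sum_le_sum fun u _ => Finset.sum_le_sum fun v _ => ?_
    have := hz u v
    by_cases p1 : u ∈ A <;> by_cases p2 : u ∈ B <;> by_cases p3 : v ∈ A <;>
      by_cases p4 : v ∈ B <;> simp [p1, p2, p3, p4, this]
  unfold Tight at *
  linarith

/-- Inside `X` there is a largest tight set that contains a given vertex. -/
lemma exists_max_tight {z : V → V → ℝ} (hz : ∀ u v, 0 ≤ z u v) (hi : Indep z)
    {X : Finset V} {v : V} (hv : v ∈ X) (hvv : z v v = 0) :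
    ∃ M, Tight z M ∧ v ∈ M ∧ M ⊆ X ∧ ∀ S, Tight z S → v ∈ S → S ⊆ X → S ⊆ M := by
  classical
  obtain ⟨M, hM, hmax⟩ := Finset.exists_max_image
    (Finset.univ.filter fun S : Finset V => Tight z S ∧ v ∈ S ∧ S ⊆ X) Finset.card
    ⟨{v}, Finset.mem_filter.2 ⟨Finset.mem_univ _, by simp [Tight, wt, hvv], by simp, by simpa using hv⟩⟩
  simp only [Finset.mem_filter, Finset.mem_univ, true_and] at hM hmax
  refine ⟨M, hM.1, hM.2.1, hM.2.2, fun S hS hvS hSX => ?_⟩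
  have := hmax (M ∪ S) ⟨hM.1.union hz hi hS ⟨v, by simp [hM.2.1, hvS]⟩, by simp [hvS],
    Finset.union_subset hM.2.2 hSX⟩
  rw [Finset.eq_of_subset_of_card_le Finset.subset_union_left this]
  exact Finset.subset_union_right

/-- If every pair inside `X` is saturated or in a tight set, and `X` carries enough weight,
then `X` is tight. -/
lemma tight_of_saturated {z x : V → V → ℝ} (hz : ∀ u v, 0 ≤ z u v) (hi : Indep z)
    (hd : ∀ v, z v v = 0) {X : Finset V} (hne : X.Nonempty) {c α : ℝ} (hα : 0 ≤ α)
    (hc₀ : 0 ≤ c) (hc : 1 ≤ c * (1 - α)) (hx : Indep x)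
    (hX : (X.card : ℝ) - 1 - α ≤ wt x X X)
    (hsat : ∀ u ∈ X, ∀ v ∈ X, z u v = c * x u v ∨ ∃ S ⊆ X, u ∈ S ∧ v ∈ S ∧ Tight z S) :
    Tight z X := by
  classical
  -- The class of `v` is the largest tight subset of `X` that contains `v`, with ∅ as a dummy value
  -- outside `X`. By uncrossing, the classes partition `X`.
  have hex : ∀ v, ∃ M, v ∈ X → Tight z M ∧ v ∈ M ∧ M ⊆ X ∧
      ∀ S, Tight z S → v ∈ S → S ⊆ X → S ⊆ M := by
    intro v
    by_cases hv : v ∈ X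
    · obtain ⟨M, hM⟩ := exists_max_tight hz hi hv (hd v)
      exact ⟨M, fun _ => hM⟩
    · exact ⟨∅, fun h => absurd h hv⟩
  choose cls hcls using hex
  have hcls_eq : ∀ u ∈ X, ∀ v ∈ X, u ∈ cls v → cls u = cls v := by
    intro u hu v hv huv
    obtain ⟨t1, m1, s1, x1⟩ := hcls u hu
    obtain ⟨t2, m2, s2, x2⟩ := hcls v hv
    have h1 : cls v ⊆ cls u := x1 _ t2 huv s2
    exact Finset.Subset.antisymm (x2 _ t1 (h1 m2) s1) h1
  set P := X.image cls with hP
  have hfib : ∀ S ∈ P, X.filter (fun u => cls u = S) = S := by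
    intro S hS
    obtain ⟨v, hv, rfl⟩ := Finset.mem_image.1 hS
    ext u
    rw [Finset.mem_filter]
    constructor
    · rintro ⟨hu, e⟩
      rw [← e]; exact (hcls u hu).2.1
    · intro hu
      have huX := (hcls v hv).2.2.1 hu
      exact ⟨huX, hcls_eq u huX v hv hu⟩
  have hdec : ∀ Y : V → V → ℝ, wt Y X X = ∑ S ∈ P, wt Y S S +
      ∑ u ∈ X, ∑ v ∈ X, if cls u = cls v then 0 else Y u v := by
    intro Y
    have e1 : ∑ S ∈ P, wt Y S S = ∑ u ∈ X, ∑ v ∈ X, if cls u = cls v then Y u v else 0 := by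
      rw [← Finset.sum_fiberwise_of_maps_to (s := X) (t := P) (g := cls)
        fun u hu => Finset.mem_image_of_mem _ hu]
      refine Finset.sum_congr rfl fun S hS => ?_
      rw [wt, hfib S hS]
      refine Finset.sum_congr rfl fun u hu => ?_
      have hu' : cls u = S := by
        rw [← hfib S hS] at hu; exact (Finset.mem_filter.1 hu).2
      rw [← Finset.sum_filter]
      refine Finset.sum_congr ?_ fun _ _ => rfl
      conv_lhs => rw [← hfib S hS]
      refine Finset.filter_congr fun v _ => ?_
      rw [hu', eq_comm]
    rw [e1, wt, ← Finset.sum_add_distrib]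
    refine Finset.sum_congr rfl fun u _ => ?_
    rw [← Finset.sum_add_distrib]
    refine Finset.sum_congr rfl fun v _ => ?_
    split_ifs <;> simp
  have hcard : (X.card : ℝ) = ∑ S ∈ P, (S.card : ℝ) := by
    rw [Finset.card_eq_sum_card_image cls X]
    push_cast
    exact Finset.sum_congr rfl fun S hS => by rw [hfib S hS]
  have hzP : ∑ S ∈ P, wt z S S = X.card - P.card := by
    rw [hcard, Finset.card_eq_sum_ones P]
    push_cast
    rw [← Finset.sum_sub_distrib]
    refine Finset.sum_congr rfl fun S hS => ?_
    obtain ⟨v, hv, rfl⟩ := Finset.mem_image.1 hS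
    exact (hcls v hv).1
  have hxP : ∑ S ∈ P, wt x S S ≤ X.card - P.card := by
    rw [hcard, Finset.card_eq_sum_ones P]
    push_cast
    rw [← Finset.sum_sub_distrib]
    refine Finset.sum_le_sum fun S hS => ?_
    obtain ⟨v, hv, rfl⟩ := Finset.mem_image.1 hS
    exact hx _ ⟨v, (hcls v hv).2.1⟩
  -- Vertices of different classes share no tight subset of `X`, so the pairs between classes are
  -- saturated.
  have hcross : ∑ u ∈ X, ∑ v ∈ X, (if cls u = cls v then 0 else z u v) =
      c * ∑ u ∈ X, ∑ v ∈ X, if cls u = cls v then 0 else x u v := by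
    rw [Finset.mul_sum]
    refine Finset.sum_congr rfl fun u hu => ?_
    rw [Finset.mul_sum]
    refine Finset.sum_congr rfl fun v hv => ?_
    split_ifs with e
    · simp
    rcases hsat u hu v hv with h | ⟨S, hSX, huS, hvS, hS⟩
    · exact h
    · refine absurd ?_ e
      exact hcls_eq u hu v hv ((hcls v hv).2.2.2 S hS hvS hSX huS)
  have hle := hi X hne
  have dz := hdec z
  have dx := hdec x
  rw [hcross] at dz
  set q := ∑ u ∈ X, ∑ v ∈ X, if cls u = cls v then 0 else x u v with hq
  have hpos : 1 ≤ P.card := Finset.card_pos.2 (hne.image _)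
  refine le_antisymm hle ?_
  rcases hpos.eq_or_lt with h1 | h2
  · obtain ⟨v, hv⟩ := hne
    have : X = cls v := by
      obtain ⟨S, hS⟩ := Finset.card_eq_one.1 h1.symm
      have e1 : ∀ u ∈ X, cls u = S := fun u hu => by
        have := Finset.mem_image_of_mem cls hu
        rwa [← hP, hS, Finset.mem_singleton] at this
      refine Finset.Subset.antisymm (fun u hu => ?_) (hcls v hv).2.2.1
      rw [e1 v hv, ← e1 u hu]; exact (hcls u hu).2.1
    have ht := (hcls v hv).1
    rw [← this] at ht
    exact ht.ge
  · have hp : (2 : ℝ) ≤ P.card := by exact_mod_cast h2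
    -- With p ≥ 2 classes, `x` has at most |X| - p inside them, which leaves p - 1 - α ≥ (p - 1)(1 -
    -- α) across. The factor `c` lifts this to at least p - 1, exactly what `X` needs to be tight.
    have hq1 : (P.card : ℝ) - 1 - α ≤ q := by linarith
    have hq2 : ((P.card : ℝ) - 1) * (1 - α) ≤ q := by nlinarith
    have hq3 : c * (((P.card : ℝ) - 1) * (1 - α)) ≤ c * q := mul_le_mul_of_nonneg_left hq2 hc₀
    have hq4 : (P.card : ℝ) - 1 ≤ c * (((P.card : ℝ) - 1) * (1 - α)) := by nlinarith
    linarith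

/-- The matrix `z` with the entry at `(u, v)` increased by `δ`. -/
def bump (z : V → V → ℝ) (u v : V) (δ : ℝ) : V → V → ℝ :=
  fun a b => if a = u ∧ b = v then z a b + δ else z a b

lemma wt_bump (z : V → V → ℝ) (u v : V) (δ : ℝ) (S : Finset V) :
    wt (bump z u v δ) S S = wt z S S + if u ∈ S ∧ v ∈ S then δ else 0 := by
  have e : ∀ a b, bump z u v δ a b = z a b + if a = u then (if b = v then δ else 0) else 0 := by
    intro a b
    unfold bump
    by_cases h1 : a = u <;> by_cases h2 : b = v <;> simp [h1, h2]
  simp only [wt, e, Finset.sum_add_distrib]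
  congr 1
  by_cases hu : u ∈ S <;> by_cases hv : v ∈ S <;> simp [hu, hv, Finset.sum_ite_irrel]

/-- `z` arises from `z₀` by raising the entries in `Q`, within the independence polytope and below
`cap`, and none of these entries can be raised further. -/
structure Saturates (cap z₀ : V → V → ℝ) (Q : V → V → Prop) (z : V → V → ℝ) : Prop where
  indep : Indep z
  le_cap : ∀ u v, z u v ≤ cap u v
  ge : ∀ u v, z₀ u v ≤ z u v
  eq : ∀ u v, ¬ Q u v → z u v = z₀ u v
  full : ∀ u v, Q u v → z u v = cap u v ∨ ∃ S, u ∈ S ∧ v ∈ S ∧ Tight z S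

/-- One step of the greedy algorithm. -/
lemma Saturates.step {cap z₀ z : V → V → ℝ} {Q : V → V → Prop} (h : Saturates cap z₀ Q z)
    {u v : V} {m : ℝ} (hm : ∀ S : Finset V, u ∈ S → v ∈ S → m ≤ (S.card : ℝ) - 1 - wt z S S)
    (hm' : ∃ S : Finset V, u ∈ S ∧ v ∈ S ∧ m = (S.card : ℝ) - 1 - wt z S S) :
    Saturates cap z₀ (fun a b => Q a b ∨ (a = u ∧ b = v))
      (bump z u v (min (cap u v - z u v) m)) := by
  have hm0 : 0 ≤ m := by
    obtain ⟨S, hu, -, rfl⟩ := hm'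
    have := h.indep S ⟨u, hu⟩
    linarith
  have hδ : 0 ≤ min (cap u v - z u v) m := le_min (by linarith [h.le_cap u v]) hm0
  have hδm := min_le_right (cap u v - z u v) m
  have hδc := min_le_left (cap u v - z u v) m
  -- A tight set that contains both `u` and `v` forces m ≤ 0, so the increment is 0; other sets do
  -- not notice the change.
  have htight : ∀ S, Tight z S → Tight (bump z u v (min (cap u v - z u v) m)) S := by
    intro S hS
    unfold Tight at *
    rw [wt_bump, hS]
    split_ifs with huv
    · have := hm S huv.1 huv.2
      rw [hS] at this
      linarith
    · ring
  refine ⟨fun S hS => ?_, fun a b => ?_, fun a b => ?_, fun a b hab => ?_, fun a b hab => ?_⟩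
  · rw [wt_bump]
    split_ifs with huv
    · have := hm S huv.1 huv.2
      linarith
    · rw [add_zero]; exact h.indep S hS
  · unfold bump
    split_ifs with hab
    · rw [hab.1, hab.2]; linarith
    · exact h.le_cap a b
  · unfold bump
    split_ifs with hab
    · linarith [h.ge a b]
    · exact h.ge a b
  · push Not at hab
    unfold bump
    rw [if_neg fun hh => hab.2 hh.1 hh.2]
    exact h.eq a b hab.1
  · by_cases huv : a = u ∧ b = v
    · obtain ⟨rfl, rfl⟩ := huv
      rcases min_cases (cap a b - z a b) m with ⟨e, -⟩ | ⟨e, -⟩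
      · left
        simp [bump, e]
      · right
        obtain ⟨S, hu, hv, hS⟩ := hm'
        refine ⟨S, hu, hv, ?_⟩
        rw [Tight, wt_bump, if_pos ⟨hu, hv⟩, e, hS]
        ring
    · rcases h.full a b (hab.resolve_right huv) with h' | ⟨S, h1, h2, h3⟩
      · left
        simp only [bump, if_neg huv]
        exact h'
      · exact Or.inr ⟨S, h1, h2, htight S h3⟩

lemma Saturates.refl {cap z : V → V → ℝ} (hi : Indep z) (hz : ∀ u v, z u v ≤ cap u v) :
    Saturates cap z (fun _ _ => False) z :=
  ⟨hi, hz, fun _ _ => le_rfl, fun _ _ _ => rfl, fun _ _ h => h.elim⟩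

lemma Saturates.congr {cap z₀ z : V → V → ℝ} {Q Q' : V → V → Prop} (h : Saturates cap z₀ Q z)
    (hQ : ∀ u v, Q u v ↔ Q' u v) : Saturates cap z₀ Q' z := by
  have : Q = Q' := by ext u v; exact hQ u v
  rwa [← this]

/-- One greedy step per pair, in any order: an entry that is blocked stays blocked, because later
steps keep tight sets tight and change only their own entry. -/
lemma exists_saturates {cap z₀ : V → V → ℝ} (hi : Indep z₀) (hz : ∀ u v, z₀ u v ≤ cap u v)
    (Q : V → V → Prop) : ∃ z, Saturates cap z₀ Q z := by
  classical
  suffices H : ∀ A : Finset (V × V), ∃ z, Saturates cap z₀ (fun u v => (u, v) ∈ A) z by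
    obtain ⟨z, h⟩ := H (Finset.univ.filter fun p => Q p.1 p.2)
    exact ⟨z, h.congr fun u v => by simp⟩
  intro A
  induction A using Finset.induction_on with
  | empty => exact ⟨z₀, (Saturates.refl hi hz).congr fun u v => by simp⟩
  | insert p A _ ih =>
    obtain ⟨u, v⟩ := p
    obtain ⟨z, h⟩ := ih
    obtain ⟨S, hS, hmin⟩ := Finset.exists_min_image
      (Finset.univ.filter fun S : Finset V => u ∈ S ∧ v ∈ S)
      (fun S => (S.card : ℝ) - 1 - wt z S S) ⟨Finset.univ, by simp⟩
    simp only [Finset.mem_filter, Finset.mem_univ, true_and] at hS hmin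
    refine ⟨_, (h.step (fun S' h1 h2 => hmin S' ⟨h1, h2⟩) ⟨S, hS.1, hS.2, rfl⟩).congr fun a b => ?_⟩
    simp only [Finset.mem_insert, Prod.mk.injEq]
    tauto

/-! ### The tightened vector -/

variable {s t : V} {X : V → V → ℝ} {τ : ℝ}

lemma PathLP.isNested (h : PathLP s t X) (hτ : τ ≤ 1 / 4) : IsNested (narrowCuts s t X τ) :=
  fun _ hU _ hW => h.narrow_chain hτ hU hW

lemma wt_eq_of_support {z : V → V → ℝ} {A B A' B' : Finset V} (hA : A ⊆ A') (hB : B ⊆ B')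
    (hz : ∀ u ∈ A', ∀ v ∈ B', z u v ≠ 0 → u ∈ A ∧ v ∈ B) : wt z A' B' = wt z A B := by
  simp only [wt_eq_sum]
  refine Finset.sum_congr rfl fun u _ => Finset.sum_congr rfl fun v _ => ?_
  by_cases h1 : u ∈ A' ∧ v ∈ B'
  · rw [if_pos h1]
    by_cases h2 : z u v = 0
    · simp [h2]
    · rw [if_pos (hz u h1.1 v h1.2 h2)]
  · rw [if_neg h1, if_neg fun h2 => h1 ⟨hA h2.1, hB h2.2⟩]

lemma mem_iff_of_sameLayer {𝓝 : Set (Finset V)} {a u : V} (h : SameLayer 𝓝 a u) {U : Finset V}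
    (hU : U ∈ 𝓝) : a ∈ U ↔ u ∈ U := by
  constructor
  · intro ha
    by_contra hu
    have := subset_below hU hu ha
    rw [← h] at this
    exact self_notMem_below a this
  · intro hu
    by_contra ha
    have := subset_below hU ha hu
    rw [h] at this
    exact self_notMem_below u this

lemma above_eq_of_sameLayer {𝓝 : Set (Finset V)} {a u : V} (h : SameLayer 𝓝 a u) :
    above 𝓝 a = above 𝓝 u := by
  ext y
  rw [mem_above, mem_above, not_iff_not]
  exact ⟨fun ⟨U, hU, h1, h2⟩ => ⟨U, hU, (mem_iff_of_sameLayer h hU).1 h1, h2⟩,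
    fun ⟨U, hU, h1, h2⟩ => ⟨U, hU, (mem_iff_of_sameLayer h hU).2 h1, h2⟩⟩

lemma not_nextLayer_of_sameLayer {𝓝 : Set (Finset V)} {u v : V} (h : SameLayer 𝓝 u v) :
    ¬ NextLayer 𝓝 u v := by
  intro h'
  have := self_mem_above (𝓝 := 𝓝) u
  rw [← h', ← h] at this
  exact self_notMem_below u this

/-! ### The weight of a feasible solution inside and between layers -/

lemma PathLP.in_above_le (h : PathLP s t X) (hτ₀ : 0 ≤ τ) (hτ : τ ≤ 1 / 4) (v : V) :
    wt X (above (narrowCuts s t X τ) v)ᶜ (above (narrowCuts s t X τ) v) ≤ τ := by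
  rcases (h.isNested hτ).above_eq_univ_or_mem v with e | e
  · rw [e]; simpa [wt] using hτ₀
  · exact (h.in_lt_of_narrow e).le

/-- Each layer contains almost the weight of a spanning tree. -/
lemma PathLP.le_wt_layer (h : PathLP s t X) (hτ₀ : 0 ≤ τ) (hτ : τ ≤ 1 / 4) (v : V) :
    ((layer (narrowCuts s t X τ) v).card : ℝ) - 1 - 2 * τ ≤
      wt X (layer (narrowCuts s t X τ) v) (layer (narrowCuts s t X τ) v) := by
  have hc := h.isNested hτ
  set L := layer (narrowCuts s t X τ) v with hL
  have hT := h.in_above_le hτ₀ hτ v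
  set T := above (narrowCuts s t X τ) v with hTdef
  have hB := hc.below_eq_empty_or_mem v
  set B := below (narrowCuts s t X τ) v with hBdef
  have hBT : B ⊆ T := below_subset_above hc v
  have hLT : L ⊆ T := Finset.sdiff_subset
  have hcomp : Lᶜ = B ∪ Tᶜ := by
    ext y
    simp only [hL, layer, ← hTdef, ← hBdef, Finset.mem_compl, Finset.mem_sdiff, Finset.mem_union]
    have := @hBT y
    tauto
  have hdis : Disjoint B Tᶜ := by
    rw [Finset.disjoint_left]; intro y hy; simp [hBT hy]
  have e1 := h.in_total L
  have e2 := wt_compl_left X L L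
  have e3 : wt X Lᶜ L = wt X B L + wt X Tᶜ L := by rw [hcomp, wt_union_left X hdis]
  have e4 : wt X Tᶜ L ≤ wt X Tᶜ T := wt_mono h.nonneg subset_rfl hLT
  have hLB : L ⊆ Bᶜ := by
    intro y hy
    rw [Finset.mem_compl]; exact (Finset.mem_sdiff.1 hy).2
  have e5 : wt X B L ≤ wt X B Bᶜ := wt_mono h.nonneg subset_rfl hLB
  -- The in-weight of the layer comes from below, from above, or from inside. From above comes at
  -- most τ. From below comes nothing at the bottom, and otherwise less than 1 + τ, but then s is
  -- outside the layer and its in-weight is the full |L|.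
  rcases hB with hB | hB
  · have e6 : wt X B L = 0 := by rw [hB]; simp [wt]
    split_ifs at e1 <;> linarith
  · have hs : s ∉ L := fun hs => Finset.mem_compl.1 (hLB hs) hB.1
    rw [if_neg hs] at e1
    have := hB.2.2
    linarith

/-- A narrow cut sends most of its weight to the next layer. -/
lemma PathLP.le_wt_next (h : PathLP s t X) (hτ₀ : 0 ≤ τ) (hτ : τ ≤ 1 / 4) {U : Finset V}
    (hU : U ∈ narrowCuts s t X τ) {v : V} (hv : below (narrowCuts s t X τ) v = U) :
    1 - τ ≤ wt X U (layer (narrowCuts s t X τ) v) := by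
  have hc := h.isNested hτ
  set L := layer (narrowCuts s t X τ) v with hL
  have hT := h.in_above_le hτ₀ hτ v
  have hBT := below_subset_above hc v
  set T := above (narrowCuts s t X τ) v with hTdef
  rw [hv] at hBT
  have hLT : L ⊆ T := Finset.sdiff_subset
  have hcomp : Lᶜ = U ∪ Tᶜ := by
    ext y
    simp only [hL, layer, ← hTdef, hv, Finset.mem_compl, Finset.mem_sdiff, Finset.mem_union]
    have := @hBT y
    tauto
  have hdis : Disjoint U Tᶜ := by
    rw [Finset.disjoint_left]; intro y hy; simp [hBT hy]
  have hs : s ∉ L := by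
    rw [hL, layer, hv]; simp [hU.1]
  -- The layer receives at least 1 in total, of which at most τ comes from beyond the cut `T`.
  have e1 := h.one_le_in ⟨v, self_mem_layer v⟩ hs
  rw [← hL, hcomp, wt_union_left X hdis] at e1
  have e4 : wt X Tᶜ L ≤ wt X Tᶜ T := wt_mono h.nonneg subset_rfl hLT
  linarith

/-- The weight between consecutive layers. -/
lemma PathLP.le_wt_layer_layer (h : PathLP s t X) (hτ₀ : 0 ≤ τ) (hτ : τ ≤ 1 / 4) {U : Finset V}
    (hU : U ∈ narrowCuts s t X τ) {u v : V} (hu : above (narrowCuts s t X τ) u = U)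
    (hv : below (narrowCuts s t X τ) v = U) :
    1 - 3 * τ ≤ wt X (layer (narrowCuts s t X τ) u) (layer (narrowCuts s t X τ) v) := by
  have hc := h.isNested hτ
  have h1 := h.le_wt_next hτ₀ hτ hU hv
  have hBU := below_subset_above hc u
  rw [hu] at hBU
  set L := layer (narrowCuts s t X τ) v with hL
  have hLU : L ⊆ Uᶜ := by
    intro y hy
    rw [Finset.mem_compl, ← hv]; exact (Finset.mem_sdiff.1 hy).2
  set B := below (narrowCuts s t X τ) u with hBdef
  have hK : layer (narrowCuts s t X τ) u = U \ B := by rw [layer, hu]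
  have hUe : U = (U \ B) ∪ B := (Finset.sdiff_union_of_subset hBU).symm
  have e1 : wt X U L = wt X (U \ B) L + wt X B L := by
    conv_lhs => rw [hUe]
    exact wt_union_left X Finset.sdiff_disjoint L
  have e2 : wt X B L ≤ wt X B Uᶜ := wt_mono h.nonneg subset_rfl hLU
  -- The narrow cut `B` sends less than 1 + τ in total and already 1 - τ to the layer just above it,
  -- so at most 2τ can skip that layer. Together with the loss of τ in `le_wt_next` this is the
  -- origin of 3τ.
  have e3 : wt X B Uᶜ ≤ 2 * τ := by
    rcases hc.below_eq_empty_or_mem u with hB | hB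
    · rw [← hBdef] at hB
      rw [hB]; simp only [wt, Finset.sum_empty]; linarith
    · have e4 := h.le_wt_next hτ₀ hτ hB rfl
      rw [← hBdef] at e4 hB
      rw [hK] at e4
      have e5 : wt X B Bᶜ = wt X B (U \ B) + wt X B Uᶜ := by
        rw [← wt_union_right]
        · congr 1
          ext y
          simp only [Finset.mem_compl, Finset.mem_union, Finset.mem_sdiff]
          have := @hBU y
          tauto
        · rw [Finset.disjoint_left]; intro y hy; simp [(Finset.mem_sdiff.1 hy).1]
      have := hB.2.2
      linarith
  rw [hK]
  linarith

/-- The properties of the matrix that the two rounds of the greedy algorithm produce. -/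
structure TightMatrix (s t : V) (X : V → V → ℝ) (τ : ℝ) (z : V → V → ℝ) : Prop where
  nonneg : ∀ u v, 0 ≤ z u v
  le : ∀ u v, z u v ≤ 1 / (1 - 3 * τ) * X u v
  indep : Indep z
  tight : Tight z Finset.univ
  out_one : ∀ U ∈ narrowCuts s t X τ, wt z U Uᶜ = 1
  in_zero : ∀ U ∈ narrowCuts s t X τ, wt z Uᶜ U = 0

/-- The core of the existence proof. The two rounds are arbitrary saturating extensions, so the same
lemma serves the abstract construction and the program. Tight layers bound the weight between
consecutive layers from above; saturation or tight sets bound it from below. -/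
lemma PathLP.tightMatrix (h : PathLP s t X) (hτ₀ : 0 ≤ τ) (hτ : τ ≤ 1 / 4)
    {z₁ z : V → V → ℝ}
    (h₁ : Saturates (fun u v => 1 / (1 - 3 * τ) * X u v) (fun _ _ => 0)
      (SameLayer (narrowCuts s t X τ)) z₁)
    (h₂ : Saturates (fun u v => 1 / (1 - 3 * τ) * X u v) z₁
      (NextLayer (narrowCuts s t X τ)) z) : TightMatrix s t X τ z := by
  have hc := h.isNested hτ
  set 𝓝 := narrowCuts s t X τ with h𝓝
  set c := 1 / (1 - 3 * τ) with hcdef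
  have hpos : 0 < 1 - 3 * τ := by linarith
  have hc₀ : 0 ≤ c := by positivity
  have hc1 : c * (1 - 3 * τ) = 1 := by rw [hcdef]; field_simp
  have hc2 : 1 ≤ c * (1 - 2 * τ) := by
    rw [← hc1]; exact mul_le_mul_of_nonneg_left (by linarith) hc₀
  have nn₁ : ∀ u v, 0 ≤ z₁ u v := h₁.ge
  have nn : ∀ u v, 0 ≤ z u v := fun u v => (nn₁ u v).trans (h₂.ge u v)
  have diag : ∀ v, z v v = 0 := fun v =>
    le_antisymm ((h₂.le_cap v v).trans (by simp [h.diag])) (nn v v)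
  have diag₁ : ∀ v, z₁ v v = 0 := fun v =>
    le_antisymm ((h₁.le_cap v v).trans (by simp [h.diag])) (nn₁ v v)
  have layer_tight₁ : ∀ v, Tight z₁ (layer 𝓝 v) := by
    intro v
    refine tight_of_saturated nn₁ h₁.indep diag₁ ⟨v, self_mem_layer v⟩ (c := c) (α := 2 * τ)
      (x := X) (by linarith) hc₀ hc2 (fun S hS => h.wt_self_le hS) (h.le_wt_layer hτ₀ hτ v) ?_
    intro u hu w hw
    rw [mem_layer] at hu hw
    have huw : SameLayer 𝓝 u w := hu.trans hw.symm
    refine (h₁.full u w huw).imp id ?_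
    rintro ⟨S, huS, hwS, hS⟩
    refine ⟨S, ?_, huS, hwS, hS⟩
    -- After the first round no weight runs between layers. A tight set meeting the layer but not
    -- contained in it would split into two nonempty parts without weight between them, so its
    -- weight would be at most |S| - 2.
    by_contra hsub
    have ne1 : (S \ layer 𝓝 v).Nonempty := Finset.sdiff_nonempty.2 hsub
    have ne2 : (S ∩ layer 𝓝 v).Nonempty := ⟨u, by simp [huS, mem_layer, hu]⟩
    have i1 := h₁.indep _ ne1
    have i2 := h₁.indep _ ne2
    have dis : Disjoint (S \ layer 𝓝 v) (S ∩ layer 𝓝 v) := Finset.disjoint_sdiff_inter S _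
    have dec := wt_union_self z₁ dis
    have hun : S \ layer 𝓝 v ∪ S ∩ layer 𝓝 v = S := Finset.sdiff_union_inter S _
    have hcard : ((S \ layer 𝓝 v).card : ℝ) + (S ∩ layer 𝓝 v).card = S.card := by
      rw [← Nat.cast_add, ← Finset.card_union_of_disjoint dis, hun]
    have z1 : wt z₁ (S \ layer 𝓝 v) (S ∩ layer 𝓝 v) = 0 := by
      refine wt_eq_zero fun a ha b hb => h₁.eq a b fun hab => ?_
      have ha' := (Finset.mem_sdiff.1 ha).2
      have hb' := (Finset.mem_inter.1 hb).2
      rw [mem_layer] at ha' hb'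
      exact ha' (hab.trans hb')
    have z2 : wt z₁ (S ∩ layer 𝓝 v) (S \ layer 𝓝 v) = 0 := by
      refine wt_eq_zero fun a ha b hb => h₁.eq a b fun hab => ?_
      have ha' := (Finset.mem_inter.1 ha).2
      have hb' := (Finset.mem_sdiff.1 hb).2
      rw [mem_layer] at ha' hb'
      exact hb' (hab.symm.trans ha')
    rw [hun] at dec
    unfold Tight at hS
    linarith
  -- The second round does not touch pairs inside a layer.
  have layer_tight : ∀ v, Tight z (layer 𝓝 v) := by
    intro v
    have := layer_tight₁ v
    unfold Tight at this ⊢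
    rw [← this]
    refine wt_congr fun a ha b hb => h₂.eq a b ?_
    rw [mem_layer] at ha hb
    exact not_nextLayer_of_sameLayer (ha.trans hb.symm)
  have support : ∀ a b, z a b ≠ 0 → SameLayer 𝓝 a b ∨ NextLayer 𝓝 a b := by
    intro a b hab
    by_contra! hcon
    exact hab ((h₂.eq a b hcon.2).trans (h₁.eq a b hcon.1))
  have back : ∀ U ∈ 𝓝, ∀ a ∉ U, ∀ b ∈ U, z a b = 0 := by
    intro U hU a ha b hb
    by_contra hab
    rcases support a b hab with h' | h'
    · exact ha ((mem_iff_of_sameLayer h' hU).2 hb)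
    · have hm := self_mem_above (𝓝 := 𝓝) a
      rw [← h'] at hm
      obtain ⟨W, hW, haW, hbW⟩ := mem_below.1 hm
      rcases hc U hU W hW with g | g
      · exact hbW (g hb)
      · exact ha (g haW)
  have back_zero : ∀ U ∈ 𝓝, wt z Uᶜ U = 0 := fun U hU =>
    wt_eq_zero fun a ha b hb => back U hU a (Finset.mem_compl.1 ha) b hb
  -- Weight stays in its layer or moves on to the next, so everything that leaves `U` runs from the
  -- last layer inside `U` to the first layer outside.
  have forward : ∀ U ∈ 𝓝, ∀ u v, above 𝓝 u = U → below 𝓝 v = U →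
      wt z U Uᶜ = wt z (layer 𝓝 u) (layer 𝓝 v) := by
    intro U hU u v hu hv
    refine wt_eq_of_support ?_ ?_ ?_
    · intro y hy; rw [← hu]; exact (Finset.mem_sdiff.1 hy).1
    · intro y hy; rw [Finset.mem_compl, ← hv]; exact (Finset.mem_sdiff.1 hy).2
    · intro a ha b hb hab
      rw [Finset.mem_compl] at hb
      rcases support a b hab with h' | h'
      · exact absurd ((mem_iff_of_sameLayer h' hU).1 ha) hb
      · have g1 := subset_below hU hb
        have g2 := above_subset hU ha
        have g3 : below 𝓝 b = U := Finset.Subset.antisymm (h'.symm ▸ g2) g1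
        have g4 : above 𝓝 a = U := h'.symm.trans g3
        refine ⟨?_, mem_layer.2 (g3.trans hv.symm)⟩
        rw [layer, Finset.mem_sdiff, hu]
        refine ⟨ha, fun hh => ?_⟩
        have hu' := self_mem_above (𝓝 := 𝓝) u
        rw [hu, ← g4, mem_above] at hu'
        exact hu' (mem_below.1 hh)
  have disj : ∀ U ∈ 𝓝, ∀ u v, above 𝓝 u = U → below 𝓝 v = U →
      Disjoint (layer 𝓝 u) (layer 𝓝 v) := by
    intro U hU u v hu hv
    rw [Finset.disjoint_left]
    intro y hy hy'
    have g1 := (Finset.mem_sdiff.1 hy).1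
    have g2 := (Finset.mem_sdiff.1 hy').2
    rw [hu] at g1
    rw [hv] at g2
    exact g2 g1
  have cross_back : ∀ U ∈ 𝓝, ∀ u v, above 𝓝 u = U → below 𝓝 v = U →
      wt z (layer 𝓝 v) (layer 𝓝 u) = 0 := by
    intro U hU u v hu hv
    refine wt_eq_zero fun a ha b hb => back U hU a ?_ b ?_
    · rw [← hv]; exact (Finset.mem_sdiff.1 ha).2
    · rw [← hu]; exact (Finset.mem_sdiff.1 hb).1
  have le_one : ∀ U ∈ 𝓝, ∀ u v, above 𝓝 u = U → below 𝓝 v = U →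
      wt z (layer 𝓝 u) (layer 𝓝 v) ≤ 1 := by
    intro U hU u v hu hv
    have hd := disj U hU u v hu hv
    -- The two layers are tight and nothing runs backwards, so the rank inequality of the union
    -- leaves exactly 1 for the pairs between them.
    have i := h₂.indep (layer 𝓝 u ∪ layer 𝓝 v) ⟨u, by simp [self_mem_layer]⟩
    rw [wt_union_self z hd, Finset.card_union_of_disjoint hd, layer_tight u, layer_tight v,
      cross_back U hU u v hu hv] at i
    push_cast at i
    linarith
  have one_le : ∀ U ∈ 𝓝, ∀ u v, above 𝓝 u = U → below 𝓝 v = U →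
      1 ≤ wt z (layer 𝓝 u) (layer 𝓝 v) := by
    intro U hU u v hu hv
    by_cases hall : ∀ a ∈ layer 𝓝 u, ∀ b ∈ layer 𝓝 v, z a b = c * X a b
    · have e : wt z (layer 𝓝 u) (layer 𝓝 v) = c * wt X (layer 𝓝 u) (layer 𝓝 v) := by
        rw [wt_congr hall]
        simp only [wt, Finset.mul_sum]
      rw [e, ← hc1]
      exact mul_le_mul_of_nonneg_left (h.le_wt_layer_layer hτ₀ hτ hU hu hv) hc₀
    · push Not at hall
      obtain ⟨a, ha, b, hb, hab⟩ := hall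
      have haU : a ∈ U := hu ▸ (Finset.mem_sdiff.1 ha).1
      have hbU : b ∉ U := hv ▸ (Finset.mem_sdiff.1 hb).2
      have hnext : NextLayer 𝓝 a b := by
        rw [mem_layer] at ha hb
        exact (hb.trans hv).trans (hu.symm.trans (above_eq_of_sameLayer ha).symm)
      obtain ⟨S, haS, hbS, hS⟩ := (h₂.full a b hnext).resolve_left hab
      rw [← forward U hU u v hu hv]
      -- The unsaturated pair lies in a tight set `S` that the cut divides. The rank inequalities of
      -- the two parts account for at most |S| - 2, so at least 1 crosses `U`, and only forwards.
      have ne1 : (S \ U).Nonempty := ⟨b, by simp [hbS, hbU]⟩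
      have ne2 : (S ∩ U).Nonempty := ⟨a, by simp [haS, haU]⟩
      have i1 := h₂.indep _ ne1
      have i2 := h₂.indep _ ne2
      have dis : Disjoint (S \ U) (S ∩ U) := Finset.disjoint_sdiff_inter S _
      have dec := wt_union_self z dis
      have hun : S \ U ∪ S ∩ U = S := Finset.sdiff_union_inter S _
      have hcard : ((S \ U).card : ℝ) + (S ∩ U).card = S.card := by
        rw [← Nat.cast_add, ← Finset.card_union_of_disjoint dis, hun]
      have z1 : wt z (S \ U) (S ∩ U) = 0 := wt_eq_zero fun a ha b hb =>
        back U hU a (Finset.mem_sdiff.1 ha).2 b (Finset.mem_inter.1 hb).2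
      have z2 : wt z (S ∩ U) (S \ U) ≤ wt z U Uᶜ := wt_mono nn Finset.inter_subset_right
        fun y hy => by rw [Finset.mem_compl]; exact (Finset.mem_sdiff.1 hy).2
      rw [hun] at dec
      unfold Tight at hS
      linarith
  have eq_one : ∀ U ∈ 𝓝, wt z U Uᶜ = 1 := by
    intro U hU
    obtain ⟨u, -, hu⟩ := hc.exists_above_eq hU ⟨s, hU.1⟩
    obtain ⟨v, -, hv⟩ := hc.exists_below_eq hU fun e => hU.2.1 (by simp [e])
    rw [forward U hU u v hu hv]
    exact le_antisymm (le_one U hU u v hu hv) (one_le U hU u v hu hv)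
  refine ⟨nn, h₂.le_cap, h₂.indep, ?_, eq_one, back_zero⟩
  -- The largest tight set that contains s absorbs every tight set it meets. Climbing through the
  -- tight unions of consecutive layers, it swallows all of V.
  obtain ⟨M, hM, hsM, -, hmax⟩ := exists_max_tight nn h₂.indep (Finset.mem_univ s) (diag s)
  have absorb : ∀ S, Tight z S → (M ∩ S).Nonempty → S ⊆ M := by
    intro S hS hne
    have := hmax (M ∪ S) (hM.union nn h₂.indep hS hne) (by simp [hsM]) (Finset.subset_univ _)
    exact Finset.subset_union_right.trans this
  have hall : ∀ k v, (below 𝓝 v).card = k → v ∈ M := by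
    intro k
    induction k using Nat.strong_induction_on with
    | _ k ih =>
    intro v hk
    rcases hc.below_eq_empty_or_mem v with hB | hB
    · have hs : below 𝓝 s = ∅ := by
        rw [Finset.eq_empty_iff_forall_notMem]
        intro y hy
        obtain ⟨U, hU, -, hsU⟩ := mem_below.1 hy
        exact hsU hU.1
      exact absorb _ (layer_tight s) ⟨s, by simp [hsM, self_mem_layer]⟩
        (mem_layer.2 (hB.trans hs.symm))
    · obtain ⟨u, huU, hu⟩ := hc.exists_above_eq hB ⟨s, hB.1⟩
      have hlt : (below 𝓝 u).card < k := by
        rw [← hk]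
        refine Finset.card_lt_card ?_
        have := below_subset_above hc u
        rw [hu] at this
        exact this.ssubset_of_ne fun e => self_notMem_below u (e ▸ huU)
      have huM := ih _ hlt u rfl
      have hd := disj _ hB u v hu rfl
      have ht : Tight z (layer 𝓝 u ∪ layer 𝓝 v) := by
        rw [Tight, wt_union_self z hd, Finset.card_union_of_disjoint hd, layer_tight u,
          layer_tight v, cross_back _ hB u v hu rfl,
          le_antisymm (le_one _ hB u v hu rfl) (one_le _ hB u v hu rfl)]
        push_cast
        ring
      exact absorb _ ht ⟨u, by simp [huM, self_mem_layer]⟩ (by simp [self_mem_layer])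
  have : M = Finset.univ := Finset.eq_univ_iff_forall.2 fun v => hall _ v rfl
  rwa [this] at hM

lemma TightMatrix.isTightened [Nonempty V] {x : Arc V → ℝ} {z : V → V → ℝ}
    (h : TightMatrix s t (toMat x) τ z) :
    IsTightened s t x τ fun a => z a.1.1 a.1.2 := by
  have diag : ∀ v, z v v = 0 := fun v =>
    le_antisymm ((h.le v v).trans (by simp [toMat_self])) (h.nonneg v v)
  have hmat : toMat (fun a : Arc V => z a.1.1 a.1.2) = z := by
    ext u v
    by_cases huv : u = v
    · rw [huv, toMat_self, diag]
    · rw [toMat_of_ne _ huv]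
  refine ⟨fun a => ⟨h.nonneg _ _, ?_⟩, ?_, fun a => ?_, fun U hU => ?_, fun U hU => ?_⟩
  -- The bound z ≤ 1 is the rank inequality of the two ends of the arc.
  · have h1 := h.indep {a.1.1, a.1.2} ⟨a.1.1, by simp⟩
    rw [Finset.card_pair a.2] at h1
    have h2 : wt z {a.1.1} {a.1.2} ≤ wt z {a.1.1, a.1.2} {a.1.1, a.1.2} :=
      wt_mono h.nonneg (by simp) (by simp)
    simp only [wt, Finset.sum_singleton] at h2
    norm_num at h1
    exact h2.trans h1
  · refine mem_spanningTreePolytope (fun a => h.nonneg _ _) (fun S hS => ?_) ?_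
    · have := h.indep S hS
      rw [← hmat, ← mass_insideArcs] at this
      exact this
    · have := h.tight
      rw [Tight, ← hmat, ← mass_insideArcs] at this
      have hins : insideArcs (Finset.univ : Finset V) = Finset.univ := by ext; simp [insideArcs]
      rw [hins, Finset.card_univ] at this
      exact this
  · have := h.le a.1.1 a.1.2
    rwa [toMat_of_ne x a.2] at this
  · rw [mass_outArcs, hmat]; exact h.out_one U (isNarrow_iff.1 hU)
  · rw [mass_inArcs, hmat]; exact h.in_zero U (isNarrow_iff.1 hU)

lemma indep_zero : Indep (fun _ _ : V => (0 : ℝ)) := by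
  intro S hS
  have : (1 : ℝ) ≤ S.card := by exact_mod_cast hS.card_pos
  simp only [wt, Finset.sum_const_zero]
  linarith

/-- Every feasible solution can be tightened. -/
theorem exists_isTightened {x : Arc V → ℝ} (h : IsFeasible s t x) (hτ₀ : 0 ≤ τ)
    (hτ : τ ≤ 1 / 4) : ∃ z, IsTightened s t x τ z := by
  have : Nonempty V := ⟨s⟩
  have hp := h.pathLP
  have hcap : ∀ u v, 0 ≤ 1 / (1 - 3 * τ) * toMat x u v := fun u v =>
    mul_nonneg (one_div_nonneg.2 (by linarith)) (hp.nonneg u v)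
  obtain ⟨z₁, h₁⟩ := exists_saturates indep_zero hcap (SameLayer _)
  obtain ⟨z, h₂⟩ := exists_saturates h₁.indep h₁.le_cap (NextLayer _)
  exact ⟨_, (hp.tightMatrix hτ₀ hτ h₁ h₂).isTightened⟩

end Greedy

/-! ### Binary lengths -/

lemma bits_le_iff {z : ℤ} {k : ℕ} : bits z ≤ k ↔ z.natAbs < 2 ^ k := Nat.size_le

lemma natAbs_lt_two_pow_bits (z : ℤ) : z.natAbs < 2 ^ bits z := Nat.lt_size_self _

lemma bits_add_le {x y : ℤ} {k : ℕ} (hx : bits x ≤ k) (hy : bits y ≤ k) :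
    bits (x + y) ≤ k + 1 := by
  rw [bits_le_iff] at *
  have := Int.natAbs_add_le x y
  rw [pow_succ]; omega

lemma bits_neg (x : ℤ) : bits (-x) = bits x := by rw [bits, Int.natAbs_neg, bits]

lemma bits_sub_le {x y : ℤ} {k : ℕ} (hx : bits x ≤ k) (hy : bits y ≤ k) :
    bits (x - y) ≤ k + 1 := by
  rw [sub_eq_add_neg]; exact bits_add_le hx (by rwa [bits_neg])

lemma bits_mul_le (x y : ℤ) : bits (x * y) ≤ bits x + bits y := by
  rw [bits_le_iff, Int.natAbs_mul, pow_add]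
  exact Nat.mul_lt_mul'' (natAbs_lt_two_pow_bits x) (natAbs_lt_two_pow_bits y)

lemma bits_div_le (x y : ℤ) : bits (x / y) ≤ bits x :=
  Nat.size_le_size (Int.natAbs_ediv_le_natAbs x y)

lemma bits_le_of_le {z : ℤ} {k : ℕ} (h₀ : 0 ≤ z) (h : z ≤ k) : bits z ≤ k := by
  rw [bits_le_iff]
  have : z.natAbs ≤ k := by omega
  exact this.trans_lt Nat.lt_two_pow_self

/-! ### Programs with bounded loops

Programs whose loops run over the range of a read-only variable have a total semantics. If they
multiply only by constants, read-only variables and entries of the array `0`, their numbers grow by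
a bounded number of bits in each step, so that their cost is polynomial. -/

/-- Programs with bounded loops: `loop i b p` runs `p` for the values `0, 1, …` of the variable `i`
that are less than the variable `b`. -/
inductive Code where
  | skip
  | assign (i : ℕ) (e : Expr)
  | store (a : ℕ) (j e : Expr)
  | seq (p q : Code)
  | ite (e : Expr) (p q : Code)
  | loop (i b : ℕ) (p : Code)

namespace Code

/-- The translation into a random access program. -/
def compile : Code → Prog
  | skip => .skip
  | assign i e => .assign i e
  | store a j e => .store a j e
  | seq p q => .seq p.compile q.compile
  | ite e p q => .ifPos e p.compile q.compile
  | loop i b p => .seq (.assign i (.lit 0)) (.whilePos (.sub (.var b) (.var i))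
      (.seq p.compile (.assign i (.add (.var i) (.lit 1)))))

/-- The memory after `k` rounds of a loop. -/
def rounds (f : Mem → Mem) (i : ℕ) (m : Mem) : ℕ → Mem
  | 0 => m.setVar i 0
  | k + 1 => (f (rounds f i m k)).setVar i (k + 1)

/-- The memory after running a program. -/
def den : Code → Mem → Mem
  | skip, m => m
  | assign i e, m => m.setVar i (e.eval m)
  | store a j e, m => m.setArr a (j.eval m) (e.eval m)
  | seq p q, m => q.den (p.den m)
  | ite e p q, m => if 0 < e.eval m then p.den m else q.den m
  | loop i b p, m => rounds p.den i m (m.var b).toNat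

/-- The variables that a program may change. -/
def wv : Code → List ℕ
  | skip => []
  | assign i _ => [i]
  | store _ _ _ => []
  | seq p q => p.wv ++ q.wv
  | ite _ p q => p.wv ++ q.wv
  | loop i _ p => i :: p.wv

/-- The arrays that a program may change. -/
def wa : Code → List ℕ
  | skip => []
  | assign _ _ => []
  | store a _ _ => [a]
  | seq p q => p.wa ++ q.wa
  | ite _ p q => p.wa ++ q.wa
  | loop _ _ p => p.wa

lemma var_den {j : ℕ} : ∀ (p : Code) (m : Mem), j ∉ p.wv → (p.den m).var j = m.var j
  | skip, m, _ => rfl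
  | assign i e, m, h => by
    simp only [wv, List.mem_singleton] at h
    simp [den, Mem.setVar, h]
  | store a _ _, m, _ => rfl
  | seq p q, m, h => by
    simp only [wv, List.mem_append, not_or] at h
    rw [den, var_den q _ h.2, var_den p _ h.1]
  | ite e p q, m, h => by
    simp only [wv, List.mem_append, not_or] at h
    rw [den]
    split_ifs
    · exact var_den p _ h.1
    · exact var_den q _ h.2
  | loop i b p, m, h => by
    simp only [wv, List.mem_cons, not_or] at h
    rw [den]
    generalize (m.var b).toNat = k
    induction k with
    | zero => simp [rounds, Mem.setVar, h.1]
    | succ k ih =>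
      rw [← ih, ← var_den p (rounds p.den i m k) h.2]
      simp [rounds, Mem.setVar, h.1]

lemma arr_den {a : ℕ} : ∀ (p : Code) (m : Mem), a ∉ p.wa → (p.den m).arr a = m.arr a
  | skip, m, _ => rfl
  | assign i e, m, _ => rfl
  | store a' _ _, m, h => by
    simp only [wa, List.mem_singleton] at h
    simp [den, Mem.setArr, h]
  | seq p q, m, h => by
    simp only [wa, List.mem_append, not_or] at h
    rw [den, arr_den q _ h.2, arr_den p _ h.1]
  | ite e p q, m, h => by
    simp only [wa, List.mem_append, not_or] at h
    rw [den]
    split_ifs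
    · exact arr_den p _ h.1
    · exact arr_den q _ h.2
  | loop i b p, m, h => by
    simp only [wa] at h
    rw [den]
    generalize (m.var b).toNat = k
    induction k with
    | zero => rfl
    | succ k ih =>
      rw [← ih, ← arr_den p (rounds p.den i m k) h]
      rfl

end Code

/-- The factors allowed in a product: constants, read-only variables, and input entries. -/
def Expr.isFactor (ro : List ℕ) : Expr → Bool
  | .lit _ => true
  | .var i => ro.contains i
  | .get a _ => a == 0
  | _ => false

/-- All products have an allowed second factor. -/
def Expr.ok (ro : List ℕ) : Expr → Bool
  | .lit _ => true
  | .var _ => true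
  | .get _ e => e.ok ro
  | .add e f => e.ok ro && f.ok ro
  | .sub e f => e.ok ro && f.ok ro
  | .mul e f => e.ok ro && (f.ok ro && f.isFactor ro)
  | .div e f => e.ok ro && f.ok ro

/-- The program respects the read-only variables `ro`: it does not change them, nor the array `0`,
nor the counters of its running loops, all loops run over ranges of read-only variables, and all
products have an allowed second factor. -/
def Code.ok (ro : List ℕ) : Code → Bool
  | skip => true
  | assign i e => !ro.contains i && e.ok ro
  | store a j e => a != 0 && (j.ok ro && e.ok ro)
  | seq p q => p.ok ro && q.ok ro
  | ite e p q => e.ok ro && (p.ok ro && q.ok ro)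
  | loop i b p => !ro.contains i && (ro.contains b && (!p.wv.contains i && p.ok ro))

/-- The read-only data are bounded by `K`. -/
def RoBound (ro : List ℕ) (K : ℕ) (m : Mem) : Prop :=
  (∀ i ∈ ro, 0 ≤ m.var i ∧ m.var i ≤ K) ∧ ∀ j, bits (m.arr 0 j) ≤ K

/-- All numbers in the memory have at most `b` bits. -/
def Mem.Bounded (b : ℕ) (m : Mem) : Prop :=
  (∀ i, bits (m.var i) ≤ b) ∧ ∀ a j, bits (m.arr a j) ≤ b

/-! ### Memories with bounded numbers, and preservation of read-only data -/

lemma Mem.Bounded.mono {b c : ℕ} {m : Mem} (h : m.Bounded b) (hbc : b ≤ c) : m.Bounded c :=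
  ⟨fun i => (h.1 i).trans hbc, fun a j => (h.2 a j).trans hbc⟩

lemma Mem.Bounded.setVar {b : ℕ} {m : Mem} (h : m.Bounded b) (i : ℕ) {v : ℤ}
    (hv : bits v ≤ b) : (m.setVar i v).Bounded b := by
  refine ⟨fun j => ?_, h.2⟩
  simp only [Mem.setVar, Function.update_apply]
  split_ifs
  · exact hv
  · exact h.1 j

lemma Mem.Bounded.setArr {b : ℕ} {m : Mem} (h : m.Bounded b) (a : ℕ) (i : ℤ) {v : ℤ}
    (hv : bits v ≤ b) : (m.setArr a i v).Bounded b := by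
  refine ⟨h.1, fun c j => ?_⟩
  simp only [Mem.setArr, Function.update_apply]
  split_ifs with h1
  · rw [Function.update_apply]
    split_ifs
    · exact hv
    · exact h.2 a j
  · exact h.2 c j

lemma Code.not_mem_wv_of_ok {ro : List ℕ} {i : ℕ} (hi : i ∈ ro) :
    ∀ p : Code, p.ok ro = true → i ∉ p.wv
  | .skip, _ => by simp [wv]
  | .assign j e, h => by
    simp only [ok, Bool.and_eq_true, Bool.not_eq_true', List.contains_eq_mem,
      decide_eq_false_iff_not] at h
    simp only [wv, List.mem_singleton]
    rintro rfl
    exact h.1 hi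
  | .store _ _ _, _ => by simp [wv]
  | .seq p q, h => by
    simp only [ok, Bool.and_eq_true] at h
    simp [wv, not_mem_wv_of_ok hi p h.1, not_mem_wv_of_ok hi q h.2]
  | .ite _ p q, h => by
    simp only [ok, Bool.and_eq_true] at h
    simp [wv, not_mem_wv_of_ok hi p h.2.1, not_mem_wv_of_ok hi q h.2.2]
  | .loop j b p, h => by
    simp only [ok, Bool.and_eq_true, Bool.not_eq_true', List.contains_eq_mem,
      decide_eq_false_iff_not] at h
    simp only [wv, List.mem_cons, not_or]
    refine ⟨?_, not_mem_wv_of_ok hi p h.2.2.2⟩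
    rintro rfl
    exact h.1 hi

lemma Code.zero_not_mem_wa_of_ok {ro : List ℕ} : ∀ p : Code, p.ok ro = true → 0 ∉ p.wa
  | .skip, _ => by simp [wa]
  | .assign _ _, _ => by simp [wa]
  | .store a _ _, h => by
    simp only [ok, Bool.and_eq_true, bne_iff_ne] at h
    simpa [wa] using h.1.symm
  | .seq p q, h => by
    simp only [ok, Bool.and_eq_true] at h
    simp [wa, zero_not_mem_wa_of_ok p h.1, zero_not_mem_wa_of_ok q h.2]
  | .ite _ p q, h => by
    simp only [ok, Bool.and_eq_true] at h
    simp [wa, zero_not_mem_wa_of_ok p h.2.1, zero_not_mem_wa_of_ok q h.2.2]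
  | .loop j b p, h => by
    simp only [ok, Bool.and_eq_true] at h
    simpa [wa] using zero_not_mem_wa_of_ok p h.2.2.2

lemma RoBound.den {ro : List ℕ} {K : ℕ} {m : Mem} (h : RoBound ro K m) {p : Code}
    (hp : p.ok ro = true) : RoBound ro K (p.den m) := by
  refine ⟨fun i hi => ?_, fun j => ?_⟩
  · rw [p.var_den m (p.not_mem_wv_of_ok hi hp)]; exact h.1 i hi
  · rw [p.arr_den m (p.zero_not_mem_wa_of_ok hp)]; exact h.2 j

lemma RoBound.setVar {ro : List ℕ} {K : ℕ} {m : Mem} (h : RoBound ro K m) {i : ℕ}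
    (hi : i ∉ ro) (v : ℤ) : RoBound ro K (m.setVar i v) := by
  refine ⟨fun j hj => ?_, h.2⟩
  have : j ≠ i := fun e => hi (e ▸ hj)
  simp only [Mem.setVar, Function.update_of_ne this]
  exact h.1 j hj

/-- The size and the cost of the value of an expression. -/
lemma Expr.bounds (ro : List ℕ) : ∀ e : Expr, e.ok ro = true → ∃ k : ℕ, ∀ (K b : ℕ) (m : Mem),
    RoBound ro K m → m.Bounded b →
      bits (e.eval m) ≤ b + k * (K + 1) ∧ e.cost m ≤ k * (b + K + 1)
  | .lit c, _ => by
    refine ⟨bits c + 1, fun K b m _ _ => ⟨?_, ?_⟩⟩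
    · simp only [eval]; nlinarith
    · simp only [cost]; nlinarith
  | .var i, _ => by
    refine ⟨1, fun K b m _ hb => ⟨?_, ?_⟩⟩
    · have := hb.1 i
      simp only [eval]; omega
    · have := hb.1 i
      simp only [cost]; omega
  | .get a e, h => by
    obtain ⟨k, hk⟩ := e.bounds ro h
    refine ⟨k + 1, fun K b m hK hb => ?_⟩
    obtain ⟨h1, h2⟩ := hk K b m hK hb
    have := hb.2 a (e.eval m)
    refine ⟨?_, ?_⟩
    · simp only [eval]; nlinarith
    · simp only [cost]; nlinarith
  | .add e f, h => by
    simp only [ok, Bool.and_eq_true] at h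
    obtain ⟨k, hk⟩ := e.bounds ro h.1
    obtain ⟨l, hl⟩ := f.bounds ro h.2
    refine ⟨2 * (k + l) + 3, fun K b m hK hb => ?_⟩
    obtain ⟨h1, h2⟩ := hk K b m hK hb
    obtain ⟨h3, h4⟩ := hl K b m hK hb
    have h5 : bits (e.eval m + f.eval m) ≤ b + (k + l) * (K + 1) + 1 :=
      bits_add_le (h1.trans (by nlinarith)) (h3.trans (by nlinarith))
    refine ⟨?_, ?_⟩
    · simp only [eval]; nlinarith
    · simp only [cost]; nlinarith [Nat.zero_le ((k + l) * b)]
  | .sub e f, h => by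
    simp only [ok, Bool.and_eq_true] at h
    obtain ⟨k, hk⟩ := e.bounds ro h.1
    obtain ⟨l, hl⟩ := f.bounds ro h.2
    refine ⟨2 * (k + l) + 3, fun K b m hK hb => ?_⟩
    obtain ⟨h1, h2⟩ := hk K b m hK hb
    obtain ⟨h3, h4⟩ := hl K b m hK hb
    have h5 : bits (e.eval m - f.eval m) ≤ b + (k + l) * (K + 1) + 1 :=
      bits_sub_le (h1.trans (by nlinarith)) (h3.trans (by nlinarith))
    refine ⟨?_, ?_⟩
    · simp only [eval]; nlinarith
    · simp only [cost]; nlinarith [Nat.zero_le ((k + l) * b)]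
  | .mul e f, h => by
    simp only [ok, Bool.and_eq_true] at h
    obtain ⟨k, hk⟩ := e.bounds ro h.1
    obtain ⟨l, hl⟩ := f.bounds ro h.2.1
    -- The size of an allowed second factor is bounded in terms of K alone, so a product adds bits
    -- instead of doubling them. The coefficient 1 of `b` in the size bound is what survives
    -- iteration.
    obtain ⟨r, hr⟩ : ∃ r : ℕ, ∀ (K : ℕ) (m : Mem), RoBound ro K m →
        bits (f.eval m) ≤ r * (K + 1) := by
      match f, h.2.2 with
      | .lit c, _ =>
        refine ⟨bits c, fun K m _ => ?_⟩
        simp only [eval]; nlinarith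
      | .var i, hf =>
        refine ⟨1, fun K m hK => ?_⟩
        simp only [isFactor, List.contains_eq_mem, decide_eq_true_eq] at hf
        have := bits_le_of_le (hK.1 i hf).1 (hK.1 i hf).2
        simp only [eval]; omega
      | .get a j, hf =>
        refine ⟨1, fun K m hK => ?_⟩
        simp only [isFactor, beq_iff_eq] at hf
        subst hf
        have := hK.2 (j.eval m)
        simp only [eval]; omega
    refine ⟨2 * (k + l + r) + 3, fun K b m hK hb => ?_⟩
    obtain ⟨h1, h2⟩ := hk K b m hK hb
    obtain ⟨h3, h4⟩ := hl K b m hK hb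
    have h6 := hr K m hK
    have h5 : bits (e.eval m * f.eval m) ≤ b + k * (K + 1) + r * (K + 1) :=
      (bits_mul_le _ _).trans (by omega)
    refine ⟨?_, ?_⟩
    · simp only [eval]; nlinarith
    · simp only [cost]; nlinarith [Nat.zero_le ((k + l + r) * b), Nat.zero_le (r * b)]
  | .div e f, h => by
    simp only [ok, Bool.and_eq_true] at h
    obtain ⟨k, hk⟩ := e.bounds ro h.1
    obtain ⟨l, hl⟩ := f.bounds ro h.2
    refine ⟨2 * (k + l) + 3, fun K b m hK hb => ?_⟩
    obtain ⟨h1, h2⟩ := hk K b m hK hb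
    obtain ⟨h3, h4⟩ := hl K b m hK hb
    have h5 : bits (e.eval m / f.eval m) ≤ b + k * (K + 1) := (bits_div_le _ _).trans h1
    refine ⟨?_, ?_⟩
    · simp only [eval]; nlinarith
    · simp only [cost]; nlinarith [Nat.zero_le ((k + l) * b)]

/-- Absorbs constants into exponents, so that a single exponent `d` describes each polynomial bound.
-/
lemma le_two_add_pow (k K : ℕ) : k ≤ (K + 2) ^ k :=
  (Nat.lt_two_pow_self (n := k)).le.trans (Nat.pow_le_pow_left (by omega) k)

/-- The cost of an expression in the form used for programs. -/
lemma Expr.bounds_pow (ro : List ℕ) (e : Expr) (he : e.ok ro = true) :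
    ∃ d : ℕ, ∀ (K b : ℕ) (m : Mem), RoBound ro K m → m.Bounded b →
      bits (e.eval m) ≤ b + (K + 2) ^ d ∧ 1 + e.cost m ≤ (b + 1) * (K + 2) ^ d := by
  obtain ⟨k, hk⟩ := e.bounds ro he
  refine ⟨k + 2, fun K b m hK hb => ?_⟩
  obtain ⟨h1, h2⟩ := hk K b m hK hb
  have h3 : k ≤ (K + 2) ^ k := le_two_add_pow k K
  have h4 : 1 ≤ (K + 2) ^ k := Nat.one_le_pow _ _ (by omega)
  rw [pow_add]
  set g := (K + 2) ^ k
  have h5 : k * (K + 1) ≤ g * (K + 2) ^ 2 := by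
    exact Nat.mul_le_mul h3 (by nlinarith)
  refine ⟨by omega, ?_⟩
  have h6 : 1 + k * (b + K + 1) ≤ g * (b + K + 2) := by
    have : k * (b + K + 1) ≤ g * (b + K + 1) := Nat.mul_le_mul_right _ h3
    nlinarith
  have h7 : b + K + 2 ≤ (b + 1) * (K + 2) ^ 2 := by nlinarith [Nat.zero_le (b * K)]
  calc 1 + e.cost m ≤ g * (b + K + 2) := by omega
    _ ≤ g * ((b + 1) * (K + 2) ^ 2) := Nat.mul_le_mul_left _ h7
    _ = (b + 1) * (g * (K + 2) ^ 2) := by ring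

/-- The statement that `p` runs in polynomial time: bounds in terms of the size `b` of the memory
and of a bound `K` for the read-only data. -/
def Code.PolyBound (ro : List ℕ) (p : Code) (d : ℕ) : Prop :=
  ∀ (K b : ℕ) (m : Mem), RoBound ro K m → m.Bounded b →
    ∃ c, Runs p.compile m c (p.den m) ∧ c ≤ (b + 1) * (K + 2) ^ d ∧
      (p.den m).Bounded (b + (K + 2) ^ d)

/-- The second program starts on numbers of b + (K+2)^d₁ bits. The extra 2 in the exponent is a
factor of at least 4, enough for the sums that arise. -/
lemma Code.polyBound_seq {ro : List ℕ} {p q : Code} {d₁ d₂ : ℕ} (hp : p.ok ro = true)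
    (h₁ : p.PolyBound ro d₁) (h₂ : q.PolyBound ro d₂) :
    (Code.seq p q).PolyBound ro (d₁ + d₂ + 2) := by
  intro K b m hK hb
  obtain ⟨c₁, r₁, l₁, b₁⟩ := h₁ K b m hK hb
  obtain ⟨c₂, r₂, l₂, b₂⟩ := h₂ K _ _ (hK.den hp) b₁
  refine ⟨c₁ + c₂, .seq r₁ r₂, ?_, b₂.mono ?_⟩
  all_goals
    have g1 : 1 ≤ (K + 2) ^ d₁ := Nat.one_le_pow _ _ (by omega)
    have g2 : 1 ≤ (K + 2) ^ d₂ := Nat.one_le_pow _ _ (by omega)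
    have e : (K + 2) ^ (d₁ + d₂ + 2) = (K + 2) ^ d₁ * (K + 2) ^ d₂ * (K + 2) ^ 2 := by
      rw [pow_add, pow_add]
    have e4 : 4 ≤ (K + 2) ^ 2 := Nat.pow_le_pow_left (by omega : 2 ≤ K + 2) 2
    rw [e]
    set G := (K + 2) ^ d₁
    set H := (K + 2) ^ d₂
    have hGH : 1 ≤ G * H := Nat.one_le_iff_ne_zero.2 (by positivity)
    have hG : G ≤ G * H := Nat.le_mul_of_pos_right _ g2
    have hH : H ≤ G * H := Nat.le_mul_of_pos_left _ g1
    have h4 : G * H * 4 ≤ G * H * (K + 2) ^ 2 := Nat.mul_le_mul_left _ e4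
  · have s1 : (b + G + 1) * H ≤ (b + 1) * (2 * (G * H)) := by
      have : b + G + 1 ≤ (b + 1) * (2 * G) := by nlinarith
      calc (b + G + 1) * H ≤ (b + 1) * (2 * G) * H := Nat.mul_le_mul_right _ this
        _ = _ := by ring
    have s2 : (b + 1) * G ≤ (b + 1) * (G * H) := Nat.mul_le_mul_left _ hG
    have s3 := Nat.mul_le_mul_left (b + 1) h4
    calc c₁ + c₂ ≤ (b + 1) * (G * H) + (b + 1) * (2 * (G * H)) := by omega
      _ ≤ (b + 1) * (G * H * 4) := by nlinarith
      _ ≤ _ := s3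
  · omega

lemma loop_size_le (K : ℕ) {G : ℕ} (g1 : 1 ≤ G) : (K + 2) + K * G ≤ G * G * (K + 2) ^ 12 := by
  have h1 : G ≤ G * G := Nat.le_mul_of_pos_right _ g1
  have h2 : 2 * (K + 2) ≤ (K + 2) ^ 12 :=
    calc 2 * (K + 2) ≤ (K + 2) * (K + 2) := Nat.mul_le_mul_right _ (by omega)
      _ = (K + 2) ^ 2 := by ring
      _ ≤ (K + 2) ^ 12 := Nat.pow_le_pow_right (by omega) (by omega)
  calc (K + 2) + K * G ≤ G * (2 * (K + 2)) := by nlinarith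
    _ ≤ G * G * (K + 2) ^ 12 := Nat.mul_le_mul h1 h2

/-- Arithmetic for `polyBound_loop`. With Q = K + 2 ≥ 2 the cost is a constant times Q², absorbed by
the exponent 12 since 44 ≤ 2^10 ≤ Q^10. -/
lemma loop_cost_le (B K : ℕ) {G : ℕ} (g1 : 1 ≤ G) :
    2 + (K + 1) * ((B + (K + 2) + K * G + 1) * G + (6 * K + 20)) ≤
      (B + 1) * (G * G * (K + 2) ^ 12) := by
  obtain ⟨Q, hQ⟩ : ∃ Q, K + 2 = Q := ⟨_, rfl⟩
  have u1 : B + (K + 2) + K * G + 1 ≤ (B + 1) * (2 * (Q * G)) := by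
    have h2 : (B + 1) * (2 * (Q * G)) = B * (2 * (Q * G)) + 2 * (Q * G) := by ring
    have hp : 0 < Q * G := Nat.mul_pos (by omega) g1
    have h3 : B ≤ B * (2 * (Q * G)) := Nat.le_mul_of_pos_right _ (by omega)
    have h4 : K * G + 2 * G = Q * G := by rw [← hQ]; ring
    have h5 : Q ≤ Q * G := Nat.le_mul_of_pos_right _ g1
    omega
  have hBG : 1 ≤ (B + 1) * (G * G) := Nat.mul_pos (by omega) (Nat.mul_pos g1 g1)
  have a3 : Q ≤ (B + 1) * (G * G) * Q := Nat.le_mul_of_pos_left _ hBG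
  have u2 : (B + (K + 2) + K * G + 1) * G + (6 * K + 20) ≤ (B + 1) * (G * G) * Q * 22 := by
    have a1 : (B + (K + 2) + K * G + 1) * G ≤ (B + 1) * (2 * (Q * G)) * G :=
      Nat.mul_le_mul_right _ u1
    have a4 : (B + 1) * (2 * (Q * G)) * G = (B + 1) * (G * G) * Q * 2 := by ring
    omega
  have u6 : 44 * Q ^ 2 ≤ Q ^ 12 := by
    have h1 : 2 ^ 10 ≤ Q ^ 10 := Nat.pow_le_pow_left (by omega) 10
    calc 44 * Q ^ 2 ≤ Q ^ 10 * Q ^ 2 := Nat.mul_le_mul_right _ (by omega)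
      _ = Q ^ 12 := by ring
  have u3 := Nat.mul_le_mul (show K + 1 ≤ Q by omega) u2
  have u4 : Q * ((B + 1) * (G * G) * Q * 22) = (B + 1) * (G * G) * (22 * Q ^ 2) := by ring
  have u5 := Nat.mul_le_mul_left ((B + 1) * (G * G)) u6
  have u7 : (B + 1) * (G * G) * (44 * Q ^ 2) = 2 * ((B + 1) * (G * G) * (22 * Q ^ 2)) := by ring
  have u8 : 2 ≤ (B + 1) * (G * G) * (22 * Q ^ 2) := by
    have : 1 ≤ Q ^ 2 := Nat.one_le_pow _ _ (by omega)
    calc 2 ≤ 1 * (22 * Q ^ 2) := by omega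
      _ ≤ _ := Nat.mul_le_mul_right _ hBG
  rw [hQ] at *
  calc _ ≤ (B + 1) * (G * G) * Q ^ 12 := by omega
    _ = _ := by ring

/-- The bound of the loop is read-only, so there are at most K rounds. Each adds at most G = (K+2)^d
bits, whatever the size reached before; hence sizes grow linearly in the number of rounds. -/
lemma Code.polyBound_loop {ro : List ℕ} {p : Code} {i b : ℕ} {d : ℕ}
    (hok : (Code.loop i b p).ok ro = true) (h : p.PolyBound ro d) :
    (Code.loop i b p).PolyBound ro (2 * d + 12) := by
  simp only [ok, Bool.and_eq_true, Bool.not_eq_true', List.contains_eq_mem,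
    decide_eq_false_iff_not, decide_eq_true_eq] at hok
  obtain ⟨hi, hb, hiw, hp⟩ := hok
  intro K B m hK hB
  set n := (m.var b).toNat with hn
  have hbK := hK.1 b hb
  have hnK : n ≤ K := by omega
  have hnb : (n : ℤ) = m.var b := by omega
  have hib : b ≠ i := fun e => hi (e ▸ hb)
  set G := (K + 2) ^ d with hG
  have g1 : 1 ≤ G := Nat.one_le_pow _ _ (by omega)
  -- The summand K + 2 leaves room for the loop counter, whose bits the body does not account for.
  have st : ∀ k, k ≤ n → RoBound ro K (rounds p.den i m k) ∧
      (rounds p.den i m k).Bounded (B + (K + 2) + k * G) ∧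
      (rounds p.den i m k).var i = k ∧ (rounds p.den i m k).var b = n := by
    intro k
    induction k with
    | zero =>
      intro _
      refine ⟨hK.setVar hi 0, (hB.mono (by omega)).setVar i (by simp [bits]), by
        simp [rounds, Mem.setVar], ?_⟩
      simp only [rounds, Mem.setVar, Function.update_of_ne hib]
      exact hnb.symm
    | succ k ih =>
      intro hk
      obtain ⟨i1, i2, -, i4⟩ := ih (by omega)
      obtain ⟨c, -, -, hbd⟩ := h K _ _ i1 i2
      refine ⟨(i1.den hp).setVar hi _, (hbd.mono ?_).setVar i ?_, by
        simp [rounds, Mem.setVar], ?_⟩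
      · rw [← hG]; nlinarith
      · have := bits_le_of_le (z := (k : ℤ) + 1) (k := k + 1) (by omega) (by push_cast; omega)
        omega
      · simp only [rounds, Mem.setVar, Function.update_of_ne hib]
        rw [p.var_den _ (p.not_mem_wv_of_ok hb hp)]
        exact i4
  -- A bound for one round: the body, charged at the largest memory size that occurs, plus the test
  -- and the increment of the counter.
  set C := (B + (K + 2) + K * G + 1) * G + (6 * K + 20) with hC
  have tb : ∀ k, k ≤ n → 1 + Expr.cost (rounds p.den i m k) (.sub (.var b) (.var i)) ≤
      3 * K + 4 := by
    intro k hk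
    obtain ⟨-, -, i3, i4⟩ := st k hk
    simp only [Expr.cost, Expr.eval, i3, i4]
    have q1 := bits_le_of_le (z := (n : ℤ)) (k := K) (by omega) (by omega)
    have q2 := bits_le_of_le (z := (k : ℤ)) (k := K) (by omega) (by omega)
    have q3 := bits_le_of_le (z := (n : ℤ) - k) (k := K) (by omega) (by omega)
    omega
  have run : ∀ r k, k + r = n → ∃ c, Runs (.whilePos (.sub (.var b) (.var i))
      (.seq p.compile (.assign i (.add (.var i) (.lit 1))))) (rounds p.den i m k) c
      (rounds p.den i m n) ∧ c ≤ (r + 1) * C := by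
    intro r
    induction r with
    | zero =>
      intro k hk
      obtain ⟨-, -, i3, i4⟩ := st k (by omega)
      have hkn : k = n := by omega
      rw [← hkn] at i4 ⊢
      refine ⟨_, .whileFalse (by simp [Expr.eval, i3, i4]), (tb k (by omega)).trans ?_⟩
      rw [hC]; omega
    | succ r ih =>
      intro k hk
      obtain ⟨c', hr', hc'⟩ := ih (k + 1) (by omega)
      obtain ⟨i1, i2, i3, i4⟩ := st k (by omega)
      obtain ⟨c, hr, hc, -⟩ := h K _ _ i1 i2
      have hvi : (p.den (rounds p.den i m k)).var i = k := by
        rw [p.var_den _ hiw]; exact i3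
      have ha := Runs.assign (p.den (rounds p.den i m k)) i (.add (.var i) (.lit 1))
      have hm : (p.den (rounds p.den i m k)).setVar i
          ((Expr.add (.var i) (.lit 1)).eval (p.den (rounds p.den i m k))) =
          rounds p.den i m (k + 1) := by
        simp only [Expr.eval, hvi, rounds]
      rw [hm] at ha
      refine ⟨_, .whileTrue (by simp only [Expr.eval, i3, i4]; omega) (.seq hr ha) hr', ?_⟩
      have t1 := tb k (by omega)
      have t2 : 1 + Expr.cost (p.den (rounds p.den i m k)) (.add (.var i) (.lit 1)) ≤
          2 * K + 8 := by
        simp only [Expr.cost, Expr.eval, hvi]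
        have q2 := bits_le_of_le (z := (k : ℤ)) (k := K) (by omega) (by omega)
        have q3 := bits_le_of_le (z := (k : ℤ) + 1) (k := K + 1) (by omega) (by push_cast; omega)
        have q4 : bits 1 = 1 := by decide
        omega
      have t3 : c ≤ (B + (K + 2) + K * G + 1) * G := by
        refine hc.trans (Nat.mul_le_mul_right _ ?_)
        have : k * G ≤ K * G := Nat.mul_le_mul_right _ (by omega)
        omega
      have t4 : (r + 1 + 1) * C = (r + 1) * C + C := by ring
      rw [t4]
      omega
  obtain ⟨c, hr, hc⟩ := run n 0 (by omega)
  have ha := Runs.assign m i (.lit 0)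
  refine ⟨_, .seq ha hr, ?_, (st n le_rfl).2.1.mono ?_⟩
  · have c1 : 1 + Expr.cost m (.lit 0) = 2 := by simp [Expr.cost, bits]
    have u3 : (n + 1) * C ≤ (K + 1) * C := Nat.mul_le_mul_right _ (by omega)
    have e : (K + 2) ^ (2 * d + 12) = G * G * (K + 2) ^ 12 := by
      rw [hG, pow_add, two_mul, pow_add]
    rw [c1, e]
    have := loop_cost_le B K g1
    rw [← hC] at this
    omega
  · have e : (K + 2) ^ (2 * d + 12) = G * G * (K + 2) ^ 12 := by
      rw [hG, pow_add, two_mul, pow_add]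
    have v1 : n * G ≤ K * G := Nat.mul_le_mul_right _ (by omega)
    have := loop_size_le K g1
    omega

/-- Programs with bounded loops run in polynomial time. -/
theorem Code.exists_polyBound (ro : List ℕ) :
    ∀ p : Code, p.ok ro = true → ∃ d, p.PolyBound ro d
  | .skip, _ => ⟨0, fun K b m _ hb => ⟨1, .skip m, by simp, hb.mono (by omega)⟩⟩
  | .assign i e, h => by
    simp only [ok, Bool.and_eq_true] at h
    obtain ⟨d, hd⟩ := e.bounds_pow ro h.2
    refine ⟨d, fun K b m hK hb => ?_⟩
    obtain ⟨h1, h2⟩ := hd K b m hK hb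
    exact ⟨_, .assign m i e, h2, (hb.mono (by omega)).setVar i h1⟩
  | .store a j e, h => by
    simp only [ok, Bool.and_eq_true] at h
    obtain ⟨d, hd⟩ := e.bounds_pow ro h.2.2
    obtain ⟨f, hf⟩ := j.bounds_pow ro h.2.1
    refine ⟨d + f + 1, fun K b m hK hb => ?_⟩
    obtain ⟨h1, h2⟩ := hd K b m hK hb
    obtain ⟨-, h4⟩ := hf K b m hK hb
    have g1 : 1 ≤ (K + 2) ^ d := Nat.one_le_pow _ _ (by omega)
    have g2 : 1 ≤ (K + 2) ^ f := Nat.one_le_pow _ _ (by omega)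
    have e1 : (K + 2) ^ (d + f + 1) = (K + 2) ^ d * (K + 2) ^ f * (K + 2) := by
      rw [pow_add, pow_add, pow_one]
    have e2 : (K + 2) ^ d + (K + 2) ^ f ≤ (K + 2) ^ (d + f + 1) := by
      rw [e1]
      have a1 : (K + 2) ^ d ≤ (K + 2) ^ d * (K + 2) ^ f := Nat.le_mul_of_pos_right _ g2
      have a2 : (K + 2) ^ f ≤ (K + 2) ^ d * (K + 2) ^ f := Nat.le_mul_of_pos_left _ g1
      nlinarith
    refine ⟨_, .store m a j e, ?_, (hb.mono (by omega)).setArr a _ (h1.trans (by omega))⟩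
    calc 1 + j.cost m + e.cost m ≤ (b + 1) * ((K + 2) ^ d + (K + 2) ^ f) := by
          rw [mul_add]; omega
      _ ≤ _ := Nat.mul_le_mul_left _ e2
  | .seq p q, h => by
    simp only [ok, Bool.and_eq_true] at h
    obtain ⟨d, hd⟩ := exists_polyBound ro p h.1
    obtain ⟨f, hf⟩ := exists_polyBound ro q h.2
    exact ⟨_, polyBound_seq h.1 hd hf⟩
  | .ite e p q, h => by
    simp only [ok, Bool.and_eq_true] at h
    obtain ⟨k, hk⟩ := e.bounds_pow ro h.1
    obtain ⟨d, hd⟩ := exists_polyBound ro p h.2.1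
    obtain ⟨f, hf⟩ := exists_polyBound ro q h.2.2
    refine ⟨k + d + f + 1, fun K b m hK hb => ?_⟩
    obtain ⟨-, h2⟩ := hk K b m hK hb
    have g0 : 1 ≤ (K + 2) ^ k := Nat.one_le_pow _ _ (by omega)
    have g1 : 1 ≤ (K + 2) ^ d := Nat.one_le_pow _ _ (by omega)
    have g2 : 1 ≤ (K + 2) ^ f := Nat.one_le_pow _ _ (by omega)
    have a1 : (K + 2) ^ d ≤ (K + 2) ^ (d + f) := Nat.pow_le_pow_right (by omega) (by omega)
    have a2 : (K + 2) ^ f ≤ (K + 2) ^ (d + f) := Nat.pow_le_pow_right (by omega) (by omega)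
    have e2 : (K + 2) ^ k + (K + 2) ^ (d + f) ≤ (K + 2) ^ (k + d + f + 1) := by
      have e1 : (K + 2) ^ (k + d + f + 1) = (K + 2) ^ k * (K + 2) ^ (d + f) * (K + 2) := by
        rw [← pow_add, ← pow_succ]; congr 1; omega
      rw [e1]
      have g3 : 1 ≤ (K + 2) ^ (d + f) := g1.trans a1
      have b1 : (K + 2) ^ k ≤ (K + 2) ^ k * (K + 2) ^ (d + f) := Nat.le_mul_of_pos_right _ g3
      have b2 : (K + 2) ^ (d + f) ≤ (K + 2) ^ k * (K + 2) ^ (d + f) :=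
        Nat.le_mul_of_pos_left _ g0
      nlinarith
    have e3 := Nat.mul_le_mul_left (b + 1) e2
    rw [mul_add] at e3
    by_cases he : 0 < e.eval m
    · obtain ⟨c, r1, r2, r3⟩ := hd K b m hK hb
      refine ⟨_, by rw [den, if_pos he]; exact .ifTrue he r1, ?_, ?_⟩
      · have := Nat.mul_le_mul_left (b + 1) a1
        omega
      · rw [den, if_pos he]; exact r3.mono (by omega)
    · obtain ⟨c, r1, r2, r3⟩ := hf K b m hK hb
      refine ⟨_, by rw [den, if_neg he]; exact .ifFalse he r1, ?_, ?_⟩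
      · have := Nat.mul_le_mul_left (b + 1) a2
        omega
      · rw [den, if_neg he]; exact r3.mono (by omega)
  | .loop i b p, h => by
    have h' := h
    simp only [ok, Bool.and_eq_true] at h'
    obtain ⟨d, hd⟩ := exists_polyBound ro p h'.2.2.2
    exact ⟨_, polyBound_loop h hd⟩

/-! ### Reasoning about bounded loops -/

lemma Mem.var_setVar (m : Mem) (i j : ℕ) (x : ℤ) :
    (m.setVar i x).var j = if j = i then x else m.var j := by
  simp [Mem.setVar, Function.update_apply]

lemma Mem.arr_setVar (m : Mem) (i : ℕ) (x : ℤ) : (m.setVar i x).arr = m.arr := rfl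

lemma Mem.var_setArr (m : Mem) (a : ℕ) (i x : ℤ) : (m.setArr a i x).var = m.var := rfl

lemma Mem.arr_setArr (m : Mem) (a b : ℕ) (i x : ℤ) :
    (m.setArr a i x).arr b = if b = a then Function.update (m.arr a) i x else m.arr b := by
  simp [Mem.setArr, Function.update_apply]

/-- The memories `m` and `m'` differ at most in the given variables and arrays. -/
def SameBut (vs as : List ℕ) (m m' : Mem) : Prop :=
  (∀ j, j ∉ vs → m'.var j = m.var j) ∧ ∀ a, a ∉ as → m'.arr a = m.arr a

lemma Code.sameBut (p : Code) (m : Mem) : SameBut p.wv p.wa m (p.den m) :=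
  ⟨fun _ hj => p.var_den m hj, fun _ ha => p.arr_den m ha⟩

/-- The invariant rule for bounded loops. -/
lemma Code.loop_inv {i b : ℕ} {p : Code} {m : Mem} (I : ℕ → Mem → Prop) {K : ℕ}
    (hK : m.var b = K) (hI : ∀ k m x, I k m → I k (m.setVar i x)) (h0 : I 0 m)
    (hs : ∀ (k : ℕ) (m' : Mem), k < K → m'.var i = (k : ℤ) → SameBut (i :: p.wv) p.wa m m' → I k m' →
      I (k + 1) (p.den m')) : I K ((Code.loop i b p).den m) := by
  have key : ∀ k, k ≤ K → I k (rounds p.den i m k) ∧ (rounds p.den i m k).var i = k ∧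
      SameBut (i :: p.wv) p.wa m (rounds p.den i m k) := by
    intro k
    induction k with
    | zero =>
      intro _
      refine ⟨hI _ _ _ h0, by simp [rounds, Mem.var_setVar], fun j hj => ?_, fun a _ => rfl⟩
      simp only [List.mem_cons, not_or] at hj
      simp [rounds, Mem.var_setVar, hj.1]
    | succ k ih =>
      intro hk
      obtain ⟨h1, h2, h3⟩ := ih (by omega)
      refine ⟨hI _ _ _ (hs k _ (by omega) h2 h3 h1), by simp [rounds, Mem.var_setVar],
        fun j hj => ?_, fun a ha => ?_⟩
      · rw [← h3.1 j hj]
        simp only [List.mem_cons, not_or] at hj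
        rw [← p.var_den (rounds p.den i m k) hj.2]
        simp [rounds, Mem.var_setVar, hj.1]
      · rw [← h3.2 a ha, ← p.arr_den (rounds p.den i m k) ha]
        rfl
  have : (m.var b).toNat = K := by omega
  rw [den, this]
  exact (key K le_rfl).1

/-! ### Matrices in memory and their cuts -/

/-- An array read as a matrix with rows of length `N`. -/
def mat (f : ℤ → ℤ) (N : ℕ) (u v : ℕ) : ℤ := f ((u : ℤ) * N + v)

lemma index_inj {N u v u' v' : ℕ} (hv : v < N) (hv' : v' < N)
    (h : (u : ℤ) * N + v = u' * N + v') : u = u' ∧ v = v' := by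
  have h' : u * N + v = u' * N + v' := by exact_mod_cast h
  have hN : 0 < N := by omega
  have h1 : (u * N + v) / N = u := by
    rw [Nat.add_comm, Nat.add_mul_div_right _ _ hN, Nat.div_eq_of_lt hv, zero_add]
  have h2 : (u' * N + v') / N = u' := by
    rw [Nat.add_comm, Nat.add_mul_div_right _ _ hN, Nat.div_eq_of_lt hv', zero_add]
  have : u = u' := by rw [← h1, h', h2]
  subst this
  exact ⟨rfl, by omega⟩

lemma mat_update {f : ℤ → ℤ} {N u v u' v' : ℕ} (hv : v < N) (hv' : v' < N) (x : ℤ) :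
    mat (Function.update f ((u : ℤ) * N + v) x) N u' v' =
      if u' = u ∧ v' = v then x else mat f N u' v' := by
  unfold mat
  by_cases h : u' = u ∧ v' = v
  · rw [if_pos h, h.1, h.2, Function.update_self]
  · rw [if_neg h, Function.update_of_ne]
    intro e
    exact h (index_inj hv' hv e)

/-- The weight of the pairs that leave `S`. -/
def cutw (N : ℕ) (r : ℕ → ℕ → ℤ) (S : Finset ℕ) : ℤ :=
  ∑ u ∈ Finset.range N, ∑ v ∈ Finset.range N, if u ∈ S ∧ v ∉ S then r u v else 0

lemma cutw_congr {N : ℕ} {r r' : ℕ → ℕ → ℤ} (h : ∀ u < N, ∀ v < N, r u v = r' u v)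
    (S : Finset ℕ) : cutw N r S = cutw N r' S := by
  refine Finset.sum_congr rfl fun u hu => Finset.sum_congr rfl fun v hv => ?_
  rw [h u (Finset.mem_range.1 hu) v (Finset.mem_range.1 hv)]

lemma cutw_nonneg {N : ℕ} {r : ℕ → ℕ → ℤ} (h : ∀ u < N, ∀ v < N, 0 ≤ r u v) (S : Finset ℕ) :
    0 ≤ cutw N r S := by
  refine Finset.sum_nonneg fun u hu => Finset.sum_nonneg fun v hv => ?_
  split_ifs
  · exact h u (Finset.mem_range.1 hu) v (Finset.mem_range.1 hv)
  · exact le_rfl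

lemma cutw_le {N : ℕ} {r : ℕ → ℕ → ℤ} {S : Finset ℕ} {B : ℤ} (hB : 0 ≤ B)
    (h : ∀ u < N, ∀ v < N, u ∈ S → v ∉ S → r u v ≤ B) : cutw N r S ≤ N * N * B := by
  have : cutw N r S ≤ ∑ u ∈ Finset.range N, ∑ v ∈ Finset.range N, B := by
    refine Finset.sum_le_sum fun u hu => Finset.sum_le_sum fun v hv => ?_
    split_ifs with huv
    · exact h u (Finset.mem_range.1 hu) v (Finset.mem_range.1 hv) huv.1 huv.2
    · exact hB
  refine this.trans (le_of_eq ?_)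
  simp [mul_assoc]

/-- The matrix `r` with the entry at `(p, q)` increased by `δ`. -/
def addAt (r : ℕ → ℕ → ℤ) (p q : ℕ) (δ : ℤ) : ℕ → ℕ → ℤ :=
  fun a b => if a = p ∧ b = q then r a b + δ else r a b

lemma cutw_addAt {N p q : ℕ} (hp : p < N) (hq : q < N) (r : ℕ → ℕ → ℤ) (δ : ℤ)
    (S : Finset ℕ) :
    cutw N (addAt r p q δ) S = cutw N r S + if p ∈ S ∧ q ∉ S then δ else 0 := by
  have e : ∀ a b, (if a ∈ S ∧ b ∉ S then addAt r p q δ a b else 0) =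
      (if a ∈ S ∧ b ∉ S then r a b else 0) +
        if a = p then (if b = q then (if p ∈ S ∧ q ∉ S then δ else 0) else 0) else 0 := by
    intro a b
    unfold addAt
    by_cases h1 : a = p <;> by_cases h2 : b = q
    · subst h1 h2; split_ifs <;> simp_all
    all_goals simp [h1, h2]
  unfold cutw
  simp only [e, Finset.sum_add_distrib]
  congr 1
  simp [Finset.sum_ite_irrel, hp, hq]

/-! ### Searching for an augmenting path -/

/-- The labelled vertices. -/
def labelled (N : ℕ) (lab : ℤ → ℤ) : Finset ℕ := (Finset.range N).filter fun v => 0 < lab v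

lemma mem_labelled {N v : ℕ} {lab : ℤ → ℤ} : v ∈ labelled N lab ↔ v < N ∧ 0 < lab v := by
  simp [labelled]

/-- The labels `lab` and the parents `par` describe a tree of arcs of capacity at least `Δ` that is
rooted at `σ`; the label of a vertex is its depth. -/
structure SearchTree (N σ : ℕ) (Δ : ℤ) (r : ℕ → ℕ → ℤ) (lab par : ℤ → ℤ) : Prop where
  root : lab σ = 1
  nonneg : ∀ v < N, 0 ≤ lab v
  parent : ∀ v < N, v ≠ σ → 0 < lab v →
    ∃ p < N, par v = p ∧ 0 < lab p ∧ lab v = lab p + 1 ∧ Δ ≤ r p v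
  le_card : ∀ v < N, lab v ≤ (labelled N lab).card

lemma update_natCast (f : ℤ → ℤ) (v w : ℕ) (x : ℤ) :
    Function.update f (v : ℤ) x (w : ℤ) = if w = v then x else f w := by
  rw [Function.update_apply]
  simp

lemma card_labelled_update {N v : ℕ} {lab : ℤ → ℤ} (hv : v < N) (h0 : ¬ 0 < lab v) {x : ℤ}
    (hx : 0 < x) :
    (labelled N (Function.update lab v x)).card = (labelled N lab).card + 1 := by
  have : labelled N (Function.update lab v x) = insert v (labelled N lab) := by
    ext w
    rw [Finset.mem_insert, mem_labelled, mem_labelled, update_natCast]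
    by_cases hw : w = v
    · subst hw; simp [hv, hx]
    · simp [hw]
  rw [this, Finset.card_insert_of_notMem]
  rw [mem_labelled]
  exact fun h => h0 h.2

/-- The vertex `v` was unlabelled, hence nobody's parent, so the old tree is unaffected. Its depth
is at most one more than the old number of labelled vertices, and that number has just grown by one.
-/
lemma SearchTree.label {N σ : ℕ} {Δ : ℤ} {r : ℕ → ℕ → ℤ} {lab par : ℤ → ℤ}
    (h : SearchTree N σ Δ r lab par) {u v : ℕ} (hu : u < N) (hv : v < N) (hlu : 0 < lab u)
    (hlv : ¬ 0 < lab v) (hr : Δ ≤ r u v) :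
    SearchTree N σ Δ r (Function.update lab v (lab u + 1)) (Function.update par v u) := by
  have hvσ : σ ≠ v := by rintro rfl; rw [h.root] at hlv; omega
  have huv : u ≠ v := by rintro rfl; exact hlv hlu
  refine ⟨?_, fun w hw => ?_, fun w hw hwσ hlw => ?_, fun w hw => ?_⟩
  · rw [update_natCast, if_neg hvσ]; exact h.root
  · rw [update_natCast]
    split_ifs
    · omega
    · exact h.nonneg w hw
  · rw [update_natCast] at hlw
    by_cases hwv : w = v
    · subst hwv
      refine ⟨u, hu, by rw [update_natCast, if_pos rfl], ?_, ?_, hr⟩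
      · rw [update_natCast, if_neg huv]; exact hlu
      · rw [update_natCast, update_natCast, if_pos rfl, if_neg huv]
    · rw [if_neg hwv] at hlw
      obtain ⟨p, hp, e, hlp, hw', hrp⟩ := h.parent w hw hwσ hlw
      have hpv : p ≠ v := by rintro rfl; exact hlv hlp
      refine ⟨p, hp, by rw [update_natCast, if_neg hwv, e], ?_, ?_, hrp⟩
      · rw [update_natCast, if_neg hpv]; exact hlp
      · rw [update_natCast, update_natCast, if_neg hwv, if_neg hpv]; exact hw'
  · rw [card_labelled_update hv hlv (by omega), update_natCast]
    push_cast
    split_ifs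
    · have := h.le_card u hu; omega
    · have := h.le_card w hw; omega

/-- The variables and arrays of the program. -/
notation "vLen" => (0 : ℕ)
notation "vn" => (1 : ℕ)
notation "vN" => (2 : ℕ)
notation "vPhases" => (3 : ℕ)
notation "vTries" => (4 : ℕ)
notation "vs" => (5 : ℕ)
notation "vt" => (6 : ℕ)
notation "vTop" => (7 : ℕ)
notation "vBig" => (8 : ℕ)
notation "vScale" => (9 : ℕ)
notation "vDen" => (10 : ℕ)
notation "vFlow" => (11 : ℕ)
notation "vDelta" => (12 : ℕ)
notation "vPhase" => (13 : ℕ)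
notation "vTry" => (14 : ℕ)
notation "vu" => (15 : ℕ)
notation "vv" => (16 : ℕ)
notation "vRound" => (17 : ℕ)
notation "vCur" => (18 : ℕ)
notation "vStep" => (19 : ℕ)
notation "vPar" => (20 : ℕ)
notation "vy" => (21 : ℕ)
notation "vz" => (22 : ℕ)
notation "va" => (23 : ℕ)
notation "vb" => (24 : ℕ)
notation "vTotal" => (25 : ℕ)
notation "vRaise" => (26 : ℕ)
notation "aIn" => (0 : ℕ)
notation "aOut" => (1 : ℕ)
notation "aRes" => (2 : ℕ)
notation "aLab" => (3 : ℕ)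
notation "aPar" => (4 : ℕ)
notation "aCap" => (5 : ℕ)
notation "aZ" => (6 : ℕ)
notation "aRank" => (7 : ℕ)
notation "aUp" => (8 : ℕ)

/-- The position of the entry `(u, v)` of a matrix with `vN` columns. -/
def ix (u v : Expr) : Expr := .add (.mul u (.var vN)) v

namespace Code

/-- Label the vertex `vv` from the vertex `vu` if this is possible. -/
def searchStep : Code :=
  .ite (.get aLab (.var vu))
    (.ite (.sub (.lit 1) (.get aLab (.var vv)))
      (.ite (.add (.sub (.get aRes (ix (.var vu) (.var vv))) (.var vDelta)) (.lit 1))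
        (.seq (.store aPar (.var vv) (.var vu))
          (.store aLab (.var vv) (.add (.get aLab (.var vu)) (.lit 1))))
        .skip) .skip) .skip

/-- Label the vertices that are reachable from the source by arcs of capacity at least `vDelta`. -/
def search : Code :=
  .seq (.loop vv vN (.store aLab (.var vv) (.lit 0)))
    (.seq (.store aLab (.var vn) (.lit 1))
      (.loop vRound vN (.loop vu vN (.loop vv vN searchStep))))

end Code

/-- No arc of capacity at least `Δ` leaves the set of the labelled vertices. -/
def SearchClosed (N : ℕ) (Δ : ℤ) (r : ℕ → ℕ → ℤ) (lab : ℤ → ℤ) : Prop :=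
  ∀ u < N, ∀ v < N, 0 < lab u → ¬ 0 < lab v → r u v < Δ

lemma searchStep_spec {m : Mem} {N σ u v : ℕ} {Δ : ℤ} {r : ℕ → ℕ → ℤ}
    (hN : m.var vN = N) (hΔ : m.var vDelta = Δ) (hr : mat (m.arr aRes) N = r)
    (hu : m.var vu = u) (hv : m.var vv = v) (huN : u < N) (hvN : v < N)
    (h : SearchTree N σ Δ r (m.arr aLab) (m.arr aPar)) :
    SearchTree N σ Δ r ((Code.searchStep.den m).arr aLab) ((Code.searchStep.den m).arr aPar) ∧
      (((Code.searchStep.den m).arr aLab = m.arr aLab ∧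
          ¬ (0 < m.arr aLab u ∧ ¬ 0 < m.arr aLab v ∧ Δ ≤ r u v)) ∨
        ((0 < m.arr aLab u ∧ ¬ 0 < m.arr aLab v ∧ Δ ≤ r u v) ∧
          (labelled N ((Code.searchStep.den m).arr aLab)).card =
          (labelled N (m.arr aLab)).card + 1)) := by
  have hr' : m.arr aRes ((u : ℤ) * N + v) = r u v := by rw [← hr]; rfl
  have hnn := h.nonneg v hvN
  by_cases c1 : 0 < m.arr aLab u
  · by_cases c2 : 0 < m.arr aLab v
    · have : Code.searchStep.den m = m := by
        have c2' : ¬ 0 < 1 - m.arr aLab v := by omega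
        simp only [Code.searchStep, Code.den, Expr.eval, hu, hv, c1, c2', if_true, if_false]
      rw [this]
      exact ⟨h, Or.inl ⟨rfl, fun hh => hh.2.1 c2⟩⟩
    · have c2' : 0 < 1 - m.arr aLab v := by omega
      by_cases c3 : Δ ≤ r u v
      · have c3' : 0 < r u v - Δ + 1 := by omega
        have e1 : (Code.searchStep.den m).arr aLab =
            Function.update (m.arr aLab) v (m.arr aLab u + 1) := by
          simp only [Code.searchStep, Code.den, Expr.eval, ix, hu, hv, c1, c2', c3', hN, hΔ, hr',
            if_true, Mem.var_setArr]
          simp [Mem.arr_setArr]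
        have e2 : (Code.searchStep.den m).arr aPar = Function.update (m.arr aPar) v u := by
          simp only [Code.searchStep, Code.den, Expr.eval, ix, hu, hv, c1, c2', c3', hN, hΔ, hr',
            if_true, Mem.var_setArr]
          simp [Mem.arr_setArr]
        rw [e1, e2]
        exact ⟨h.label huN hvN c1 c2 c3,
          Or.inr ⟨⟨c1, c2, c3⟩, card_labelled_update hvN c2 (by omega)⟩⟩
      · have c3' : ¬ 0 < r u v - Δ + 1 := by omega
        have : Code.searchStep.den m = m := by
          simp only [Code.searchStep, Code.den, Expr.eval, ix, hu, hv, c1, c2', c3', hN, hΔ, hr',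
            if_true, if_false]
        rw [this]
        exact ⟨h, Or.inl ⟨rfl, fun hh => c3 hh.2.2⟩⟩
  · have : Code.searchStep.den m = m := by
      simp only [Code.searchStep, Code.den, Expr.eval, hu, c1, if_false]
    rw [this]
    exact ⟨h, Or.inl ⟨rfl, fun hh => c1 hh.1⟩⟩

/-- A round over all pairs that labels nothing proves that the labelled set is closed; any other
round labels a new vertex. Starting from the labelled root, N rounds without closure would label N +
1 of the N vertices. -/
lemma search_spec {m : Mem} {N n : ℕ} {Δ : ℤ} {r : ℕ → ℕ → ℤ}
    (hN : m.var vN = N) (hn : m.var vn = n) (hnN : n < N) (hΔ : m.var vDelta = Δ)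
    (hr : mat (m.arr aRes) N = r) :
    SearchTree N n Δ r ((Code.search.den m).arr aLab) ((Code.search.den m).arr aPar) ∧
      SearchClosed N Δ r ((Code.search.den m).arr aLab) := by
  set p₁ : Code := .loop vv vN (.store aLab (.var vv) (.lit 0)) with hp₁
  have h1 : ∀ w < N, (p₁.den m).arr aLab (w : ℤ) = 0 := by
    refine Code.loop_inv (fun k m => ∀ w < k, m.arr aLab (w : ℤ) = 0) hN
      (fun _ _ _ h => h) (by simp) ?_
    intro k m' hk hv _ hI w hw
    simp only [Code.den, Expr.eval, hv, Mem.arr_setArr, if_true, update_natCast]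
    split_ifs with hwk
    · rfl
    · exact hI w (by omega)
  set m₁ := p₁.den m with hm₁
  have s₁ : SameBut p₁.wv p₁.wa m m₁ := p₁.sameBut m
  set m₂ := (Code.store aLab (.var vn) (.lit 1)).den m₁ with hm₂
  have hn₁ : m₁.var vn = n := (s₁.1 vn (by decide)).trans hn
  have hN₂ : m₂.var vN = N := (s₁.1 vN (by decide)).trans hN
  have hΔ₂ : m₂.var vDelta = Δ := (s₁.1 vDelta (by decide)).trans hΔ
  have hr₂ : mat (m₂.arr aRes) N = r := by
    rw [← hr, ← s₁.2 aRes (by decide)]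
    rfl
  have lab₂ : ∀ w < N, m₂.arr aLab (w : ℤ) = if w = n then 1 else 0 := by
    intro w hw
    simp only [hm₂, Code.den, Expr.eval, hn₁, Mem.arr_setArr, if_true, update_natCast]
    split_ifs
    · rfl
    · exact h1 w hw
  have card₂ : 1 ≤ (labelled N (m₂.arr aLab)).card := by
    refine Finset.card_pos.2 ⟨n, mem_labelled.2 ⟨hnN, ?_⟩⟩
    rw [lab₂ n hnN, if_pos rfl]; omega
  have tree₂ : SearchTree N n Δ r (m₂.arr aLab) (m₂.arr aPar) := by
    refine ⟨by rw [lab₂ n hnN, if_pos rfl], fun w hw => ?_, fun w hw hwn hl => ?_, fun w hw => ?_⟩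
    · rw [lab₂ w hw]; split_ifs <;> omega
    · rw [lab₂ w hw, if_neg hwn] at hl; omega
    · rw [lab₂ w hw]; split_ifs <;> omega
  have hden : Code.search.den m =
      (Code.loop vRound vN (.loop vu vN (.loop vv vN Code.searchStep))).den m₂ := rfl
  rw [hden]
  have main := Code.loop_inv (i := vRound) (b := vN) (p := .loop vu vN (.loop vv vN Code.searchStep))
    (m := m₂) (fun k m => SearchTree N n Δ r (m.arr aLab) (m.arr aPar) ∧
      (SearchClosed N Δ r (m.arr aLab) ∨ k + 1 ≤ (labelled N (m.arr aLab)).card)) hN₂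
    (fun _ _ _ h => h) ⟨tree₂, Or.inr card₂⟩ ?_
  · refine ⟨main.1, main.2.resolve_right fun hc => ?_⟩
    have : (labelled N (((Code.loop vRound vN (.loop vu vN (.loop vv vN Code.searchStep))).den
        m₂).arr aLab)).card ≤ N := by
      refine (Finset.card_filter_le _ _).trans ?_
      simp
    omega
  intro k m₃ hk _ s₃ hI₃
  -- Within round `k` there are three cases: the set is already closed, this round has labelled
  -- something (count k + 2), or nothing new so far, and then the pairs scanned up to now offer no
  -- extension.
  have mid := Code.loop_inv (i := vu) (b := vN) (p := .loop vv vN Code.searchStep)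
    (m := m₃) (fun u m => SearchTree N n Δ r (m.arr aLab) (m.arr aPar) ∧
      (SearchClosed N Δ r (m.arr aLab) ∨ k + 2 ≤ (labelled N (m.arr aLab)).card ∨
        (k + 1 ≤ (labelled N (m.arr aLab)).card ∧
          ∀ a < u, ∀ b < N, 0 < m.arr aLab a → ¬ 0 < m.arr aLab b → r a b < Δ)))
    ((s₃.1 vN (by decide)).trans hN₂)
    (fun _ _ _ h => h) ⟨hI₃.1, hI₃.2.imp id fun h => Or.inr ⟨h, by simp⟩⟩ ?_
  · refine ⟨mid.1, ?_⟩
    rcases mid.2 with h | h | h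
    · exact Or.inl h
    · exact Or.inr h
    · exact Or.inl fun a ha b hb h1 h2 => h.2 a ha b hb h1 h2
  intro u m₄ hu hvu₄ s₄ hI₄
  have inner := Code.loop_inv (i := vv) (b := vN) (p := Code.searchStep)
    (m := m₄) (fun v m => SearchTree N n Δ r (m.arr aLab) (m.arr aPar) ∧
      (SearchClosed N Δ r (m.arr aLab) ∨ k + 2 ≤ (labelled N (m.arr aLab)).card ∨
        (k + 1 ≤ (labelled N (m.arr aLab)).card ∧
          ∀ a < N, ∀ b < N, (a < u ∨ (a = u ∧ b < v)) →
            0 < m.arr aLab a → ¬ 0 < m.arr aLab b → r a b < Δ)))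
    ((s₄.1 vN (by decide)).trans ((s₃.1 vN (by decide)).trans hN₂))
    (fun _ _ _ h => h) ⟨hI₄.1, ?_⟩ ?_
  · refine ⟨inner.1, ?_⟩
    rcases inner.2 with h | h | h
    · exact Or.inl h
    · exact Or.inr (Or.inl h)
    · refine Or.inr (Or.inr ⟨h.1, fun a ha b hb h1 h2 => h.2 a (by omega) b hb ?_ h1 h2⟩)
      omega
  · rcases hI₄.2 with h | h | h
    · exact Or.inl h
    · exact Or.inr (Or.inl h)
    · refine Or.inr (Or.inr ⟨h.1, fun a ha b hb hab h1 h2 => h.2 a (by omega) b hb h1 h2⟩)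
  intro v m₅ hv hvv₅ s₅ hI₅
  have hN₅ : m₅.var vN = N := (s₅.1 vN (by decide)).trans
    ((s₄.1 vN (by decide)).trans ((s₃.1 vN (by decide)).trans hN₂))
  have hΔ₅ : m₅.var vDelta = Δ := (s₅.1 vDelta (by decide)).trans
    ((s₄.1 vDelta (by decide)).trans ((s₃.1 vDelta (by decide)).trans hΔ₂))
  have hr₅ : mat (m₅.arr aRes) N = r := by
    rw [s₅.2 aRes (by decide), s₄.2 aRes (by decide), s₃.2 aRes (by decide)]
    exact hr₂
  have hu₅ : m₅.var vu = u := (s₅.1 vu (by decide)).trans hvu₄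
  obtain ⟨q1, q2⟩ := searchStep_spec hN₅ hΔ₅ hr₅ hu₅ hvv₅ hu hv hI₅.1
  refine ⟨q1, ?_⟩
  rcases q2 with ⟨q2, q3⟩ | ⟨q2, q3⟩
  · rw [q2]
    rcases hI₅.2 with h | h | h
    · exact Or.inl h
    · exact Or.inr (Or.inl h)
    · refine Or.inr (Or.inr ⟨h.1, fun a ha b hb hab h1 h2 => ?_⟩)
      by_cases hab' : a = u ∧ b = v
      · obtain ⟨rfl, rfl⟩ := hab'
        by_contra hcon
        exact q3 ⟨h1, h2, not_lt.1 hcon⟩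
      · exact h.2 a ha b hb (by omega) h1 h2
  · rw [q3]
    rcases hI₅.2 with h | h | h
    -- A closed set admits no further label, so this case cannot occur.
    · exact absurd (h u hu v hv q2.1 q2.2.1) (not_lt.2 q2.2.2)
    · exact Or.inr (Or.inl (by omega))
    · exact Or.inr (Or.inl (by omega))

/-! ### Minimum cuts by capacity scaling -/

namespace Code

/-- Push `vDelta` units over the arc from the parent of `vCur`, and go to this parent. -/
def augmentStep : Code :=
  .ite (.sub (.get aLab (.var vCur)) (.lit 1))
    (.seq (.assign vPar (.get aPar (.var vCur)))
      (.seq (.store aRes (ix (.var vPar) (.var vCur))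
          (.sub (.get aRes (ix (.var vPar) (.var vCur))) (.var vDelta)))
        (.seq (.store aRes (ix (.var vCur) (.var vPar))
            (.add (.get aRes (ix (.var vCur) (.var vPar))) (.var vDelta)))
          (.assign vCur (.var vPar)))))
    .skip

/-- If the sink is labelled, push `vDelta` units along the path that leads to it. -/
def augment : Code :=
  .ite (.get aLab (.add (.var vn) (.lit 1)))
    (.seq (.assign vFlow (.add (.var vFlow) (.var vDelta)))
      (.seq (.assign vCur (.add (.var vn) (.lit 1))) (.loop vStep vN augmentStep)))
    .skip

/-- Search for a path and push flow along it, `vTries` times; then halve `vDelta`. -/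
def scalingPhase : Code :=
  .seq (.loop vTry vTries (.seq search augment)) (.assign vDelta (.div (.var vDelta) (.lit 2)))

/-- Compute the minimum weight `vFlow` of a cut that separates the source `n` from the sink `n + 1`
in the network with the capacities `aRes`. -/
def minCut : Code :=
  .seq (.assign vFlow (.lit 0))
    (.seq (.assign vDelta (.var vTop)) (.loop vPhase vPhases scalingPhase))

end Code

lemma mat_addAt {f : ℤ → ℤ} {N u v : ℕ} (hv : v < N) {δ : ℤ} {a b : ℕ} (hb : b < N) :
    mat (Function.update f ((u : ℤ) * N + v) (mat f N u v + δ)) N a b =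
      addAt (mat f N) u v δ a b := by
  rw [mat_update hv hb, addAt]
  split_ifs with h
  · rw [h.1, h.2]
  · rfl

/-- The state of the walk from the sink back to the source. -/
structure WalkBack (N n : ℕ) (Δ : ℤ) (lab par : ℤ → ℤ) (r : ℕ → ℕ → ℤ) (k : ℕ) (cur : ℕ)
    (r' : ℕ → ℕ → ℤ) : Prop where
  lt : cur < N
  pos : 0 < lab cur
  depth : cur = n ∨ lab cur + k ≤ N
  nonneg : ∀ a < N, ∀ b < N, 0 ≤ r' a b
  free : ∀ a < N, ∀ p < N, a ≠ n → 0 < lab a → lab a ≤ lab cur → par a = p → Δ ≤ r' p a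
  cut : ∀ S : Finset ℕ, n + 1 ∉ S →
    cutw N r' S = cutw N r S - if cur ∈ S then Δ else 0

/-- Pushing Δ over (p, cur) lowers the cuts with p inside and cur outside and raises those with cur
inside and p outside. In the formula for cuts this just moves the indicator from `cur` to `p`. At
the root the step does nothing. -/
lemma augmentStep_spec {m : Mem} {N n cur k : ℕ} {Δ : ℤ} {r r₀ : ℕ → ℕ → ℤ}
    (hN : m.var vN = N) (hΔ : m.var vDelta = Δ) (hΔ₀ : 0 ≤ Δ)
    (htree : SearchTree N n Δ r₀ (m.arr aLab) (m.arr aPar))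
    (hcur : m.var vCur = cur)
    (hw : WalkBack N n Δ (m.arr aLab) (m.arr aPar) r k cur (mat (m.arr aRes) N)) :
    ∃ cur', (Code.augmentStep.den m).var vCur = (cur' : ℕ) ∧
      WalkBack N n Δ (m.arr aLab) (m.arr aPar) r (k + 1) cur'
        (mat ((Code.augmentStep.den m).arr aRes) N) := by
  by_cases hc : cur = n
  · have hl : ¬ 0 < m.arr aLab cur - 1 := by rw [hc, htree.root]; omega
    have : Code.augmentStep.den m = m := by
      simp only [Code.augmentStep, Code.den, Expr.eval, hcur, hl, if_false]
    rw [this]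
    exact ⟨cur, hcur, ⟨hw.lt, hw.pos, Or.inl hc, hw.nonneg, hw.free, hw.cut⟩⟩
  · obtain ⟨p, hpN, hpar, hlp, hlc, -⟩ := htree.parent cur hw.lt hc hw.pos
    have hl : 0 < m.arr aLab cur - 1 := by omega
    have hpc : p ≠ cur := by rintro rfl; omega
    set r' := mat (m.arr aRes) N with hr'
    have e1 : (Code.augmentStep.den m).var vCur = p := by
      simp only [Code.augmentStep, Code.den, Expr.eval, hcur, hl, if_true, ix]
      simp [Mem.var_setVar, Mem.var_setArr, hpar]
    have e2 : ∀ a < N, ∀ b < N, mat ((Code.augmentStep.den m).arr aRes) N a b =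
        addAt (addAt r' p cur (-Δ)) cur p Δ a b := by
      intro a _ b hb
      have : (Code.augmentStep.den m).arr aRes =
          Function.update (Function.update (m.arr aRes) ((p : ℤ) * N + cur)
            (mat (m.arr aRes) N p cur + -Δ)) ((cur : ℤ) * N + p)
            (mat (Function.update (m.arr aRes) ((p : ℤ) * N + cur)
              (mat (m.arr aRes) N p cur + -Δ)) N cur p + Δ) := by
        simp only [Code.augmentStep, Code.den, Expr.eval, hcur, hl, if_true, ix]
        simp [Mem.var_setVar, Mem.var_setArr, Mem.arr_setVar, Mem.arr_setArr, hpar, hcur, hN, hΔ,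
          mat, sub_eq_add_neg]
      rw [this, mat_addAt hpN hb]
      unfold addAt
      rw [mat_addAt hw.lt hb]
      rfl
    have hfree := hw.free cur hw.lt p hpN hc hw.pos le_rfl hpar
    refine ⟨p, e1, hpN, hlp, Or.inr ?_, fun a ha b hb => ?_, ?_, fun S hS => ?_⟩
    · have := hw.depth.resolve_left hc
      push_cast; omega
    · rw [e2 a ha b hb]
      have := hw.nonneg a ha b hb
      unfold addAt
      by_cases c1 : a = p ∧ b = cur
      · obtain ⟨rfl, rfl⟩ := c1
        rw [if_neg (fun h => hpc h.1), if_pos ⟨rfl, rfl⟩]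
        omega
      · simp only [if_neg c1]
        split_ifs <;> omega
    · intro a ha q hq han hla hle hpa
      rw [e2 q hq a ha]
      have := hw.free a ha q hq han hla (by omega) hpa
      -- The remaining tree arcs end at vertices of smaller depth than `cur`, so none of them is the
      -- arc whose capacity has just been reduced.
      have hac : a ≠ cur := by rintro rfl; omega
      unfold addAt
      simp only [hac, and_false, if_false]
      split_ifs <;> omega
    · rw [cutw_congr e2, cutw_addAt hw.lt hpN, cutw_addAt hpN hw.lt, hw.cut S hS]
      by_cases c1 : p ∈ S <;> by_cases c2 : cur ∈ S <;> simp [c1, c2, sub_eq_add_neg]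

/-- The depth drops with every step until the root is reached. It is at most N at the sink, so N
steps suffice. The indicator of the walk's position starts at the sink, outside `S`, and ends at the
source, inside `S`: each cut loses exactly Δ. -/
lemma augment_spec {m : Mem} {N n : ℕ} {Δ : ℤ} (hN : m.var vN = N) (hn : m.var vn = n)
    (hnN : n + 1 < N) (hΔ : m.var vDelta = Δ) (hΔ₀ : 0 ≤ Δ)
    (htree : SearchTree N n Δ (mat (m.arr aRes) N) (m.arr aLab) (m.arr aPar))
    (hr : ∀ a < N, ∀ b < N, 0 ≤ mat (m.arr aRes) N a b) (hsink : 0 < m.arr aLab ((n + 1 : ℕ) : ℤ)) :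
    (Code.augment.den m).var vFlow = m.var vFlow + Δ ∧
    (∀ a < N, ∀ b < N, 0 ≤ mat ((Code.augment.den m).arr aRes) N a b) ∧
    ∀ S : Finset ℕ, n ∈ S → n + 1 ∉ S →
      cutw N (mat ((Code.augment.den m).arr aRes) N) S = cutw N (mat (m.arr aRes) N) S - Δ := by
  set m₁ := (m.setVar vFlow (m.var vFlow + Δ)).setVar vCur ((n + 1 : ℕ) : ℤ) with hm₁
  have hsink' : 0 < m.arr aLab ((n : ℤ) + 1) := by exact_mod_cast hsink
  have hden : Code.augment.den m = (Code.loop vStep vN Code.augmentStep).den m₁ := by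
    simp only [Code.augment, Code.den, Expr.eval, hn, hsink', if_true, hΔ]
    simp [hm₁, Mem.var_setVar, hn]
  have hlab : m₁.arr = m.arr := rfl
  rw [hden]
  have main := Code.loop_inv (i := vStep) (b := vN) (p := Code.augmentStep) (m := m₁)
    (fun k m' => ∃ cur : ℕ, m'.var vCur = cur ∧
      WalkBack N n Δ (m.arr aLab) (m.arr aPar) (mat (m.arr aRes) N) k cur
        (mat (m'.arr aRes) N)) (K := N) ?_ ?_ ?_ ?_
  · obtain ⟨cur, -, hw⟩ := main
    have hcn : cur = n := hw.depth.resolve_right fun h => by have := hw.pos; omega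
    refine ⟨?_, hw.nonneg, fun S h1 h2 => ?_⟩
    · rw [Code.var_den _ _ (by decide)]
      simp [hm₁, Mem.var_setVar]
    · rw [hw.cut S h2, hcn, if_pos h1]
  · simp [hm₁, Mem.var_setVar, hN]
  · rintro k m' x ⟨cur, h1, h2⟩
    exact ⟨cur, by simpa [Mem.var_setVar] using h1, h2⟩
  · refine ⟨n + 1, by simp [hm₁, Mem.var_setVar], hnN, hsink, Or.inr ?_, hr, ?_, fun S hS => ?_⟩
    · have h1 := htree.le_card (n + 1) hnN
      have h2 : (labelled N (m.arr aLab)).card ≤ N :=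
        (Finset.card_filter_le _ _).trans (by simp)
      push_cast at *; omega
    · intro a ha p hp han hla _ hpa
      obtain ⟨q, _, hq, _, _, hΔq⟩ := htree.parent a ha han hla
      rw [hpa] at hq
      obtain rfl : p = q := by exact_mod_cast hq
      exact hΔq
    · rw [if_neg hS, sub_zero, hlab]
  · rintro k m' hk - hs ⟨cur, h1, h2⟩
    have hl : m'.arr aLab = m.arr aLab := hs.2 aLab (by decide)
    have hp : m'.arr aPar = m.arr aPar := hs.2 aPar (by decide)
    have hN' : m'.var vN = N := (hs.1 vN (by decide)).trans (by simp [hm₁, Mem.var_setVar, hN])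
    have hΔ' : m'.var vDelta = Δ :=
      (hs.1 vDelta (by decide)).trans (by simp [hm₁, Mem.var_setVar, hΔ])
    rw [← hl, ← hp] at h2 htree ⊢
    exact augmentStep_spec hN' hΔ' hΔ₀ htree h1 h2

/-- `r` is a residual network of `c` for a flow of the value `F`. -/
structure Residual (N n : ℕ) (c r : ℕ → ℕ → ℤ) (F : ℤ) : Prop where
  nonneg : ∀ a < N, ∀ b < N, 0 ≤ r a b
  cut : ∀ S : Finset ℕ, n ∈ S → n + 1 ∉ S → cutw N r S + F = cutw N c S

/-- Some cut has residual capacity at most `B`. -/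
def CutAtMost (N n : ℕ) (r : ℕ → ℕ → ℤ) (B : ℤ) : Prop :=
  ∃ S : Finset ℕ, n ∈ S ∧ n + 1 ∉ S ∧ cutw N r S ≤ B

/-- If the sink is labelled, every cut loses Δ. If not, the labelled set is itself a cut, left only
by arcs of capacity at most Δ - 1, at most N² of them. In neither case does a cut grow. -/
lemma try_spec {m : Mem} {N n : ℕ} {Δ : ℤ} {c : ℕ → ℕ → ℤ} (hN : m.var vN = N)
    (hn : m.var vn = n) (hnN : n + 1 < N) (hΔ : m.var vDelta = Δ) (hΔ₀ : 1 ≤ Δ)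
    (hres : Residual N n c (mat (m.arr aRes) N) (m.var vFlow)) :
    ∀ m', m' = (Code.seq Code.search Code.augment).den m →
    Residual N n c (mat (m'.arr aRes) N) (m'.var vFlow) ∧
      (CutAtMost N n (mat (m'.arr aRes) N) (N * N * (Δ - 1)) ∨
        ∀ B, CutAtMost N n (mat (m.arr aRes) N) B →
          CutAtMost N n (mat (m'.arr aRes) N) (B - Δ)) ∧
      (∀ B, CutAtMost N n (mat (m.arr aRes) N) B → CutAtMost N n (mat (m'.arr aRes) N) B) := by
  rintro m' rfl
  obtain ⟨htree, hclosed⟩ := search_spec hN hn (by omega) hΔ rfl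
  rw [Code.den]
  have s₁ := Code.search.sameBut m
  set m₁ := Code.search.den m
  have hres₁ : m₁.arr aRes = m.arr aRes := s₁.2 aRes (by decide)
  have hN₁ : m₁.var vN = N := (s₁.1 vN (by decide)).trans hN
  have hn₁ : m₁.var vn = n := (s₁.1 vn (by decide)).trans hn
  have hΔ₁ : m₁.var vDelta = Δ := (s₁.1 vDelta (by decide)).trans hΔ
  have hF₁ : m₁.var vFlow = m.var vFlow := s₁.1 vFlow (by decide)
  rw [← hres₁] at hres htree hclosed ⊢
  rw [← hF₁] at hres
  by_cases hsink : 0 < m₁.arr aLab ((n + 1 : ℕ) : ℤ)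
  · obtain ⟨a1, a2, a3⟩ := augment_spec hN₁ hn₁ hnN hΔ₁ (by omega) htree hres.nonneg hsink
    refine ⟨⟨a2, fun S h1 h2 => ?_⟩, Or.inr ?_, ?_⟩
    · rw [a1, a3 S h1 h2, ← hres.cut S h1 h2]; ring
    · rintro B ⟨S, h1, h2, h3⟩
      exact ⟨S, h1, h2, by rw [a3 S h1 h2]; omega⟩
    · rintro B ⟨S, h1, h2, h3⟩
      exact ⟨S, h1, h2, by rw [a3 S h1 h2]; omega⟩
  · have : Code.augment.den m₁ = m₁ := by
      have h' : ¬ 0 < m₁.arr aLab ((n : ℤ) + 1) := by exact_mod_cast hsink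
      simp only [Code.augment, Code.den, Expr.eval, hn₁, h', if_false]
    rw [this]
    refine ⟨hres, Or.inl ⟨labelled N (m₁.arr aLab), ?_, ?_, ?_⟩, fun B h => h⟩
    · rw [mem_labelled, htree.root]; omega
    · rw [mem_labelled]; exact fun h => hsink h.2
    · refine cutw_le (by omega) fun u hu v hv h1 h2 => ?_
      rw [mem_labelled] at h1 h2
      have := hclosed u hu v hv h1.2 (fun h => h2 ⟨hv, h⟩)
      omega

/-- Each try that does not exhibit a cut of weight at most N²(Δ - 1) takes Δ from a cut that began
at 2N²Δ or less; 2N² + 1 such tries would make it negative. -/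
lemma scalingPhase_spec {m : Mem} {N n J : ℕ} {Δ : ℤ} {c : ℕ → ℕ → ℤ} (hN : m.var vN = N)
    (hn : m.var vn = n) (hnN : n + 1 < N) (hJ : m.var vTries = J) (hJ' : 2 * N * N + 1 ≤ J)
    (hΔ : m.var vDelta = Δ) (hΔ₀ : 1 ≤ Δ)
    (hres : Residual N n c (mat (m.arr aRes) N) (m.var vFlow))
    (hcut : CutAtMost N n (mat (m.arr aRes) N) (N * N * (2 * Δ))) :
    ∀ m', m' = Code.scalingPhase.den m →
    Residual N n c (mat (m'.arr aRes) N) (m'.var vFlow) ∧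
      CutAtMost N n (mat (m'.arr aRes) N) (N * N * (Δ - 1)) ∧ m'.var vDelta = Δ / 2 := by
  rintro m' rfl
  rw [Code.scalingPhase, Code.den]
  set p : Code := .loop vTry vTries (.seq Code.search Code.augment) with hp
  have s₁ : SameBut p.wv p.wa m (p.den m) := p.sameBut m
  have main := Code.loop_inv (i := vTry) (b := vTries) (p := .seq Code.search Code.augment) (m := m)
    (fun k m' => Residual N n c (mat (m'.arr aRes) N) (m'.var vFlow) ∧
      (CutAtMost N n (mat (m'.arr aRes) N) (N * N * (Δ - 1)) ∨
        CutAtMost N n (mat (m'.arr aRes) N) (N * N * (2 * Δ) - k * Δ))) hJ ?_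
    ⟨hres, Or.inr (by simpa using hcut)⟩ ?_
  · set m₁ := p.den m with hm₁
    have e1 : ((Code.assign vDelta (.div (.var vDelta) (.lit 2))).den m₁).arr = m₁.arr := rfl
    have e2 : ((Code.assign vDelta (.div (.var vDelta) (.lit 2))).den m₁).var vFlow =
        m₁.var vFlow := by simp [Code.den, Mem.var_setVar]
    rw [e1, e2]
    refine ⟨main.1, main.2.resolve_right ?_, ?_⟩
    · rintro ⟨S, -, -, h3⟩
      have h4 := cutw_nonneg main.1.nonneg S
      have h5 : (2 * N * N + 1 : ℤ) ≤ J := by exact_mod_cast hJ'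
      nlinarith
    · simp only [Code.den, Expr.eval, Mem.var_setVar, if_true]
      rw [s₁.1 vDelta (by decide), hΔ]
  · rintro k m' x ⟨h1, h2⟩
    have : (m'.setVar vTry x).var vFlow = m'.var vFlow := by simp [Mem.var_setVar]
    rw [this]
    exact ⟨h1, h2⟩
  · rintro k m' hk - hs ⟨h1, h2⟩
    obtain ⟨t1, t2, t3⟩ := try_spec ((hs.1 vN (by decide)).trans hN)
      ((hs.1 vn (by decide)).trans hn) hnN ((hs.1 vDelta (by decide)).trans hΔ) hΔ₀ h1 _ rfl
    refine ⟨t1, ?_⟩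
    rcases h2 with h2 | h2
    · exact Or.inl (t3 _ h2)
    · rcases t2 with t2 | t2
      · exact Or.inl t2
      · right
        have := t2 _ h2
        have e : (N * N * (2 * Δ) - k * Δ - Δ : ℤ) = N * N * (2 * Δ) - (k + 1 : ℕ) * Δ := by
          push_cast; ring
        rwa [e] at this

/-- The constants of the network programs. -/
structure NetEnv (m : Mem) (n L J : ℕ) : Prop where
  n_eq : m.var vn = n
  N_eq : m.var vN = (n + 2 : ℕ)
  phases : m.var vPhases = (L + 1 : ℕ)
  tries : m.var vTries = J
  top : m.var vTop = 2 ^ L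
  le_tries : 2 * (n + 2) * (n + 2) + 1 ≤ J

/-- Phase k works with Δ = 2^(L-k), and halving Δ turns N²(Δ - 1) into a valid starting bound for
the next phase. After the phase Δ = 1 some residual cut has weight 0, so its original weight equals
the flow, while nonnegativity of the residual network makes the flow a lower bound for all cuts. -/
lemma minCut_spec {m : Mem} {n L J : ℕ} (he : NetEnv m n L J) {c : ℕ → ℕ → ℤ}
    (hc : ∀ u < n + 2, ∀ v < n + 2, mat (m.arr aRes) (n + 2) u v = c u v)
    (hc₀ : ∀ u < n + 2, ∀ v < n + 2, 0 ≤ c u v)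
    (hcut : CutAtMost (n + 2) n c ((n + 2 : ℕ) * (n + 2 : ℕ) * (2 * 2 ^ L))) :
    (∀ S : Finset ℕ, n ∈ S → n + 1 ∉ S →
      (Code.minCut.den m).var vFlow ≤ cutw (n + 2) c S) ∧
    ∃ S : Finset ℕ, n ∈ S ∧ n + 1 ∉ S ∧
      (Code.minCut.den m).var vFlow = cutw (n + 2) c S := by
  set m₁ := (m.setVar vFlow 0).setVar vDelta (2 ^ L) with hm₁
  have hden : Code.minCut.den m = (Code.loop vPhase vPhases Code.scalingPhase).den m₁ := by
    simp [Code.minCut, Code.den, Expr.eval, Mem.var_setVar, hm₁, he.top]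
  have v₁ : ∀ j, j ≠ vFlow → j ≠ vDelta → m₁.var j = m.var j := by
    intro j h1 h2
    simp [hm₁, Mem.var_setVar, h1, h2]
  rw [hden]
  have main := Code.loop_inv (i := vPhase) (b := vPhases) (p := Code.scalingPhase) (m := m₁)
    (fun k m' => Residual (n + 2) n c (mat (m'.arr aRes) (n + 2)) (m'.var vFlow) ∧
      CutAtMost (n + 2) n (mat (m'.arr aRes) (n + 2))
        -- The value 0 stands for the situation after the last phase, where L - k would be
        -- truncated.
        ((n + 2 : ℕ) * (n + 2 : ℕ) * (if k ≤ L then 2 * 2 ^ (L - k) else 0)) ∧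
      (k ≤ L → m'.var vDelta = 2 ^ (L - k))) (K := L + 1) ?_ ?_ ?_ ?_
  · obtain ⟨h1, ⟨S, s1, s2, s3⟩, -⟩ := main
    rw [if_neg (by omega), mul_zero] at s3
    refine ⟨fun S' h2 h3 => ?_, S, s1, s2, ?_⟩
    · rw [← h1.cut S' h2 h3]
      have := cutw_nonneg h1.nonneg S'
      omega
    · rw [← h1.cut S s1 s2]
      have := cutw_nonneg h1.nonneg S
      omega
  · exact (v₁ vPhases (by decide) (by decide)).trans he.phases
  · rintro k m' x ⟨h1, h2, h3⟩
    have e1 : (m'.setVar vPhase x).var vFlow = m'.var vFlow := by simp [Mem.var_setVar]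
    have e2 : (m'.setVar vPhase x).var vDelta = m'.var vDelta := by simp [Mem.var_setVar]
    rw [e1, e2]
    exact ⟨h1, h2, h3⟩
  · have e0 : m₁.var vFlow = 0 := by simp [hm₁, Mem.var_setVar]
    have e1 : ∀ S, cutw (n + 2) (mat (m₁.arr aRes) (n + 2)) S = cutw (n + 2) c S :=
      fun S => cutw_congr (fun u hu v hv => hc u hu v hv) S
    refine ⟨⟨fun a ha b hb => ?_, fun S _ _ => ?_⟩, ?_, fun _ => by simp [hm₁, Mem.var_setVar]⟩
    · have := hc₀ a ha b hb
      rw [← hc a ha b hb] at this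
      exact this
    · rw [e0, e1, add_zero]
    · obtain ⟨S, s1, s2, s3⟩ := hcut
      refine ⟨S, s1, s2, ?_⟩
      rw [e1]
      simpa using s3
  · rintro k m' hk - hs ⟨h1, h2, h3⟩
    have hkL : k ≤ L := by omega
    rw [if_pos hkL] at h2
    obtain ⟨t1, t2, t3⟩ := scalingPhase_spec (Δ := 2 ^ (L - k)) (J := J)
      ((hs.1 vN (by decide)).trans ((v₁ vN (by decide) (by decide)).trans he.N_eq))
      ((hs.1 vn (by decide)).trans ((v₁ vn (by decide) (by decide)).trans he.n_eq)) (by omega)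
      ((hs.1 vTries (by decide)).trans ((v₁ vTries (by decide) (by decide)).trans he.tries))
      he.le_tries (h3 hkL) (one_le_pow₀ (by norm_num)) h1 h2 _ rfl
    refine ⟨t1, ?_, fun hk' => ?_⟩
    · obtain ⟨S, s1, s2, s3⟩ := t2
      refine ⟨S, s1, s2, s3.trans ?_⟩
      refine mul_le_mul_of_nonneg_left ?_ (by positivity)
      split_ifs with hk'
      · have : L - k = L - (k + 1) + 1 := by omega
        rw [this, pow_succ]
        omega
      · have : L - k = 0 := by omega
        rw [this]; norm_num
    · rw [t3]
      have : L - k = L - (k + 1) + 1 := by omega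
      rw [this, pow_succ]
      omega

/-! ### Networks -/

namespace Code

/-- Copy a matrix to the network. -/
def copyRes (a : ℕ) : Code :=
  .loop va vN (.loop vb vN (.store aRes (ix (.var va) (.var vb)) (.get a (ix (.var va) (.var vb)))))

/-- Add `e` to the capacity of the arc `(u, v)` of the network. -/
def addRes (u v e : Expr) : Code := .store aRes (ix u v) (.add (.get aRes (ix u v)) e)

end Code

lemma copyRes_spec {m : Mem} {N a : ℕ} (hN : m.var vN = N) (ha : a ≠ aRes) :
    ∀ u < N, ∀ v < N, mat (((Code.copyRes a).den m).arr aRes) N u v = mat (m.arr a) N u v := by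
  refine Code.loop_inv (fun k m' => ∀ u < k, ∀ v < N, mat (m'.arr aRes) N u v = mat (m.arr a) N u v)
    hN (fun _ _ _ h => h) (by simp) ?_
  intro k m₁ hk hva s₁ hI
  have hN₁ : m₁.var vN = N := (s₁.1 vN (by simp [Code.wv])).trans hN
  have inner := Code.loop_inv (i := vb) (b := vN)
    (p := .store aRes (ix (.var va) (.var vb)) (.get a (ix (.var va) (.var vb)))) (m := m₁)
    (fun j m' => ∀ u < N, ∀ v < N, (u < k ∨ (u = k ∧ v < j)) →
      mat (m'.arr aRes) N u v = mat (m.arr a) N u v) hN₁ (fun _ _ _ h => h)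
    (fun u hu v hv huv => hI u (by omega) v hv) ?_
  · intro u hu v hv
    exact inner u (by omega) v hv (by omega)
  intro j m₂ hj hvb s₂ hI₂ u hu v hv huv
  have hva₂ : m₂.var va = k := (s₂.1 va (by simp [Code.wv])).trans hva
  have hN₂ : m₂.var vN = N := (s₂.1 vN (by simp [Code.wv])).trans hN₁
  have ha₂ : m₂.arr a = m.arr a :=
    (s₂.2 a (by simpa [Code.wa] using ha)).trans (s₁.2 a (by simpa [Code.wa] using ha))
  simp only [Code.den, Expr.eval, ix, hva₂, hvb, hN₂, Mem.arr_setArr, if_true, ha₂]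
  rw [mat_update hj hv]
  split_ifs with h
  · rw [h.1, h.2]; rfl
  · exact hI₂ u hu v hv (by omega)

lemma addRes_spec {m : Mem} {N u v : ℕ} {δ : ℤ} {e₁ e₂ e₃ : Expr} (hN : m.var vN = N)
    (h₁ : e₁.eval m = u) (h₂ : e₂.eval m = v) (h₃ : e₃.eval m = δ) (hv : v < N) :
    ∀ a < N, ∀ b < N, mat (((Code.addRes e₁ e₂ e₃).den m).arr aRes) N a b =
      addAt (mat (m.arr aRes) N) u v δ a b := by
  intro a _ b hb
  simp only [Code.addRes, Code.den, Expr.eval, ix, h₁, h₂, h₃, hN, Mem.arr_setArr, if_true]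
  exact mat_addAt hv hb

/-- The array `f` is a nonnegative network on `N` vertices whose cuts that separate `n` from `n + 1`
have the weights `w`. -/
structure NetCuts (n : ℕ) (f : ℤ → ℤ) (w : Finset ℕ → ℤ) : Prop where
  nonneg : ∀ a < n + 2, ∀ b < n + 2, 0 ≤ mat f (n + 2) a b
  cut : ∀ S : Finset ℕ, n ∈ S → n + 1 ∉ S → cutw (n + 2) (mat f (n + 2)) S = w S

lemma NetCuts.addRes {m : Mem} {n u v : ℕ} {δ : ℤ} {w : Finset ℕ → ℤ} {e₁ e₂ e₃ : Expr}
    (h : NetCuts n (m.arr aRes) w) (hN : m.var vN = (n + 2 : ℕ)) (h₁ : e₁.eval m = u)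
    (h₂ : e₂.eval m = v) (h₃ : e₃.eval m = δ) (hu : u < n + 2) (hv : v < n + 2) (hδ : 0 ≤ δ) :
    NetCuts n (((Code.addRes e₁ e₂ e₃).den m).arr aRes)
      (fun S => w S + if u ∈ S ∧ v ∉ S then δ else 0) := by
  have e := addRes_spec hN h₁ h₂ h₃ hv
  refine ⟨fun a ha b hb => ?_, fun S h1 h2 => ?_⟩
  · rw [e a ha b hb, addAt]
    have := h.nonneg a ha b hb
    split_ifs <;> omega
  · rw [cutw_congr e, cutw_addAt hu hv, h.cut S h1 h2]

lemma NetCuts.copyRes {m : Mem} {n a : ℕ} (hN : m.var vN = (n + 2 : ℕ)) (ha : a ≠ aRes)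
    (h0 : ∀ u < n + 2, ∀ v < n + 2, 0 ≤ mat (m.arr a) (n + 2) u v) :
    NetCuts n (((Code.copyRes a).den m).arr aRes) (cutw (n + 2) (mat (m.arr a) (n + 2))) := by
  have e := copyRes_spec hN ha
  refine ⟨fun u hu v hv => ?_, fun S _ _ => cutw_congr e S⟩
  rw [e u hu v hv]; exact h0 u hu v hv

lemma NetCuts.congr {n : ℕ} {f : ℤ → ℤ} {w w' : Finset ℕ → ℤ} (h : NetCuts n f w)
    (hw : ∀ S, n ∈ S → n + 1 ∉ S → w S = w' S) : NetCuts n f w' :=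
  ⟨h.nonneg, fun S h1 h2 => (h.cut S h1 h2).trans (hw S h1 h2)⟩

/-- Scaling needs just one cut of limited weight to start from, and {n} is the one whose weight is
easy to bound. -/
lemma NetCuts.minCut {m : Mem} {n L J : ℕ} (he : NetEnv m n L J) {w : Finset ℕ → ℤ}
    (h : NetCuts n (m.arr aRes) w)
    (hw : w {n} ≤ (n + 2 : ℕ) * (n + 2 : ℕ) * (2 * 2 ^ L)) :
    (∀ S : Finset ℕ, n ∈ S → n + 1 ∉ S → (Code.minCut.den m).var vFlow ≤ w S) ∧
    ∃ S : Finset ℕ, n ∈ S ∧ n + 1 ∉ S ∧ (Code.minCut.den m).var vFlow = w S := by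
  obtain ⟨h1, S, s1, s2, s3⟩ := minCut_spec he (c := mat (m.arr aRes) (n + 2))
    (fun _ _ _ _ => rfl) h.nonneg
    ⟨{n}, by simp, by simp, by rw [h.cut {n} (by simp) (by simp)]; exact hw⟩
  refine ⟨fun S' h2 h3 => ?_, S, s1, s2, ?_⟩
  · rw [← h.cut S' h2 h3]; exact h1 S' h2 h3
  · rw [s3, h.cut S s1 s2]

/-- The matrix vanishes outside the first `n` rows and columns. -/
def Padded (n : ℕ) (r : ℕ → ℕ → ℤ) : Prop :=
  ∀ u < n + 2, ∀ v < n + 2, (n ≤ u ∨ n ≤ v) → r u v = 0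

lemma cutw_of_padded {n : ℕ} {r : ℕ → ℕ → ℤ} (h : Padded n r) (S : Finset ℕ) :
    cutw (n + 2) r S = cutw n r S := by
  unfold cutw
  have h1 : ∀ u < n + 2, n ≤ u → ∑ v ∈ Finset.range (n + 2),
      (if u ∈ S ∧ v ∉ S then r u v else 0) = 0 := by
    intro u hu hnu
    refine Finset.sum_eq_zero fun v hv => ?_
    rw [h u hu v (Finset.mem_range.1 hv) (Or.inl hnu), ite_self]
  rw [Finset.sum_range_succ, Finset.sum_range_succ, h1 n (by omega) le_rfl,
    h1 (n + 1) (by omega) (by omega), add_zero, add_zero]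
  refine Finset.sum_congr rfl fun u hu => ?_
  rw [Finset.sum_range_succ, Finset.sum_range_succ,
    h u (by simp at hu; omega) n (by omega) (Or.inr le_rfl),
    h u (by simp at hu; omega) (n + 1) (by omega) (Or.inr (by omega)), ite_self, ite_self, add_zero,
    add_zero]

lemma cutw_congr_set {n : ℕ} (r : ℕ → ℕ → ℤ) {S S' : Finset ℕ}
    (h : ∀ u < n, u ∈ S ↔ u ∈ S') : cutw n r S = cutw n r S' := by
  refine Finset.sum_congr rfl fun u hu => Finset.sum_congr rfl fun v hv => ?_
  rw [Finset.mem_range] at hu hv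
  simp only [h u hu, h v hv]

/-! ### Ranking the vertices by the narrow cuts -/

namespace Code

/-- Decide whether some narrow cut contains `vy` but not `vz`, and count this pair. -/
def rankPair : Code :=
  .seq (copyRes aCap)
    (.seq (addRes (.var vn) (.var vs) (.var vBig))
      (.seq (addRes (.var vn) (.var vy) (.var vBig))
        (.seq (addRes (.var vt) (.add (.var vn) (.lit 1)) (.var vBig))
          (.seq (addRes (.var vz) (.add (.var vn) (.lit 1)) (.var vBig))
            (.seq minCut
              (.ite (.sub (.var vBig) (.var vFlow))
                (.seq (.store aRank (.var vz) (.add (.get aRank (.var vz)) (.lit 1)))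
                  (.store aUp (.var vy) (.add (.get aUp (.var vy)) (.lit 1))))
                .skip))))))

/-- Count, for every vertex, the vertices that narrow cuts separate from it. -/
def rankAll : Code := .loop vy vn (.loop vz vn rankPair)

end Code

/-- Some set that contains `s` and `y`, but not `t` and `z`, has a cut of weight less than `B`. -/
def SepBelow (n : ℕ) (C : ℕ → ℕ → ℤ) (s t : ℕ) (B : ℤ) (y z : ℕ) : Prop :=
  ∃ S : Finset ℕ, s ∈ S ∧ t ∉ S ∧ y ∈ S ∧ z ∉ S ∧ cutw n C S < B

/-- The constants of the instance: the terminals, the threshold for narrow cuts, the scale, and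
the capacities. -/
structure InstEnv (m : Mem) (n L J s t : ℕ) (B M : ℤ) (C : ℕ → ℕ → ℤ) : Prop
    extends NetEnv m n L J where
  s_eq : m.var vs = s
  t_eq : m.var vt = t
  big : m.var vBig = B
  scale : m.var vScale = M
  cap : ∀ u < n + 2, ∀ v < n + 2, mat (m.arr aCap) (n + 2) u v = C u v

lemma InstEnv.of_sameBut {m m' : Mem} {n L J s t : ℕ} {B M : ℤ} {C : ℕ → ℕ → ℤ}
    (h : InstEnv m n L J s t B M C) {vs' as' : List ℕ} (hs : SameBut vs' as' m m')
    (hv : ∀ i ∈ [vn, vN, vPhases, vTries, vTop, vs, vt, vBig, vScale], i ∉ vs')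
    (ha : aCap ∉ as') : InstEnv m' n L J s t B M C where
  n_eq := (hs.1 _ (hv vn (by simp))).trans h.n_eq
  N_eq := (hs.1 _ (hv vN (by simp))).trans h.N_eq
  phases := (hs.1 _ (hv vPhases (by simp))).trans h.phases
  tries := (hs.1 _ (hv vTries (by simp))).trans h.tries
  top := (hs.1 _ (hv vTop (by simp))).trans h.top
  le_tries := h.le_tries
  s_eq := (hs.1 _ (hv vs (by simp))).trans h.s_eq
  t_eq := (hs.1 _ (hv vt (by simp))).trans h.t_eq
  big := (hs.1 _ (hv vBig (by simp))).trans h.big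
  scale := (hs.1 _ (hv vScale (by simp))).trans h.scale
  cap := by rw [hs.2 _ ha]; exact h.cap

lemma SameBut.refl (l l' : List ℕ) (m : Mem) : SameBut l l' m m := ⟨fun _ _ => rfl, fun _ _ => rfl⟩

lemma SameBut.step {l l' : List ℕ} {m m' : Mem} (h : SameBut l l' m m') (p : Code)
    (hv : ∀ i ∈ p.wv, i ∈ l) (ha : ∀ i ∈ p.wa, i ∈ l') : SameBut l l' m (p.den m') :=
  ⟨fun j hj => (p.var_den m' fun h' => hj (hv j h')).trans (h.1 j hj),
    fun j hj => (p.arr_den m' fun h' => hj (ha j h')).trans (h.2 j hj)⟩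

/-- The invariant rule for two nested loops over the same range. -/
lemma Code.pairs_inv {i j b : ℕ} {p : Code} {m : Mem} (I : ℕ → ℕ → Mem → Prop) {n : ℕ}
    (hn : m.var b = n) (hij : i ≠ j) (hi : i ∉ p.wv) (hb : b ∉ i :: j :: p.wv)
    (hI : ∀ k l m x, I k l m → I k l (m.setVar i x) ∧ I k l (m.setVar j x)) (h0 : I 0 0 m)
    (hrow : ∀ k m, k < n → I k n m → I (k + 1) 0 m)
    (hs : ∀ (k l : ℕ) (m' : Mem), k < n → l < n → m'.var i = (k : ℤ) → m'.var j = (l : ℤ) →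
      SameBut (i :: j :: p.wv) p.wa m m' → I k l m' → I k (l + 1) (p.den m')) :
    I n 0 ((Code.loop i b (.loop j b p)).den m) := by
  refine Code.loop_inv (fun k m => I k 0 m) hn (fun k m x h => (hI k 0 m x h).1) h0 ?_
  intro k m₁ hk hi₁ s₁ h₁
  refine hrow k _ hk ?_
  have hw : (Code.loop j b p).wv = j :: p.wv := rfl
  refine Code.loop_inv (fun l m => I k l m) ((s₁.1 b (by rw [hw]; exact hb)).trans hn)
    (fun l m x h => (hI k l m x h).2) h₁ ?_
  intro l m₂ hl hj₂ s₂ h₂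
  refine hs k l m₂ hk hl ((s₂.1 i ?_).trans hi₁) hj₂ ⟨fun v hv => ?_, fun a ha => ?_⟩ h₂
  · simp [hij, hi]
  · exact (s₂.1 v fun h => hv (List.mem_cons_of_mem _ h)).trans (s₁.1 v (by rw [hw]; exact hv))
  · exact (s₂.2 a ha).trans (s₁.2 a ha)

/-- The numbers of an instance: `B` is the threshold for narrow cuts, `M` the scale, and `C` are the
capacities. -/
structure InstData (n L s t : ℕ) (B M : ℤ) (C : ℕ → ℕ → ℤ) : Prop where
  padded : Padded n C
  nonneg : ∀ u < n + 2, ∀ v < n + 2, 0 ≤ C u v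
  scale_pos : 0 < M
  scale_le : M ≤ B
  big_le : B ≤ 2 ^ L
  s_lt : s < n
  t_lt : t < n

-- The four arcs of capacity `B` penalise sets that violate one of the conditions on s, y, t, z: the
-- minimum cut is below `B` exactly if a set meets all four conditions and has weight below `B`. The
-- starting cut {n} has weight 2B.
open Classical in
lemma rankPair_spec {m : Mem} {n L J s t y z : ℕ} {B M : ℤ} {C : ℕ → ℕ → ℤ}
    (hd : InstData n L s t B M C) (he : InstEnv m n L J s t B M C)
    (hy : m.var vy = y) (hz : m.var vz = z) (hyn : y < n) (hzn : z < n) :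
    ((Code.rankPair.den m).arr aRank = if SepBelow n C s t B y z then
      Function.update (m.arr aRank) z (m.arr aRank z + 1) else m.arr aRank) ∧
    ((Code.rankPair.den m).arr aUp = if SepBelow n C s t B y z then
      Function.update (m.arr aUp) y (m.arr aUp y + 1) else m.arr aUp) := by
  have hB : 0 ≤ B := hd.scale_pos.le.trans hd.scale_le
  have hs := hd.s_lt
  have ht := hd.t_lt
  set m₁ := (Code.copyRes aCap).den m with hm₁
  have s₁ : SameBut [va, vb] [aRes] m m₁ := (SameBut.refl _ _ m).step _ (by decide) (by decide)
  set m₂ := (Code.addRes (.var vn) (.var vs) (.var vBig)).den m₁ with hm₂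
  have s₂ : SameBut [va, vb] [aRes] m m₂ := s₁.step _ (by decide) (by decide)
  set m₃ := (Code.addRes (.var vn) (.var vy) (.var vBig)).den m₂ with hm₃
  have s₃ : SameBut [va, vb] [aRes] m m₃ := s₂.step _ (by decide) (by decide)
  set m₄ := (Code.addRes (.var vt) (.add (.var vn) (.lit 1)) (.var vBig)).den m₃ with hm₄
  have s₄ : SameBut [va, vb] [aRes] m m₄ := s₃.step _ (by decide) (by decide)
  set m₅ := (Code.addRes (.var vz) (.add (.var vn) (.lit 1)) (.var vBig)).den m₄ with hm₅
  have s₅ : SameBut [va, vb] [aRes] m m₅ := s₄.step _ (by decide) (by decide)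
  set m₆ := Code.minCut.den m₅ with hm₆
  have s₆ : SameBut Code.minCut.wv Code.minCut.wa m₅ m₆ := Code.minCut.sameBut m₅
  have e₁ := he.of_sameBut s₁ (by decide) (by decide)
  have e₂ := he.of_sameBut s₂ (by decide) (by decide)
  have e₃ := he.of_sameBut s₃ (by decide) (by decide)
  have e₄ := he.of_sameBut s₄ (by decide) (by decide)
  have e₅ := he.of_sameBut s₅ (by decide) (by decide)
  have e₆ := e₅.of_sameBut s₆ (by decide) (by decide)
  have hy₂ : m₂.var vy = y := (s₂.1 vy (by decide)).trans hy
  have hz₄ : m₄.var vz = z := (s₄.1 vz (by decide)).trans hz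
  have hy₆ : m₆.var vy = y := (s₆.1 vy (by decide)).trans ((s₅.1 vy (by decide)).trans hy)
  have hz₆ : m₆.var vz = z := (s₆.1 vz (by decide)).trans ((s₅.1 vz (by decide)).trans hz)
  have hr₆ : m₆.arr aRank = m.arr aRank := (s₆.2 aRank (by decide)).trans (s₅.2 aRank (by decide))
  have hu₆ : m₆.arr aUp = m.arr aUp := (s₆.2 aUp (by decide)).trans (s₅.2 aUp (by decide))
  have c₁ : NetCuts n (m₁.arr aRes) (cutw n C) := by
    refine (NetCuts.copyRes he.N_eq (by decide) ?_).congr fun S _ _ => ?_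
    · intro u hu v hv; rw [he.cap u hu v hv]; exact hd.nonneg u hu v hv
    · rw [cutw_congr he.cap, cutw_of_padded hd.padded]
  have c₂ := c₁.addRes (u := n) (v := s) (δ := B) (e₁ := .var vn) (e₂ := .var vs) (e₃ := .var vBig)
    e₁.N_eq e₁.n_eq e₁.s_eq e₁.big (by omega) (by omega) hB
  have c₃ := c₂.addRes (u := n) (v := y) (δ := B) (e₁ := .var vn) (e₂ := .var vy) (e₃ := .var vBig)
    e₂.N_eq e₂.n_eq hy₂ e₂.big (by omega) (by omega) hB
  have c₄ := c₃.addRes (u := t) (v := n + 1) (δ := B) (e₁ := .var vt)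
    (e₂ := .add (.var vn) (.lit 1)) (e₃ := .var vBig)
    e₃.N_eq e₃.t_eq (by change m₃.var vn + 1 = _; rw [e₃.n_eq]; push_cast; rfl) e₃.big (by omega) (by omega) hB
  have c₅ := c₄.addRes (u := z) (v := n + 1) (δ := B) (e₁ := .var vz)
    (e₂ := .add (.var vn) (.lit 1)) (e₃ := .var vBig)
    e₄.N_eq hz₄ (by change m₄.var vn + 1 = _; rw [e₄.n_eq]; push_cast; rfl) e₄.big (by omega) (by omega) hB
  obtain ⟨f₁, S, hS₁, hS₂, f₂⟩ := c₅.minCut e₅.toNetEnv (by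
    have h0 : cutw n C {n} = 0 := by
      refine Finset.sum_eq_zero fun u hu => Finset.sum_eq_zero fun v hv => ?_
      rw [if_neg]; simp at hu ⊢; omega
    have h1 : s ∉ ({n} : Finset ℕ) := by simp; omega
    have h2 : y ∉ ({n} : Finset ℕ) := by simp; omega
    have h3 : t ∉ ({n} : Finset ℕ) := by simp; omega
    have h4 : z ∉ ({n} : Finset ℕ) := by simp; omega
    simp only [h0, h1, h2, h3, h4, Finset.mem_singleton, not_false_eq_true, and_self, if_true,
      false_and, if_false]
    have := hd.big_le
    have h4 : (4 : ℤ) ≤ ((n + 2 : ℕ) : ℤ) * (n + 2 : ℕ) := by push_cast; nlinarith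
    nlinarith [h4])
  have key : m₆.var vFlow < B ↔ SepBelow n C s t B y z := by
    constructor
    · intro hlt
      rw [f₂] at hlt
      have hc := cutw_nonneg (N := n) (r := C)
        (fun u hu v hv => hd.nonneg u (by omega) v (by omega)) S
      simp only [hS₁, hS₂, not_false_eq_true, and_true, true_and] at hlt
      by_cases a1 : s ∈ S <;> by_cases a2 : y ∈ S <;> by_cases a3 : t ∈ S <;> by_cases a4 : z ∈ S <;>
        simp only [a1, a2, a3, a4, not_true_eq_false, not_false_eq_true, if_true, if_false] at hlt <;>
        first | omega | skip
      exact ⟨S, a1, a3, a2, a4, by omega⟩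
    · rintro ⟨T, t1, t2, t3, t4, t5⟩
      -- `T` is arbitrary at the two artificial vertices, so it is corrected there; the capacities
      -- below n do not see this.
      refine (f₁ (insert n (T.erase (n + 1))) (by simp) (by simp)).trans_lt ?_
      have a0 : ∀ u < n, u ∈ insert n (T.erase (n + 1)) ↔ u ∈ T := by
        intro u hu
        have b1 : u ≠ n := by omega
        have b2 : u ≠ n + 1 := by omega
        simp [b1, b2]
      rw [cutw_congr_set C a0]
      simp only [a0 s hs, a0 t ht, a0 y hyn, a0 z hzn, t1, t2, t3, t4, not_true_eq_false, and_false,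
        false_and, if_false]
      omega
  have hden : Code.rankPair.den m = (Code.ite (.sub (.var vBig) (.var vFlow))
      (.seq (.store aRank (.var vz) (.add (.get aRank (.var vz)) (.lit 1)))
        (.store aUp (.var vy) (.add (.get aUp (.var vy)) (.lit 1)))) .skip).den m₆ := rfl
  rw [hden]
  by_cases hR : SepBelow n C s t B y z
  · simp [Code.den, Expr.eval, e₆.big, key.2 hR, hR, hy₆, hz₆, Mem.arr_setArr, Mem.var_setArr, hr₆, hu₆]
  · have : ¬ 0 < B - m₆.var vFlow := by have := mt key.1 hR; omega
    simp only [Code.den, Expr.eval, e₆.big, this, hR, hr₆, hu₆, if_false, and_self]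

/-- The pair `(a, b)` comes before the pair `(k, l)`. -/
def Before (k l a b : ℕ) : Prop := a < k ∨ (a = k ∧ b < l)

open Classical in
lemma rankAll_spec {m : Mem} {n L J s t : ℕ} {B M : ℤ} {C : ℕ → ℕ → ℤ}
    (hd : InstData n L s t B M C) (he : InstEnv m n L J s t B M C)
    (h1 : ∀ v < n, m.arr aRank (v : ℕ) = 0) (h2 : ∀ v < n, m.arr aUp (v : ℕ) = 0) :
    (∀ v < n, (Code.rankAll.den m).arr aRank (v : ℕ) =
      ((Finset.range n).filter fun y => SepBelow n C s t B y v).card) ∧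
    (∀ v < n, (Code.rankAll.den m).arr aUp (v : ℕ) =
      ((Finset.range n).filter fun z => SepBelow n C s t B v z).card) := by
  have main := Code.pairs_inv (i := vy) (j := vz) (b := vn) (p := Code.rankPair) (m := m)
    (fun k l m => 
      (∀ v < n, m.arr aRank (v : ℕ) =
        ((Finset.range n).filter fun y => SepBelow n C s t B y v ∧ Before k l y v).card) ∧
      (∀ v < n, m.arr aUp (v : ℕ) =
        ((Finset.range n).filter fun z => SepBelow n C s t B v z ∧ Before k l v z).card))
    he.n_eq (by decide) (by decide) (by decide) (fun _ _ _ _ h => ⟨h, h⟩) ?_ ?_ ?_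
  · refine ⟨fun v hv => (main.1 v hv).trans ?_, fun v hv => (main.2 v hv).trans ?_⟩ <;>
    · congr 2
      refine Finset.filter_congr fun y hy => ?_
      simp only [Finset.mem_range] at hy
      simp [Before, hy, hv]
  · exact ⟨fun v hv => by simp [h1 v hv, Before], fun v hv => by simp [h2 v hv, Before]⟩
  · rintro k m hk ⟨g1, g2⟩
    refine ⟨fun v hv => (g1 v hv).trans ?_, fun v hv => (g2 v hv).trans ?_⟩ <;>
    · congr 2
      refine Finset.filter_congr fun y hy => ?_
      simp only [Finset.mem_range] at hy
      simp only [Before]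
      refine and_congr_right fun _ => ?_
      omega
  · rintro k l m' hk hl hi hj hs ⟨g1, g2⟩
    obtain ⟨q1, q2⟩ := rankPair_spec hd (he.of_sameBut hs (by decide) (by decide)) hi hj hk hl
    -- Advancing past the pair (k, l) admits one more pair, which affects only the count of column
    -- l; for `c2`, only that of row k.
    have c1 : ∀ v < n, ((Finset.range n).filter fun y => SepBelow n C s t B y v ∧
        Before k (l + 1) y v).card = ((Finset.range n).filter fun y => SepBelow n C s t B y v ∧
        Before k l y v).card + if v = l ∧ SepBelow n C s t B k l then 1 else 0 := by
      intro v hv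
      split_ifs with h
      · rw [← Finset.card_insert_of_notMem (a := k) (s := (Finset.range n).filter _)
          (by simp [Before, h.1])]
        congr 1
        ext y
        rw [Finset.mem_insert, Finset.mem_filter, Finset.mem_filter, Finset.mem_range]
        simp only [Before]
        obtain ⟨rfl, h⟩ := h
        constructor
        · rintro ⟨a1, a2, a3⟩
          by_cases hyk : y = k
          · exact Or.inl hyk
          · exact Or.inr ⟨a1, a2, by omega⟩
        · rintro (rfl | ⟨a1, a2, a3⟩)
          · exact ⟨hk, h, by omega⟩
          · exact ⟨a1, a2, by omega⟩
      · rw [add_zero]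
        congr 1
        refine Finset.filter_congr fun y hy => and_congr_right fun hy' => ?_
        simp only [Before]
        have : ¬ (y = k ∧ v = l) := by rintro ⟨rfl, rfl⟩; exact h ⟨rfl, hy'⟩
        omega
    have c2 : ∀ v < n, ((Finset.range n).filter fun z => SepBelow n C s t B v z ∧
        Before k (l + 1) v z).card = ((Finset.range n).filter fun z => SepBelow n C s t B v z ∧
        Before k l v z).card + if v = k ∧ SepBelow n C s t B k l then 1 else 0 := by
      intro v hv
      split_ifs with h
      · rw [← Finset.card_insert_of_notMem (a := l) (s := (Finset.range n).filter _)
          (by simp [Before, h.1])]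
        congr 1
        ext z
        rw [Finset.mem_insert, Finset.mem_filter, Finset.mem_filter, Finset.mem_range]
        simp only [Before]
        obtain ⟨rfl, h⟩ := h
        constructor
        · rintro ⟨a1, a2, a3⟩
          by_cases hyk : z = l
          · exact Or.inl hyk
          · exact Or.inr ⟨a1, a2, by omega⟩
        · rintro (rfl | ⟨a1, a2, a3⟩)
          · exact ⟨hl, h, by omega⟩
          · exact ⟨a1, a2, by omega⟩
      · rw [add_zero]
        congr 1
        refine Finset.filter_congr fun z hz => and_congr_right fun hz' => ?_
        simp only [Before]
        have : ¬ (v = k ∧ z = l) := by rintro ⟨rfl, rfl⟩; exact h ⟨rfl, hz'⟩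
        omega
    refine ⟨fun v hv => ?_, fun v hv => ?_⟩
    · rw [c1 v hv, q1]
      by_cases hR : SepBelow n C s t B k l
      · by_cases hvl : v = l
        · subst hvl; simp [hR, g1 v hv]
        · simp [hR, hvl, g1 v hv]
      · simp [hR, g1 v hv]
    · rw [c2 v hv, q2]
      by_cases hR : SepBelow n C s t B k l
      · by_cases hvl : v = k
        · subst hvl; simp [hR, g2 v hv]
        · simp [hR, hvl, g2 v hv]
      · simp [hR, g2 v hv]

/-! ### Raising the entries of a matrix as far as the rank inequalities permit -/

/-- The weight of the pairs inside `S`. -/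
def insw (n : ℕ) (r : ℕ → ℕ → ℤ) (S : Finset ℕ) : ℤ :=
  ∑ u ∈ Finset.range n, ∑ v ∈ Finset.range n, if u ∈ S ∧ v ∈ S then r u v else 0

/-- The sum of the entries of a matrix. -/
def totw (n : ℕ) (r : ℕ → ℕ → ℤ) : ℤ := ∑ u ∈ Finset.range n, ∑ v ∈ Finset.range n, r u v

lemma insw_congr_set {n : ℕ} (r : ℕ → ℕ → ℤ) {S S' : Finset ℕ}
    (h : ∀ u < n, u ∈ S ↔ u ∈ S') : insw n r S = insw n r S' := by
  refine Finset.sum_congr rfl fun u hu => Finset.sum_congr rfl fun v hv => ?_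
  rw [Finset.mem_range] at hu hv
  simp only [h u hu, h v hv]

lemma insw_le_totw {n : ℕ} {r : ℕ → ℕ → ℤ} (h : ∀ u < n, ∀ v < n, 0 ≤ r u v) (S : Finset ℕ) :
    insw n r S ≤ totw n r := by
  refine Finset.sum_le_sum fun u hu => Finset.sum_le_sum fun v hv => ?_
  have := h u (Finset.mem_range.1 hu) v (Finset.mem_range.1 hv)
  split_ifs <;> omega

lemma insw_nonneg {n : ℕ} {r : ℕ → ℕ → ℤ} (h : ∀ u < n, ∀ v < n, 0 ≤ r u v) (S : Finset ℕ) :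
    0 ≤ insw n r S := by
  refine Finset.sum_nonneg fun u hu => Finset.sum_nonneg fun v hv => ?_
  have := h u (Finset.mem_range.1 hu) v (Finset.mem_range.1 hv)
  split_ifs <;> omega

lemma insw_range (n : ℕ) (r : ℕ → ℕ → ℤ) : insw n r (Finset.range n) = totw n r := by
  refine Finset.sum_congr rfl fun u hu => Finset.sum_congr rfl fun v hv => if_pos ⟨hu, hv⟩

lemma totw_addAt {n u v : ℕ} (hu : u < n) (hv : v < n) (r : ℕ → ℕ → ℤ) (δ : ℤ) :
    totw n (addAt r u v δ) = totw n r + δ := by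
  have e : ∀ a b, addAt r u v δ a b = r a b + if a = u then (if b = v then δ else 0) else 0 := by
    intro a b
    unfold addAt
    by_cases h1 : a = u <;> by_cases h2 : b = v <;> simp [h1, h2]
  simp only [totw, e, Finset.sum_add_distrib]
  congr 1
  simp [Finset.sum_ite_irrel, hu, hv]

/-- The scaled right hand side of the rank inequality of `S`, plus a constant, minus the left hand
side. -/
def gapw (n : ℕ) (M : ℤ) (r : ℕ → ℕ → ℤ) (S : Finset ℕ) : ℤ :=
  M * ((Finset.range n).filter (· ∈ S)).card + totw n r - insw n r S

lemma gapw_congr_set {n : ℕ} (M : ℤ) (r : ℕ → ℕ → ℤ) {S S' : Finset ℕ}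
    (h : ∀ u < n, u ∈ S ↔ u ∈ S') : gapw n M r S = gapw n M r S' := by
  have : (Finset.range n).filter (· ∈ S) = (Finset.range n).filter (· ∈ S') :=
    Finset.filter_congr fun u hu => h u (Finset.mem_range.1 hu)
  rw [gapw, gapw, insw_congr_set r h, this]

lemma gapw_range (n : ℕ) (M : ℤ) (r : ℕ → ℕ → ℤ) : gapw n M r (Finset.range n) = M * n := by
  have : (Finset.range n).filter (· ∈ Finset.range n) = Finset.range n := by ext; simp
  rw [gapw, this, Finset.card_range, insw_range]
  ring

lemma gapw_nonneg {n : ℕ} {M : ℤ} (hM : 0 ≤ M) {r : ℕ → ℕ → ℤ}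
    (h : ∀ u < n, ∀ v < n, 0 ≤ r u v) (S : Finset ℕ) : 0 ≤ gapw n M r S := by
  have h1 := insw_le_totw h S
  have h2 : 0 ≤ M * ((Finset.range n).filter (· ∈ S)).card := by positivity
  unfold gapw
  omega

/-- The part of an integer matrix with the indices below `n`, divided by `M`. -/
noncomputable def scaled (n : ℕ) (r : ℕ → ℕ → ℤ) (M : ℤ) : Fin n → Fin n → ℝ :=
  fun u v => (r u v : ℝ) / M

lemma wt_scaled {n : ℕ} (r : ℕ → ℕ → ℤ) (M : ℤ) {T T' : Finset (Fin n)} {S S' : Finset ℕ}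
    (h : ∀ i : Fin n, i ∈ T ↔ (i : ℕ) ∈ S) (h' : ∀ i : Fin n, i ∈ T' ↔ (i : ℕ) ∈ S') :
    wt (scaled n r M) T T' = ((∑ u ∈ Finset.range n, ∑ v ∈ Finset.range n,
      if u ∈ S ∧ v ∈ S' then r u v else 0 : ℤ) : ℝ) / M := by
  rw [wt_eq_sum, Finset.sum_range, Int.cast_sum, Finset.sum_div]
  refine Finset.sum_congr rfl fun u _ => ?_
  rw [Finset.sum_range, Int.cast_sum, Finset.sum_div]
  refine Finset.sum_congr rfl fun v _ => ?_
  simp only [h u, h' v]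
  split_ifs
  · rfl
  · simp

lemma card_filter_mem {n : ℕ} {T : Finset (Fin n)} {S : Finset ℕ}
    (h : ∀ i : Fin n, i ∈ T ↔ (i : ℕ) ∈ S) : T.card = ((Finset.range n).filter (· ∈ S)).card := by
  rw [← Finset.card_map Fin.valEmbedding]
  congr 1
  ext a
  simp only [Finset.mem_map, Fin.valEmbedding_apply, Finset.mem_filter, Finset.mem_range]
  constructor
  · rintro ⟨i, hi, rfl⟩; exact ⟨i.2, (h i).1 hi⟩
  · rintro ⟨ha, hS⟩; exact ⟨⟨a, ha⟩, (h ⟨a, ha⟩).2 hS, rfl⟩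

namespace Code

/-- The network whose cuts have the weights of the rank inequalities. -/
def raiseNet : Code :=
  .seq (copyRes aZ) (.loop va vn
    (.seq (addRes (.var va) (.add (.var vn) (.lit 1)) (.var vScale))
      (.loop vb vn (addRes (.var vn) (.var va) (.get aZ (ix (.var va) (.var vb)))))))

/-- Compute the minimum weight of a cut of this network among the sets that contain `vy` and
`vz`. -/
def raiseFlow : Code :=
  .seq raiseNet
    (.seq (addRes (.var vn) (.var vy) (.mul (.var vScale) (.var vn)))
      (.seq (addRes (.var vn) (.var vz) (.mul (.var vScale) (.var vn))) minCut))

/-- Raise the entry `(vy, vz)` of `aZ` as far as possible. -/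
def raise : Code :=
  .seq raiseFlow
    (.seq (.assign vRaise (.sub (.sub (.var vFlow) (.var vTotal)) (.var vScale)))
      (.seq (.ite (.sub (.var vRaise) (.sub (.get aCap (ix (.var vy) (.var vz)))
            (.get aZ (ix (.var vy) (.var vz)))))
          (.assign vRaise (.sub (.get aCap (ix (.var vy) (.var vz)))
            (.get aZ (ix (.var vy) (.var vz))))) .skip)
        (.seq (.store aZ (ix (.var vy) (.var vz))
            (.add (.get aZ (ix (.var vy) (.var vz))) (.var vRaise)))
          (.assign vTotal (.add (.var vTotal) (.var vRaise))))))

end Code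

/-- Arcs to the sink charge M for each vertex of S, and arcs from the source charge the whole row of
each vertex outside S. The copied matrix charges the pairs that leave S, so all pairs are charged
except those inside S. -/
lemma raiseNet_spec {m : Mem} {n : ℕ} {M : ℤ} (hn : m.var vn = n) (hN : m.var vN = (n + 2 : ℕ))
    (hM : m.var vScale = M) (hM₀ : 0 ≤ M) {r : ℕ → ℕ → ℤ} (hr : mat (m.arr aZ) (n + 2) = r)
    (hpad : Padded n r) (h0 : ∀ u < n + 2, ∀ v < n + 2, 0 ≤ r u v) :
    NetCuts n ((Code.raiseNet.den m).arr aRes)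
      (gapw n M r) := by
  set m₁ := (Code.copyRes aZ).den m with hm₁
  have s₁ : SameBut [va, vb] [aRes] m m₁ := (SameBut.refl _ _ m).step _ (by decide) (by decide)
  have c₁ : NetCuts n (m₁.arr aRes) (cutw n r) := by
    refine (NetCuts.copyRes hN (by decide) ?_).congr fun S _ _ => ?_
    · rw [hr]; exact h0
    · rw [hr, cutw_of_padded hpad]
  have hden : Code.raiseNet.den m = (Code.loop va vn
    (.seq (.addRes (.var va) (.add (.var vn) (.lit 1)) (.var vScale))
      (.loop vb vn (.addRes (.var vn) (.var va) (.get aZ (ix (.var va) (.var vb))))))).den m₁ := rfl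
  rw [hden]
  have main := Code.loop_inv (i := va) (b := vn)
    (p := .seq (.addRes (.var va) (.add (.var vn) (.lit 1)) (.var vScale))
      (.loop vb vn (.addRes (.var vn) (.var va) (.get aZ (ix (.var va) (.var vb))))))
    (m := m₁) (fun k m => NetCuts n (m.arr aRes) (fun S => cutw n r S + ∑ a ∈ Finset.range k,
      ((if a ∈ S then M else 0) + ∑ b ∈ Finset.range n, if a ∈ S then 0 else r a b)))
    ((s₁.1 vn (by decide)).trans hn) (fun _ _ _ h => h) (by simpa using c₁) ?_
  · refine main.congr fun S _ _ => ?_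
    have e1 : ∑ a ∈ Finset.range n, (if a ∈ S then M else 0) =
        M * ((Finset.range n).filter (· ∈ S)).card := by
      rw [← Finset.sum_filter, Finset.sum_const, nsmul_eq_mul, mul_comm]
    have e2 : cutw n r S + ∑ a ∈ Finset.range n, ∑ b ∈ Finset.range n, (if a ∈ S then 0 else r a b) =
        totw n r - insw n r S := by
      simp only [cutw, totw, insw, ← Finset.sum_add_distrib, ← Finset.sum_sub_distrib]
      refine Finset.sum_congr rfl fun u _ => Finset.sum_congr rfl fun v _ => ?_
      by_cases a1 : u ∈ S <;> by_cases a2 : v ∈ S <;> simp [a1, a2]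
    rw [Finset.sum_add_distrib, e1, gapw]
    linarith
  intro k m₂ hk hva s₂ hI
  have s₂' : SameBut [va, vb] [aRes] m m₂ :=
    ⟨fun j hj => (s₂.1 j hj).trans (s₁.1 j hj),
      fun j hj => (s₂.2 j (by simpa [Code.wa, Code.addRes] using hj)).trans (s₁.2 j hj)⟩
  have hn₂ : m₂.var vn = n := (s₂'.1 vn (by decide)).trans hn
  set m₃ := (Code.addRes (.var va) (.add (.var vn) (.lit 1)) (.var vScale)).den m₂ with hm₃
  have s₃ : SameBut [va, vb] [aRes] m m₃ := s₂'.step _ (by decide) (by decide)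
  have hva₃ : m₃.var va = k := hva
  have c₃ : NetCuts n (m₃.arr aRes) _ := hI.addRes (u := k) (v := n + 1) (δ := M) (e₁ := .var va)
    (e₂ := .add (.var vn) (.lit 1)) (e₃ := .var vScale)
    ((s₂'.1 vN (by decide)).trans hN) hva (by change m₂.var vn + 1 = _; rw [hn₂]; push_cast; rfl)
    ((s₂'.1 vScale (by decide)).trans hM) (by omega) (by omega) hM₀
  have inner := Code.loop_inv (i := vb) (b := vn)
    (p := .addRes (.var vn) (.var va) (.get aZ (ix (.var va) (.var vb))))
    (m := m₃) (fun l m => NetCuts n (m.arr aRes) (fun S => cutw n r S + (∑ a ∈ Finset.range k,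
      ((if a ∈ S then M else 0) + ∑ b ∈ Finset.range n, if a ∈ S then 0 else r a b)) +
      ((if k ∈ S then M else 0) + ∑ b ∈ Finset.range l, if k ∈ S then 0 else r k b)))
    ((s₃.1 vn (by decide)).trans hn) (fun _ _ _ h => h) ?_ ?_
  · refine inner.congr fun S _ _ => ?_
    rw [Finset.sum_range_succ, add_assoc]
  · refine c₃.congr fun S _ hS => ?_
    simp [hS]
  intro l m₄ hl hvb s₄ hI₄
  have s₄' : SameBut [va, vb] [aRes] m m₄ :=
    ⟨fun j hj => (s₄.1 j (fun h => hj (List.mem_cons_of_mem _ h))).trans (s₃.1 j hj),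
      fun j hj => (s₄.2 j hj).trans (s₃.2 j hj)⟩
  have hva₄ : m₄.var va = k := (s₄.1 va (by decide)).trans hva₃
  have hN₄ : m₄.var vN = (n + 2 : ℕ) := (s₄'.1 vN (by decide)).trans hN
  refine (hI₄.addRes (u := n) (v := k) (δ := r k l) (e₁ := .var vn)
    (e₂ := .var va) (e₃ := .get aZ (ix (.var va) (.var vb)))
    hN₄ ((s₄'.1 vn (by decide)).trans hn) hva₄ ?_ (by omega) (by omega)
    (h0 k (by omega) l (by omega))).congr fun S hS _ => ?_
  · simp only [Expr.eval, ix, hva₄, hvb, hN₄, s₄'.2 aZ (by decide), ← hr]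
    rfl
  · rw [Finset.sum_range_succ]
    by_cases a1 : k ∈ S
    · simp [a1]
    · simp [a1, hS]; ring

/-- The matrix `aZ` and its total weight, where the greedy algorithm has treated the pairs in `Q`. -/
structure ZState (n : ℕ) (M : ℤ) (C : ℕ → ℕ → ℤ) (z₀ : Fin n → Fin n → ℝ)
    (Q : Fin n → Fin n → Prop) (m : Mem) : Prop where
  padded : Padded n (mat (m.arr aZ) (n + 2))
  total : m.var vTotal = totw n (mat (m.arr aZ) (n + 2))
  sat : Saturates (scaled n C M) z₀ Q (scaled n (mat (m.arr aZ) (n + 2)) M)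

lemma ZState.nonneg {n : ℕ} {M : ℤ} {C : ℕ → ℕ → ℤ} {z₀ : Fin n → Fin n → ℝ}
    {Q : Fin n → Fin n → Prop} {m : Mem} (h : ZState n M C z₀ Q m) (hM : 0 < M)
    (hz₀ : ∀ u v, 0 ≤ z₀ u v) :
    ∀ u < n + 2, ∀ v < n + 2, 0 ≤ mat (m.arr aZ) (n + 2) u v := by
  intro u hu v hv
  by_cases huv : u < n ∧ v < n
  · have h1 := (hz₀ ⟨u, huv.1⟩ ⟨v, huv.2⟩).trans (h.sat.ge ⟨u, huv.1⟩ ⟨v, huv.2⟩)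
    unfold scaled at h1
    have hM' : (0 : ℝ) < M := by exact_mod_cast hM
    rw [le_div_iff₀ hM', zero_mul] at h1
    exact_mod_cast h1
  · rw [h.padded u hu v hv (by omega)]

/-- The additional capacities M·n make it useless to leave out y or z: the set of all vertices
contains both and has `gapw` equal to M·n. -/
lemma raiseFlow_spec {m : Mem} {n L J s t y z : ℕ} {B M : ℤ} {C r : ℕ → ℕ → ℤ}
    (hd : InstData n L s t B M C) (he : InstEnv m n L J s t B M C)
    (hr : mat (m.arr aZ) (n + 2) = r) (hpad : Padded n r)
    (h0 : ∀ u < n + 2, ∀ v < n + 2, 0 ≤ r u v) (htot : totw n r ≤ M * n)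
    (hy : m.var vy = y) (hz : m.var vz = z) (hyn : y < n) (hzn : z < n) :
    (∀ T : Finset ℕ, y ∈ T → z ∈ T → (Code.raiseFlow.den m).var vFlow ≤ gapw n M r T) ∧
    ∃ T : Finset ℕ, y ∈ T ∧ z ∈ T ∧ (Code.raiseFlow.den m).var vFlow = gapw n M r T := by
  have hM := hd.scale_pos
  set m₁ := Code.raiseNet.den m with hm₁
  have s₁ : SameBut [va, vb] [aRes] m m₁ := (SameBut.refl _ _ m).step _ (by decide) (by decide)
  set m₂ := (Code.addRes (.var vn) (.var vy) (.mul (.var vScale) (.var vn))).den m₁ with hm₂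
  have s₂ : SameBut [va, vb] [aRes] m m₂ := s₁.step _ (by decide) (by decide)
  set m₃ := (Code.addRes (.var vn) (.var vz) (.mul (.var vScale) (.var vn))).den m₂ with hm₃
  have s₃ : SameBut [va, vb] [aRes] m m₃ := s₂.step _ (by decide) (by decide)
  have e₁ := he.of_sameBut s₁ (by decide) (by decide)
  have e₂ := he.of_sameBut s₂ (by decide) (by decide)
  have e₃ := he.of_sameBut s₃ (by decide) (by decide)
  have hnM : 0 ≤ M * n := by positivity
  have c₁ : NetCuts n (m₁.arr aRes) _ :=
    raiseNet_spec he.n_eq he.N_eq he.scale hM.le hr hpad h0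
  have c₂ : NetCuts n (m₂.arr aRes) _ :=
    c₁.addRes (u := n) (v := y) (δ := M * n) (e₁ := .var vn) (e₂ := .var vy)
    (e₃ := .mul (.var vScale) (.var vn)) e₁.N_eq e₁.n_eq ((s₁.1 vy (by decide)).trans hy)
    (by simp only [Expr.eval, e₁.scale, e₁.n_eq]) (by omega) (by omega) hnM
  have c₃ : NetCuts n (m₃.arr aRes) _ :=
    c₂.addRes (u := n) (v := z) (δ := M * n) (e₁ := .var vn) (e₂ := .var vz)
    (e₃ := .mul (.var vScale) (.var vn)) e₂.N_eq e₂.n_eq ((s₂.1 vz (by decide)).trans hz)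
    (by simp only [Expr.eval, e₂.scale, e₂.n_eq]) (by omega) (by omega) hnM
  have hle : ∀ u < n, ∀ v < n, 0 ≤ r u v := fun u hu v hv => h0 u (by omega) v (by omega)
  have hw : gapw n M r {n} ≤ totw n r := by
    have h1 : (Finset.range n).filter (· ∈ ({n} : Finset ℕ)) = ∅ := by
      ext a; simp
    have h2 := insw_nonneg hle {n}
    rw [gapw, h1, Finset.card_empty]
    omega
  -- The weight of the starting cut {n}: at most the total of the matrix plus the two additional
  -- arcs.
  have hL : totw n r + M * n + M * n ≤ (n + 2 : ℕ) * (n + 2 : ℕ) * (2 * 2 ^ L) := by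
    have h3 : M ≤ 2 ^ L := hd.scale_le.trans hd.big_le
    have h6 : M * n ≤ n * 2 ^ L := by nlinarith
    have h7 : (3 : ℤ) * n ≤ 2 * (((n + 2 : ℕ) : ℤ) * (n + 2 : ℕ)) := by push_cast; nlinarith
    have h8 : (0 : ℤ) ≤ 2 ^ L := by positivity
    have h9 := mul_le_mul_of_nonneg_right h7 h8
    linarith
  have hden : Code.raiseFlow.den m = Code.minCut.den m₃ := rfl
  rw [hden]
  obtain ⟨f₁, S, hS₁, hS₂, f₂⟩ := c₃.minCut e₃.toNetEnv (by
    have h4 : y ∉ ({n} : Finset ℕ) := by simp; omega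
    have h5 : z ∉ ({n} : Finset ℕ) := by simp; omega
    simp only [h4, h5, Finset.mem_singleton, not_false_eq_true, and_self, if_true]
    linarith)
  generalize (Code.minCut.den m₃).var vFlow = F at *
  have g₁ : ∀ T : Finset ℕ, y ∈ T → z ∈ T → F ≤ gapw n M r T := by
    intro T hyT hzT
    have a0 : ∀ u < n, u ∈ insert n (T.erase (n + 1)) ↔ u ∈ T := by
      intro u hu
      have b1 : u ≠ n := by omega
      have b2 : u ≠ n + 1 := by omega
      simp [b1, b2]
    have := f₁ (insert n (T.erase (n + 1))) (by simp) (by simp)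
    rw [gapw_congr_set M r a0] at this
    simpa only [a0 y hyn, a0 z hzn, hyT, hzT, not_true_eq_false, and_false, if_false,
      add_zero] using this
  refine ⟨g₁, ?_⟩
  by_cases hyz : y ∈ S ∧ z ∈ S
  · refine ⟨S, hyz.1, hyz.2, ?_⟩
    simpa only [hyz.1, hyz.2, not_true_eq_false, and_false, if_false, add_zero] using f₂
  · refine ⟨Finset.range n, Finset.mem_range.2 hyn, Finset.mem_range.2 hzn,
      le_antisymm (g₁ _ (Finset.mem_range.2 hyn) (Finset.mem_range.2 hzn)) ?_⟩
    have q1 := gapw_nonneg hM.le hle S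
    rw [gapw_range, f₂]
    by_cases b1 : y ∈ S
    · have b2 : z ∉ S := fun b2 => hyz ⟨b1, b2⟩
      simp only [hS₁, b1, b2, not_true_eq_false, not_false_eq_true, and_false, and_true, if_true,
        if_false]
      linarith
    · by_cases b2 : z ∈ S <;>
      · simp only [hS₁, b1, b2, not_true_eq_false, not_false_eq_true, and_false, and_true, if_true,
          if_false]
        linarith

/-- Subtracting the total and M from the minimum of `gapw` leaves the minimum of M(|T| - 1) - r(T),
which is M times the slack in `Saturates.step`. All quantities are integers at the scale M, so no
new denominators arise. -/
lemma raise_spec {m : Mem} {n L J s t y z : ℕ} {B M : ℤ} {C : ℕ → ℕ → ℤ}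
    (hd : InstData n L s t B M C) (he : InstEnv m n L J s t B M C)
    {z₀ : Fin n → Fin n → ℝ} (hz₀ : ∀ u v, 0 ≤ z₀ u v) {Q : Fin n → Fin n → Prop}
    (h : ZState n M C z₀ Q m)
    (hy : m.var vy = y) (hz : m.var vz = z) (hyn : y < n) (hzn : z < n) :
    ZState n M C z₀ (fun a b => Q a b ∨ (a = ⟨y, hyn⟩ ∧ b = ⟨z, hzn⟩)) (Code.raise.den m) := by
  have hM := hd.scale_pos
  have h0 := h.nonneg hM hz₀
  set r := mat (m.arr aZ) (n + 2) with hr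
  have hMr : (0 : ℝ) < M := by exact_mod_cast hM
  -- The rank inequality of the whole vertex set, weakened from n - 1 to n.
  have htot : totw n r ≤ M * n := by
    have h1 := h.sat.indep Finset.univ ⟨⟨y, hyn⟩, Finset.mem_univ _⟩
    rw [wt_scaled r M (S := Finset.range n) (S' := Finset.range n) (by simp) (by simp),
      div_le_iff₀ hMr, Finset.card_univ, Fintype.card_fin] at h1
    have h2 : ((insw n r (Finset.range n) : ℤ) : ℝ) ≤ ((n - 1) * M : ℝ) := h1
    rw [insw_range] at h2
    have h3 : ((totw n r : ℤ) : ℝ) ≤ ((M * n : ℤ) : ℝ) := by push_cast; nlinarith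
    exact_mod_cast h3
  obtain ⟨g₁, g₂⟩ := raiseFlow_spec hd he hr.symm h.padded h0 htot hy hz hyn hzn
  set m₄ := Code.raiseFlow.den m with hm₄
  have s₄ : SameBut Code.raiseFlow.wv Code.raiseFlow.wa m m₄ := Code.raiseFlow.sameBut m
  have e₄ := he.of_sameBut s₄ (by decide) (by decide)
  have hy₄ : m₄.var vy = y := (s₄.1 vy (by decide)).trans hy
  have hz₄ : m₄.var vz = z := (s₄.1 vz (by decide)).trans hz
  have hZ₄ : m₄.arr aZ = m.arr aZ := s₄.2 aZ (by decide)
  have hT₄ : m₄.var vTotal = totw n r := (s₄.1 vTotal (by decide)).trans h.total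
  set F := m₄.var vFlow with hF
  set δ : ℤ := min (C y z - r y z) (F - totw n r - M) with hδ
  have hcap : m₄.arr aCap ((y : ℤ) * (n + 2 : ℕ) + z) = C y z :=
    e₄.cap y (by omega) z (by omega)
  have hZr : m.arr aZ ((y : ℤ) * (n + 2 : ℕ) + z) = r y z := rfl
  set m₅ := (Code.assign vRaise (.sub (.sub (.var vFlow) (.var vTotal)) (.var vScale))).den m₄
    with hm₅
  have hR₅ : m₅.var vRaise = F - totw n r - M := by
    simp [hm₅, Code.den, Expr.eval, Mem.var_setVar, hT₄, e₄.scale, ← hF]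
  have s₅ : SameBut [vRaise] [] m₄ m₅ := (SameBut.refl _ _ m₄).step _ (by decide) (by decide)
  set p₆ : Code := .ite (.sub (.var vRaise) (.sub (.get aCap (ix (.var vy) (.var vz)))
      (.get aZ (ix (.var vy) (.var vz)))))
    (.assign vRaise (.sub (.get aCap (ix (.var vy) (.var vz)))
      (.get aZ (ix (.var vy) (.var vz))))) .skip with hp₆
  set m₆ := p₆.den m₅ with hm₆
  have s₆ : SameBut [vRaise] [] m₄ m₆ := s₅.step _ (by decide) (by decide)
  have ev : ∀ m' : Mem, SameBut [vRaise] [] m₄ m' →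
      (ix (.var vy) (.var vz)).eval m' = (y : ℤ) * (n + 2 : ℕ) + z := by
    intro m' hm'
    simp only [ix, Expr.eval]
    rw [(hm'.1 vy (by decide)).trans hy₄, (hm'.1 vz (by decide)).trans hz₄,
      (hm'.1 vN (by decide)).trans e₄.N_eq]
  have hR₆ : m₆.var vRaise = δ := by
    have h1 : (Expr.sub (.get aCap (ix (.var vy) (.var vz))) (.get aZ (ix (.var vy) (.var vz)))).eval
        m₅ = C y z - r y z := by
      simp only [Expr.eval]
      rw [ev m₅ s₅, s₅.2 aCap (by decide), s₅.2 aZ (by decide), hcap, hZ₄, hZr]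
    have h2 : (Expr.sub (.var vRaise) (.sub (.get aCap (ix (.var vy) (.var vz)))
        (.get aZ (ix (.var vy) (.var vz))))).eval m₅ = F - totw n r - M - (C y z - r y z) := by
      rw [← h1, ← hR₅]; rfl
    rw [hm₆, hp₆, Code.den, h2]
    split_ifs with hc
    · rw [Code.den, h1, Mem.var_setVar, if_pos rfl, hδ, min_eq_left (by omega)]
    · rw [Code.den, hR₅, hδ, min_eq_right (by omega)]
  have hden : Code.raise.den m = (Code.seq (.store aZ (ix (.var vy) (.var vz))
      (.add (.get aZ (ix (.var vy) (.var vz))) (.var vRaise)))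
      (.assign vTotal (.add (.var vTotal) (.var vRaise)))).den m₆ := rfl
  have hZ' : (Code.raise.den m).arr aZ = Function.update (m.arr aZ)
      ((y : ℤ) * (n + 2 : ℕ) + z) (r y z + δ) := by
    rw [hden]
    simp only [Code.den, Expr.eval, Mem.arr_setVar, Mem.arr_setArr, if_true]
    rw [ev m₆ s₆, s₆.2 aZ (by decide), hZ₄, hR₆, hZr]
  have hT' : (Code.raise.den m).var vTotal = totw n r + δ := by
    rw [hden]
    simp only [Code.den, Expr.eval, Mem.var_setVar, Mem.var_setArr, if_true]
    rw [(s₆.1 vTotal (by decide)).trans hT₄, hR₆]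
  have hZe : ∀ a, ∀ b < n + 2, mat ((Code.raise.den m).arr aZ) (n + 2) a b =
      addAt r y z δ a b := by
    intro a b hb
    rw [hZ']
    exact mat_addAt (by omega) hb
  refine ⟨fun u hu v hv huv => ?_, ?_, ?_⟩
  · rw [hZe u v hv, addAt, if_neg (by omega)]
    exact h.padded u hu v hv huv
  · rw [hT', ← totw_addAt hyn hzn]
    refine Finset.sum_congr rfl fun u hu => Finset.sum_congr rfl fun v hv => ?_
    rw [hZe u v (by simp at hv; omega)]
  · have step := h.sat.step (u := ⟨y, hyn⟩) (v := ⟨z, hzn⟩) (m := (F - totw n r - M : ℤ) / M)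
      (fun T hyT hzT => ?_) ?_
    · convert step using 1
      funext a b
      unfold scaled bump
      rw [hZe a b (by omega), addAt]
      have : (a = ⟨y, hyn⟩ ∧ b = ⟨z, hzn⟩) ↔ ((a : ℕ) = y ∧ (b : ℕ) = z) := by
        simp [Fin.ext_iff]
      simp only [this]
      split_ifs with hab
      · rw [← hr, ← sub_div, min_div_div_right hMr.le, ← add_div, hδ]
        push_cast
        rfl
      · rfl
    · have a0 : ∀ i : Fin n, i ∈ T ↔ (i : ℕ) ∈ T.map Fin.valEmbedding := by
        intro i
        rw [Finset.mem_map]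
        exact ⟨fun hi => ⟨i, hi, rfl⟩, fun ⟨j, hj, e⟩ => by rwa [← Fin.ext e]⟩
      rw [wt_scaled _ M a0 a0, card_filter_mem a0]
      have := g₁ (T.map Fin.valEmbedding) ((a0 ⟨y, hyn⟩).1 hyT) ((a0 ⟨z, hzn⟩).1 hzT)
      rw [div_le_iff₀ hMr, sub_mul, sub_mul, div_mul_cancel₀ _ hMr.ne']
      rw [gapw, insw] at this
      have h' := (Int.cast_le (R := ℝ)).2 this
      push_cast at h' ⊢
      linarith
    · obtain ⟨T, hyT, hzT, hT⟩ := g₂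
      refine ⟨Finset.univ.filter fun i => (i : ℕ) ∈ T, by simpa using hyT, by simpa using hzT, ?_⟩
      have a0 : ∀ i : Fin n, i ∈ Finset.univ.filter (fun i : Fin n => (i : ℕ) ∈ T) ↔ (i : ℕ) ∈ T := by
        simp
      rw [wt_scaled _ M a0 a0, card_filter_mem a0]
      rw [div_eq_iff hMr.ne', sub_mul, sub_mul, div_mul_cancel₀ _ hMr.ne']
      rw [gapw, insw] at hT
      have h' := congrArg (Int.cast (R := ℝ)) hT
      push_cast at h' ⊢
      linarith

/-! ### The two passes of the greedy algorithm -/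

/-- Raise all entries with equal values of `a` and `b`. -/
def Code.pass (a b : Expr) : Code :=
  .loop vy vn (.loop vz vn (.ite (.sub a b) .skip (.ite (.sub b a) .skip .raise)))

lemma ZState.congr {n : ℕ} {M : ℤ} {C : ℕ → ℕ → ℤ} {z₀ : Fin n → Fin n → ℝ}
    {Q Q' : Fin n → Fin n → Prop} {m : Mem} (h : ZState n M C z₀ Q m)
    (hQ : ∀ u v, Q u v ↔ Q' u v) : ZState n M C z₀ Q' m :=
  ⟨h.padded, h.total, h.sat.congr hQ⟩

/-- Between the passes the current matrix becomes the base point, relative to which no pair has been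
treated yet. -/
lemma ZState.restart {n : ℕ} {M : ℤ} {C : ℕ → ℕ → ℤ} {z₀ : Fin n → Fin n → ℝ}
    {Q : Fin n → Fin n → Prop} {m : Mem} (h : ZState n M C z₀ Q m) :
    ZState n M C (scaled n (mat (m.arr aZ) (n + 2)) M) (fun _ _ => False) m :=
  ⟨h.padded, h.total, Saturates.refl h.sat.indep h.sat.le_cap⟩

lemma ZState.of_sameBut {n : ℕ} {M : ℤ} {C : ℕ → ℕ → ℤ} {z₀ : Fin n → Fin n → ℝ}
    {Q : Fin n → Fin n → Prop} {m m' : Mem} (h : ZState n M C z₀ Q m) {l l' : List ℕ}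
    (hs : SameBut l l' m m') (hl : vTotal ∉ l) (hl' : aZ ∉ l') : ZState n M C z₀ Q m' := by
  refine ⟨?_, ?_, ?_⟩
  · rw [hs.2 aZ hl']; exact h.padded
  · rw [hs.2 aZ hl', hs.1 vTotal hl]; exact h.total
  · rw [hs.2 aZ hl']; exact h.sat

lemma SameBut.setVar (m : Mem) (i : ℕ) (x : ℤ) : SameBut [i] [] m (m.setVar i x) :=
  ⟨fun j hj => by rw [Mem.var_setVar, if_neg (by simpa using hj)], fun _ _ => rfl⟩

/-- The program only tests positivity, so equality of `a` and `b` is tested by two differences. The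
tests must describe `Q` throughout the pass, hence in every memory that the loops can produce. -/
lemma pass_spec {m : Mem} {n L J s t : ℕ} {B M : ℤ} {C : ℕ → ℕ → ℤ}
    (hd : InstData n L s t B M C) (he : InstEnv m n L J s t B M C)
    {z₀ : Fin n → Fin n → ℝ} (hz₀ : ∀ u v, 0 ≤ z₀ u v) {Q : Fin n → Fin n → Prop}
    (h : ZState n M C z₀ (fun _ _ => False) m) {a b : Expr}
    (hab : ∀ (m' : Mem) (y z : Fin n), SameBut (vy :: vz :: Code.raise.wv) Code.raise.wa m m' →
      m'.var vy = (y : ℕ) → m'.var vz = (z : ℕ) → (a.eval m' = b.eval m' ↔ Q y z)) :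
    ZState n M C z₀ Q ((Code.pass a b).den m) := by
  have main := Code.pairs_inv (i := vy) (j := vz) (b := vn)
    (p := .ite (.sub a b) .skip (.ite (.sub b a) .skip .raise)) (m := m)
    (fun k l m => ZState n M C z₀ (fun u v => Q u v ∧ Before k l u v) m)
    he.n_eq (by decide) (show vy ∉ Code.raise.wv by decide)
    (show vn ∉ vy :: vz :: Code.raise.wv by decide) (fun _ _ m x h =>
      ⟨h.of_sameBut (SameBut.setVar m vy x) (by decide) (by decide),
        h.of_sameBut (SameBut.setVar m vz x) (by decide) (by decide)⟩)
    (h.congr (by simp [Before])) (fun k m hk h => h.congr fun u v => ?_) ?_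
  · refine main.congr fun u v => ?_
    simp [Before]
  · simp only [Before]
    refine and_congr_right fun _ => ?_
    omega
  intro k l m' hk hl hy hz hs hI
  replace hs : SameBut (vy :: vz :: Code.raise.wv) Code.raise.wa m m' := hs
  have hiff := hab m' ⟨k, hk⟩ ⟨l, hl⟩ hs hy hz
  have hskip : ¬ Q ⟨k, hk⟩ ⟨l, hl⟩ →
      ZState n M C z₀ (fun u v => Q u v ∧ Before k (l + 1) u v) m' := by
    intro hQ
    refine hI.congr fun u v => and_congr_right fun huv => ?_
    have : ¬ ((u : ℕ) = k ∧ (v : ℕ) = l) := by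
      rintro ⟨rfl, rfl⟩; exact hQ huv
    simp only [Before]
    omega
  by_cases hlt : 0 < a.eval m' - b.eval m'
  · simp only [Code.den, Expr.eval, hlt, if_true]
    exact hskip fun hQ => by have := hiff.2 hQ; omega
  · by_cases hlt' : 0 < b.eval m' - a.eval m'
    · simp only [Code.den, Expr.eval, hlt, hlt', if_true, if_false]
      exact hskip fun hQ => by have := hiff.2 hQ; omega
    · simp only [Code.den, Expr.eval, hlt, hlt', if_false]
      have hQ := hiff.1 (by omega)
      refine (raise_spec hd (he.of_sameBut hs (by decide) (by decide)) hz₀ hI hy hz hk hl).congr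
        fun u v => ?_
      constructor
      · rintro (⟨h1, h2⟩ | ⟨rfl, rfl⟩)
        · exact ⟨h1, by simp only [Before] at h2 ⊢; omega⟩
        · exact ⟨hQ, Or.inr ⟨rfl, Nat.lt_succ_self l⟩⟩
      · rintro ⟨h1, h2⟩
        by_cases huv : (u : ℕ) = k ∧ (v : ℕ) = l
        · exact Or.inr ⟨Fin.ext huv.1, Fin.ext huv.2⟩
        · exact Or.inl ⟨h1, by simp only [Before] at h2 ⊢; omega⟩

/-- The main part of the algorithm: rank the vertices by the narrow cuts, then raise the entries
inside the layers, then the entries between consecutive layers. -/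
def Code.tighten : Code :=
  .seq .rankAll
    (.seq (.pass (.get aRank (.var vy)) (.get aRank (.var vz)))
      (.pass (.add (.get aRank (.var vz)) (.get aUp (.var vy))) (.var vn)))

lemma sepBelow_iff {n : ℕ} {s t : Fin n} {B E : ℤ} {C : ℕ → ℕ → ℤ} {τ : ℝ} (hE : 0 < E)
    (hB : (B : ℝ) = E * (1 + τ)) (y z : Fin n) :
    SepBelow n C s t B y z ↔ Separates (narrowCuts s t (scaled n C E) τ) y z := by
  have hE' : (0 : ℝ) < E := by exact_mod_cast hE
  have key : ∀ (T : Finset (Fin n)) (S : Finset ℕ), (∀ i : Fin n, i ∈ T ↔ (i : ℕ) ∈ S) →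
      (wt (scaled n C E) T Tᶜ < 1 + τ ↔ cutw n C S < B) := by
    intro T S hTS
    have : wt (scaled n C E) T Tᶜ = (cutw n C S : ℝ) / E := by
      rw [wt_scaled C E (S' := Finset.range n \ S) hTS (by intro i; simp [hTS i])]
      congr 2
      refine Finset.sum_congr rfl fun u hu => Finset.sum_congr rfl fun v hv => ?_
      simp only [Finset.mem_sdiff, hv, true_and]
    rw [this, div_lt_iff₀ hE', mul_comm, ← hB, Int.cast_lt]
  constructor
  · rintro ⟨S, h1, h2, h3, h4, h5⟩
    have hS : ∀ i : Fin n, i ∈ Finset.univ.filter (fun i : Fin n => (i : ℕ) ∈ S) ↔ (i : ℕ) ∈ S := by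
      simp
    exact ⟨_, ⟨(hS s).2 h1, fun h => h2 ((hS t).1 h), (key _ S hS).2 h5⟩, (hS y).2 h3,
      fun h => h4 ((hS z).1 h)⟩
  · rintro ⟨T, ⟨h1, h2, h3⟩, h4, h5⟩
    have hT : ∀ i : Fin n, i ∈ T ↔ (i : ℕ) ∈ T.map Fin.valEmbedding := by
      intro i
      rw [Finset.mem_map]
      exact ⟨fun hi => ⟨i, hi, rfl⟩, fun ⟨j, hj, e⟩ => by rwa [← Fin.ext e]⟩
    exact ⟨_, (hT s).1 h1, fun h => h2 ((hT t).2 h), (hT y).1 h4, fun h => h5 ((hT z).2 h),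
      (key T _ hT).1 h3⟩

/-- `E` is the scale of the input capacities. As M = E(1 - 3τ), the caps C/M are exactly x/(1 - 3τ),
and both greedy passes fit the hypotheses of `PathLP.tightMatrix`. -/
lemma tighten_spec {m : Mem} {n L J : ℕ} {s t : Fin n} {B M E : ℤ} {C : ℕ → ℕ → ℤ} {τ : ℝ}
    (hd : InstData n L s t B M C) (he : InstEnv m n L J s t B M C) (hE : 0 < E)
    (hB : (B : ℝ) = E * (1 + τ)) (hM : (M : ℝ) = E * (1 - 3 * τ)) (hτ₀ : 0 ≤ τ) (hτ : τ ≤ 1 / 4)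
    (hp : PathLP s t (scaled n C E)) (hT : m.var vTotal = 0) (hZ : m.arr aZ = fun _ => 0)
    (hr : m.arr aRank = fun _ => 0) (hu : m.arr aUp = fun _ => 0) :
    TightMatrix s t (scaled n C E) τ
      (scaled n (mat ((Code.tighten.den m).arr aZ) (n + 2)) M) := by
  classical
  have hE' : (0 : ℝ) < E := by exact_mod_cast hE
  have hMr : (0 : ℝ) < M := by exact_mod_cast hd.scale_pos
  have hcap : scaled n C M = fun u v => 1 / (1 - 3 * τ) * scaled n C E u v := by
    funext u v
    unfold scaled
    have : (1 - 3 * τ) ≠ 0 := by linarith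
    rw [hM]
    field_simp
  have hnest := hp.isNested hτ
  set 𝓝 := narrowCuts s t (scaled n C E) τ with h𝓝
  set m₁ := Code.rankAll.den m with hm₁
  have s₁ : SameBut Code.rankAll.wv Code.rankAll.wa m m₁ := Code.rankAll.sameBut m
  have e₁ := he.of_sameBut s₁ (by decide) (by decide)
  obtain ⟨r₁, r₂⟩ := rankAll_spec hd he (by simp [hr]) (by simp [hu])
  have hbelow : ∀ v : Fin n, m₁.arr aRank ((v : ℕ) : ℤ) = (below 𝓝 v).card := by
    intro v
    rw [r₁ v v.2, card_filter_mem (S := (Finset.range n).filter fun y => SepBelow n C s t B y v)]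
    · congr 2
      ext y
      simp only [Finset.mem_filter]
      tauto
    · intro i
      rw [mem_below, ← sepBelow_iff hE hB, Finset.mem_filter]
      simp
  -- `aUp` counts the vertices outside `above`. So v is in the layer after u exactly if rank(v) +
  -- up(u) = n, the test of the second pass.
  have habove : ∀ u : Fin n, m₁.arr aUp ((u : ℕ) : ℤ) + (above 𝓝 u).card = n := by
    intro u
    have h1 : (above 𝓝 u)ᶜ.card = ((Finset.range n).filter fun z => SepBelow n C s t B u z).card := by
      rw [card_filter_mem (S := (Finset.range n).filter fun z => SepBelow n C s t B u z)]
      · congr 1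
        ext y
        simp only [Finset.mem_filter]
        tauto
      · intro i
        rw [Finset.mem_compl, mem_above, not_not, ← sepBelow_iff hE hB, Finset.mem_filter]
        simp
    have h2 := Finset.card_compl_add_card (above 𝓝 u)
    rw [r₂ u u.2, ← h1]
    rw [Fintype.card_fin] at h2
    exact_mod_cast h2
  have hzero : mat (m₁.arr aZ) (n + 2) = fun _ _ => 0 := by
    rw [s₁.2 aZ (by decide), hZ]; rfl
  have hzs : scaled n (mat (m₁.arr aZ) (n + 2)) M = fun _ _ => 0 := by
    funext u v; rw [hzero]; simp [scaled]
  have z₁ : ZState n M C (fun _ _ => 0) (fun _ _ => False) m₁ := by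
    refine ⟨?_, ?_, ?_⟩
    · rw [hzero]; exact fun _ _ _ _ _ => rfl
    · rw [hzero, s₁.1 vTotal (by decide), hT]; simp [totw]
    · rw [hzs]
      refine Saturates.refl indep_zero fun u v => ?_
      unfold scaled
      have := hd.nonneg u (by omega) v (by omega)
      exact div_nonneg (by exact_mod_cast this) hMr.le
  set p₂ : Code := .pass (.get aRank (.var vy)) (.get aRank (.var vz)) with hp₂
  set m₂ := p₂.den m₁ with hm₂
  have s₂ : SameBut p₂.wv p₂.wa m₁ m₂ := p₂.sameBut m₁
  have e₂ := e₁.of_sameBut s₂ (by decide) (by decide)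
  have z₂ : ZState n M C (fun _ _ => 0) (SameLayer 𝓝) m₂ := by
    refine pass_spec hd e₁ (fun _ _ => le_rfl) z₁ fun m' y z hs hy hz => ?_
    simp only [Expr.eval, hy, hz, hs.2 aRank (by decide), hbelow]
    rw [hnest.sameLayer_iff_card, Int.natCast_inj]
  have z₃ := pass_spec (Q := NextLayer 𝓝) (a := .add (.get aRank (.var vz)) (.get aUp (.var vy)))
    (b := .var vn) hd e₂ (fun u v => z₂.sat.ge u v) z₂.restart (fun m' y z hs hy hz => by
      simp only [Expr.eval, hy, hz, hs.2 aRank (by decide), hs.2 aUp (by decide),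
        hs.1 vn (by decide), s₂.2 aRank (by decide), s₂.2 aUp (by decide), hbelow, e₂.n_eq]
      rw [hnest.nextLayer_iff_card]
      have := habove y
      omega)
  have t₂ := z₂.sat
  have t₃ := z₃.sat
  rw [hcap] at t₂ t₃
  exact hp.tightMatrix hτ₀ hτ t₂ t₃

/-! ### Reading the input -/

/-- The input that is stored in the array `aIn`. -/
structure HasInput (m : Mem) (n s t : ℕ) (p q : ℤ) (num den : ℕ → ℕ → ℤ) : Prop where
  n_eq : m.arr aIn 0 = n
  s_eq : m.arr aIn 1 = s
  t_eq : m.arr aIn 2 = t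
  p_eq : m.arr aIn 3 = p
  q_eq : m.arr aIn 4 = q
  num_eq : ∀ u < n, ∀ v < n, m.arr aIn (((u : ℤ) * n + v) * 2 + 5) = num u v
  den_eq : ∀ u < n, ∀ v < n, m.arr aIn (((u : ℤ) * n + v) * 2 + 6) = den u v

lemma HasInput.congr {m m' : Mem} {n s t : ℕ} {p q : ℤ} {num den : ℕ → ℕ → ℤ}
    (h : HasInput m n s t p q num den) (e : m'.arr aIn = m.arr aIn) :
    HasInput m' n s t p q num den := by
  obtain ⟨h1, h2, h3, h4, h5, h6, h7⟩ := h
  rw [← e] at h1 h2 h3 h4 h5 h6 h7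
  exact ⟨h1, h2, h3, h4, h5, h6, h7⟩

namespace Code

/-- Read the number of vertices and the terminals. -/
def readHeader : Code :=
  .seq (.assign vn (.get aIn (.lit 0)))
    (.seq (.assign vs (.get aIn (.lit 1)))
      (.seq (.assign vt (.get aIn (.lit 2)))
        (.seq (.assign vN (.add (.var vn) (.lit 2)))
          -- The square of n + 2 is computed as (n+2)·n + (n+2)·2 with n taken from the input array,
          -- because `vN` has just been written and may not be a second factor.
          (.seq (.assign vTries (.add (.mul (.add (.mul (.var vN) (.get aIn (.lit 0)))
              (.mul (.var vN) (.lit 2))) (.lit 2)) (.lit 1)))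
            (.assign vDen (.lit 1))))))

/-- Twice the position of the entry `(vy, vz)` in a matrix with `vn` columns, plus `c`. -/
def slot (c : ℤ) : Expr := .add (.mul (.add (.mul (.var vy) (.var vn)) (.var vz)) (.lit 2)) (.lit c)

/-- Compute a common denominator. -/
def readDen : Code :=
  .loop vy vn (.loop vz vn (.assign vDen (.mul (.var vDen) (.get aIn (slot 6)))))

/-- Compute integral capacities. -/
def readCap : Code :=
  .loop vy vn (.loop vz vn (.store aCap (ix (.var vy) (.var vz))
    (.mul (.div (.mul (.var vDen) (.get aIn (slot 5))) (.get aIn (slot 6))) (.get aIn (.lit 4)))))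

/-- Compute the threshold for narrow cuts and the scale. -/
def readScale : Code :=
  .seq (.assign vBig (.add (.mul (.var vDen) (.get aIn (.lit 4)))
      (.mul (.var vDen) (.get aIn (.lit 3)))))
    (.seq (.assign vScale (.sub (.mul (.var vDen) (.get aIn (.lit 4)))
        (.mul (.mul (.var vDen) (.get aIn (.lit 3))) (.lit 3))))
      (.seq (.assign vTop (.lit 1)) (.assign vPhases (.lit 1))))

/-- Read the matrix. -/
def readMatrix : Code := .seq readDen (.seq readCap readScale)

end Code

lemma slot_eval {m : Mem} {n y z : ℕ} (hn : m.var vn = n) (hy : m.var vy = y) (hz : m.var vz = z)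
    (c : ℤ) : (Code.slot c).eval m = ((y : ℤ) * n + z) * 2 + c := by
  simp only [Code.slot, Expr.eval, hn, hy, hz]

lemma readHeader_spec {m : Mem} {n s t : ℕ} {p q : ℤ} {num den : ℕ → ℕ → ℤ}
    (h : HasInput m n s t p q num den) :
    (Code.readHeader.den m).var vn = n ∧ (Code.readHeader.den m).var vs = s ∧
      (Code.readHeader.den m).var vt = t ∧ (Code.readHeader.den m).var vN = (n + 2 : ℕ) ∧
      (Code.readHeader.den m).var vTries = (2 * (n + 2) * (n + 2) + 1 : ℕ) ∧
      (Code.readHeader.den m).var vDen = 1 := by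
  refine ⟨?_, ?_, ?_, ?_, ?_, ?_⟩ <;>
    simp [Code.readHeader, Code.den, Expr.eval, Mem.var_setVar, Mem.arr_setVar, h.n_eq, h.s_eq,
      h.t_eq]
  ring

lemma readDen_spec {m : Mem} {n s t : ℕ} {p q : ℤ} {num den : ℕ → ℕ → ℤ}
    (h : HasInput m n s t p q num den) (hn : m.var vn = n) (hD : m.var vDen = 1)
    (hden : ∀ u < n, ∀ v < n, 0 < den u v) :
    0 < (Code.readDen.den m).var vDen ∧
      ∀ u < n, ∀ v < n, den u v ∣ (Code.readDen.den m).var vDen := by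
  have main := Code.pairs_inv (i := vy) (j := vz) (b := vn)
    (p := .assign vDen (.mul (.var vDen) (.get aIn (Code.slot 6)))) (m := m)
    (fun k l m => 0 < m.var vDen ∧ ∀ u < n, ∀ v < n, Before k l u v → den u v ∣ m.var vDen)
    hn (by decide) (by decide) (by decide)
    (fun k l m x h => by simpa [Mem.var_setVar] using h) ?_ ?_ ?_
  · exact ⟨main.1, fun u hu v hv => main.2 u hu v hv (Or.inl hu)⟩
  · rw [hD]; simp [Before]
  · intro k m hk h
    refine ⟨h.1, fun u hu v hv huv => h.2 u hu v hv ?_⟩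
    simp only [Before] at huv ⊢
    omega
  · intro k l m' hk hl hy hz hs hI
    have hn' : m'.var vn = n := (hs.1 vn (by decide)).trans hn
    have hin := h.congr (hs.2 aIn (by decide))
    have e : ((Code.assign vDen (.mul (.var vDen) (.get aIn (Code.slot 6)))).den m').var vDen =
        m'.var vDen * den k l := by
      simp only [Code.den, Expr.eval, Mem.var_setVar, if_true, slot_eval hn' hy hz,
        hin.den_eq k hk l hl]
    rw [e]
    refine ⟨mul_pos hI.1 (hden k hk l hl), fun u hu v hv huv => ?_⟩
    by_cases hkl : u = k ∧ v = l
    · obtain ⟨rfl, rfl⟩ := hkl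
      exact dvd_mul_left _ _
    · refine (hI.2 u hu v hv ?_).trans (dvd_mul_right _ _)
      simp only [Before] at huv ⊢
      omega

/-- The capacities that are computed from the input, with the common denominator `D`. -/
def capw (n : ℕ) (D q : ℤ) (num den : ℕ → ℕ → ℤ) (u v : ℕ) : ℤ :=
  if u < n ∧ v < n then D * num u v / den u v * q else 0

lemma readCap_spec {m : Mem} {n s t : ℕ} {p q : ℤ} {num den : ℕ → ℕ → ℤ}
    (h : HasInput m n s t p q num den) (hn : m.var vn = n) (hN : m.var vN = (n + 2 : ℕ))
    (h0 : m.arr aCap = fun _ => 0) :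
    ∀ u < n + 2, ∀ v < n + 2, mat ((Code.readCap.den m).arr aCap) (n + 2) u v =
      capw n (m.var vDen) q num den u v := by
  set p₁ : Code := .store aCap (ix (.var vy) (.var vz))
    (.mul (.div (.mul (.var vDen) (.get aIn (Code.slot 5))) (.get aIn (Code.slot 6)))
      (.get aIn (.lit 4))) with hp₁
  have main := Code.pairs_inv (i := vy) (j := vz) (b := vn) (p := p₁) (m := m)
    (fun k l m' => ∀ u < n + 2, ∀ v < n + 2, mat (m'.arr aCap) (n + 2) u v =
      if v < n ∧ (u < k ∨ (u = k ∧ v < l)) then capw n (m.var vDen) q num den u v else 0)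
    hn (by decide) (by decide) (by decide) (fun _ _ _ _ h => ⟨h, h⟩) ?_ ?_ ?_
  · intro u hu v hv
    rw [show (Code.readCap.den m) = (Code.loop vy vn (.loop vz vn p₁)).den m from rfl,
      main u hu v hv]
    by_cases huv : u < n ∧ v < n
    · rw [if_pos (by omega)]
    · rw [if_neg (by omega), capw, if_neg huv]
  · intro u hu v hv
    rw [h0]; simp [mat]
  · intro k m' hk h u hu v hv
    rw [h u hu v hv]
    refine if_congr ?_ rfl rfl
    omega
  · intro k l m' hk hl hy hz hs hI u hu v hv
    have hn' : m'.var vn = n := (hs.1 vn (by decide)).trans hn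
    have hN' : m'.var vN = (n + 2 : ℕ) := (hs.1 vN (by decide)).trans hN
    have hD' : m'.var vDen = m.var vDen := hs.1 vDen (by decide)
    have hin := h.congr (hs.2 aIn (by decide))
    have e : (p₁.den m').arr aCap = Function.update (m'.arr aCap) ((k : ℤ) * (n + 2 : ℕ) + l)
        (capw n (m.var vDen) q num den k l) := by
      simp only [hp₁, Code.den, Expr.eval, ix, Mem.arr_setArr, if_true, slot_eval hn' hy hz,
        hin.den_eq k hk l hl, hin.num_eq k hk l hl, hin.q_eq, hy, hz, hN', hD', capw, hk, hl,
        and_self]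
    rw [e, mat_update (by omega) hv, hI u hu v hv]
    by_cases huv : u = k ∧ v = l
    · rw [if_pos huv, if_pos (by omega), huv.1, huv.2]
    · rw [if_neg huv]
      refine if_congr ?_ rfl rfl
      omega

lemma readMatrix_spec {m : Mem} {n s t : ℕ} {p q : ℤ} {num den : ℕ → ℕ → ℤ}
    (h : HasInput m n s t p q num den) (hn : m.var vn = n) (hN : m.var vN = (n + 2 : ℕ))
    (hD : m.var vDen = 1) (hden : ∀ u < n, ∀ v < n, 0 < den u v)
    (h0 : m.arr aCap = fun _ => 0) :
    ∃ D : ℤ, 0 < D ∧ (∀ u < n, ∀ v < n, den u v ∣ D) ∧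
      (∀ u < n + 2, ∀ v < n + 2, mat ((Code.readMatrix.den m).arr aCap) (n + 2) u v =
        capw n D q num den u v) ∧
      (Code.readMatrix.den m).var vBig = D * q + D * p ∧
      (Code.readMatrix.den m).var vScale = D * q - D * p * 3 ∧
      (Code.readMatrix.den m).var vTop = 1 ∧ (Code.readMatrix.den m).var vPhases = 1 := by
  set m₁ := Code.readDen.den m with hm₁
  have s₁ : SameBut Code.readDen.wv Code.readDen.wa m m₁ := Code.readDen.sameBut m
  obtain ⟨d1, d2⟩ := readDen_spec h hn hD hden
  have h₁ := h.congr (s₁.2 aIn (by decide))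
  have c₁ := readCap_spec h₁ ((s₁.1 vn (by decide)).trans hn) ((s₁.1 vN (by decide)).trans hN)
    ((s₁.2 aCap (by decide)).trans h0)
  set m₂ := Code.readCap.den m₁ with hm₂
  have s₂ : SameBut Code.readCap.wv Code.readCap.wa m₁ m₂ := Code.readCap.sameBut m₁
  have h₂ := h₁.congr (s₂.2 aIn (by decide))
  have hD₂ : m₂.var vDen = m₁.var vDen := s₂.1 vDen (by decide)
  have hden : Code.readMatrix.den m = Code.readScale.den m₂ := rfl
  refine ⟨m₁.var vDen, d1, d2, ?_, ?_, ?_, ?_, ?_⟩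
  · rw [hden, Code.arr_den _ _ (by decide)]
    exact c₁
  all_goals
    rw [hden]
    simp [Code.readScale, Code.den, Expr.eval, Mem.var_setVar, Mem.arr_setVar, h₂.p_eq, h₂.q_eq, hD₂]

/-! ### A power of two that exceeds the threshold -/

/-- Double `vTop` until it is at least `vBig`, and count the rounds. -/
def doubling : Prog :=
  .whilePos (.sub (.var vBig) (.var vTop))
    (.seq (.assign vTop (.add (.var vTop) (.var vTop))) (.assign vPhases (.add (.var vPhases) (.lit 1))))

lemma bits_two_pow (i : ℕ) : bits ((2 : ℤ) ^ i) = i + 1 := by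
  have : ((2 : ℤ) ^ i).natAbs = 2 ^ i := by rw [Int.natAbs_pow]; rfl
  rw [bits, this, Nat.size_pow]

lemma bits_le_of_natAbs_le {x y : ℤ} (h : x.natAbs ≤ y.natAbs) : bits x ≤ bits y :=
  Nat.size_le_size h

/-- This loop is bounded by the size of `vBig`, not by a read-only variable. The induction runs over
the rounds `j` that may still occur; after `b` doublings 2^b is above a number of at most `b` bits.
-/
lemma runs_doubling {b : ℕ} (j : ℕ) : ∀ (i : ℕ) (m : Mem), i + j = b → m.var vTop = 2 ^ i →
    m.var vPhases = (i + 1 : ℕ) → 0 ≤ m.var vBig → bits (m.var vBig) ≤ b → m.Bounded (b + 1) →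
    ∃ (L c : ℕ) (m' : Mem), Runs doubling m c m' ∧ c ≤ 12 * (b + 3) * (j + 1) ∧ L ≤ b ∧
      m'.Bounded (b + 1) ∧ SameBut [vTop, vPhases] [] m m' ∧ m'.var vTop = 2 ^ L ∧
      m'.var vPhases = (L + 1 : ℕ) ∧ m.var vBig ≤ 2 ^ L := by
  induction j with
  | zero =>
    intro i m hij hT hP hB hb hm
    have hi : i = b := by omega
    subst hi
    have hle : m.var vBig ≤ 2 ^ i := by
      have h1 := bits_le_iff.1 hb
      zify at h1
      rw [abs_of_nonneg hB] at h1
      exact h1.le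
    have hno : ¬ 0 < (Expr.sub (.var vBig) (.var vTop)).eval m := by
      simp only [Expr.eval, hT]; omega
    refine ⟨i, _, m, .whileFalse hno, ?_, le_rfl, hm, SameBut.refl _ _ _, hT, hP, hle⟩
    have h1 : bits (2 ^ i - m.var vBig) ≤ bits ((2 : ℤ) ^ i) :=
      bits_le_of_natAbs_le (by omega)
    rw [← neg_sub, bits_neg] at h1
    rw [bits_two_pow] at h1
    simp only [Expr.cost, Expr.eval, hT, bits_two_pow]
    omega
  | succ j ih =>
    intro i m hij hT hP hB hb hm
    by_cases hpos : 0 < m.var vBig - 2 ^ i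
    · have h2i : (0 : ℤ) < 2 ^ i := by positivity
      set m₁ := (m.setVar vTop (2 ^ (i + 1))).setVar vPhases ((i + 1 + 1 : ℕ) : ℤ) with hm₁
      have hP' : bits (((i + 1 + 1 : ℕ) : ℤ)) ≤ b + 1 := bits_le_of_le (by positivity) (by
        push_cast; omega)
      have hm₁b : m₁.Bounded (b + 1) :=
        (hm.setVar _ (by rw [bits_two_pow]; omega)).setVar _ hP'
      have s₁ : SameBut [vTop, vPhases] [] m m₁ := by
        refine ⟨fun v hv => ?_, fun _ _ => rfl⟩
        simp only [List.mem_cons, List.not_mem_nil, or_false, not_or] at hv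
        simp [hm₁, Mem.var_setVar, hv.1, hv.2]
      have hB₁ : m₁.var vBig = m.var vBig := s₁.1 vBig (by decide)
      obtain ⟨L, c, m', r, hc, hL, hb', s', t', p', q'⟩ := ih (i + 1) m₁ (by omega)
        (by simp [hm₁, Mem.var_setVar]) (by simp [hm₁, Mem.var_setVar]) (by rw [hB₁]; exact hB)
        (by rw [hB₁]; exact hb) hm₁b
      have hyes : 0 < (Expr.sub (.var vBig) (.var vTop)).eval m := by
        simp only [Expr.eval, hT]; exact hpos
      have r1 := Runs.seq (Runs.assign m vTop (.add (.var vTop) (.var vTop)))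
        (Runs.assign (m.setVar vTop ((Expr.add (.var vTop) (.var vTop)).eval m)) vPhases
          (.add (.var vPhases) (.lit 1)))
      have e1 : (Expr.add (.var vTop) (.var vTop)).eval m = 2 ^ (i + 1) := by
        simp only [Expr.eval, hT]; ring
      have e2 : (Expr.add (.var vPhases) (.lit 1)).eval (m.setVar vTop (2 ^ (i + 1))) =
          ((i + 1 + 1 : ℕ) : ℤ) := by
        simp [Expr.eval, Mem.var_setVar, hP]
      rw [e1, e2] at r1
      refine ⟨L, _, m', .whileTrue hyes r1 r, ?_, hL, hb', ?_, t', p', by rw [← hB₁]; exact q'⟩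
      · have b1 : bits (m.var vBig - 2 ^ i) ≤ bits (m.var vBig) := bits_le_of_natAbs_le (by omega)
        have b2 : bits (((i + 1 : ℕ) : ℤ)) ≤ b + 1 :=
          bits_le_of_le (by positivity) (by push_cast; omega)
        have b3 : bits (((i + 1 : ℕ) : ℤ) + 1) ≤ b + 1 := by exact_mod_cast hP'
        have b4 : bits ((2 : ℤ) ^ i + 2 ^ i) = i + 2 := by
          rw [← mul_two, ← pow_succ, bits_two_pow]
        have b5 : bits 1 = 1 := by decide
        have hTP : (m.setVar vTop (2 ^ (i + 1))).var vPhases = ((i + 1 : ℕ) : ℤ) := by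
          simp [Mem.var_setVar, hP]
        simp only [Expr.cost, Expr.eval, hT, bits_two_pow, hTP, b4, b5]
        have : 12 * (b + 3) * (j + 1 + 1) = 12 * (b + 3) * (j + 1) + 12 * (b + 3) := by ring
        omega
      · exact ⟨fun v hv => (s'.1 v hv).trans (s₁.1 v hv), fun a ha => (s'.2 a ha).trans (s₁.2 a ha)⟩
    · have hno : ¬ 0 < (Expr.sub (.var vBig) (.var vTop)).eval m := by
        simp only [Expr.eval, hT]; exact hpos
      refine ⟨i, _, m, .whileFalse hno, ?_, by omega, hm, SameBut.refl _ _ _, hT, hP, by omega⟩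
      have h1 : bits (2 ^ i - m.var vBig) ≤ bits ((2 : ℤ) ^ i) :=
        bits_le_of_natAbs_le (by omega)
      rw [← neg_sub, bits_neg] at h1
      rw [bits_two_pow] at h1
      simp only [Expr.cost, Expr.eval, hT, bits_two_pow]
      have : 12 * (b + 3) * (j + 1 + 1) = 12 * (b + 3) * (j + 1) + 12 * (b + 3) := by ring
      omega

/-! ### Encodings as matrices -/

lemma getElem?_flatMap_of_length {α β : Type*} {f : α → List β} {k : ℕ}
    (hf : ∀ a, (f a).length = k) : ∀ (l : List α) (i : ℕ) (hi : i < l.length) (j : ℕ), j < k →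
    (l.flatMap f)[i * k + j]? = (f l[i])[j]?
  | a :: l, 0, _, j, hj => by
    rw [List.flatMap_cons, List.getElem?_append_left (by rw [hf]; omega)]
    simp
  | a :: l, i + 1, hi, j, hj => by
    have h1 : (i + 1) * k + j = k + (i * k + j) := by ring
    rw [List.flatMap_cons, List.getElem?_append_right (by rw [hf]; omega), hf, h1,
      Nat.add_sub_cancel_left, getElem?_flatMap_of_length hf l i (by simpa using hi) j hj]
    simp

lemma length_flatMap_of_length {α β : Type*} {f : α → List β} {k : ℕ}
    (hf : ∀ a, (f a).length = k) (l : List α) : (l.flatMap f).length = l.length * k := by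
  induction l with
  | nil => simp
  | cons a l ih => rw [List.flatMap_cons, List.length_append, hf, ih, List.length_cons]; ring

/-- The matrix of fractions with zero diagonal. -/
def fracAt {n : ℕ} (x : Arc (Fin n) → Frac) (u v : Fin n) : Frac :=
  if h : u ≠ v then x ⟨(u, v), h⟩ else ⟨0, 1, one_pos⟩

lemma encodeVec_eq {n : ℕ} (x : Arc (Fin n) → Frac) :
    encodeVec x = (List.finRange n).flatMap fun u => (List.finRange n).flatMap fun v =>
      [(fracAt x u v).num, (fracAt x u v).den] := by
  unfold encodeVec fracAt
  refine congrArg (fun f => (List.finRange n).flatMap f) (funext fun u => ?_)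
  refine congrArg (fun f => (List.finRange n).flatMap f) (funext fun v => ?_)
  split_ifs <;> rfl

lemma length_encodeVec {n : ℕ} (x : Arc (Fin n) → Frac) : (encodeVec x).length = n * (n * 2) := by
  rw [encodeVec_eq, length_flatMap_of_length (k := n * 2), List.length_finRange]
  intro u
  rw [length_flatMap_of_length (k := 2), List.length_finRange]
  intro v
  rfl

lemma encodeVec_getElem? {n : ℕ} (x : Arc (Fin n) → Frac) (u v : Fin n) {e : ℕ} (he : e < 2) :
    (encodeVec x)[((u : ℕ) * n + v) * 2 + e]? =
      [(fracAt x u v).num, (fracAt x u v).den][e]? := by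
  have h1 : ((u : ℕ) * n + v) * 2 + e = u * (n * 2) + (v * 2 + e) := by ring
  rw [encodeVec_eq, h1, getElem?_flatMap_of_length (k := n * 2) _ _ _ (by simp),
    getElem?_flatMap_of_length (k := 2) _ _ _ (by simp) _ he]
  · simp
  · intro v; rfl
  · have := v.2; omega
  · intro u
    rw [length_flatMap_of_length (k := 2), List.length_finRange]
    intro v
    rfl

lemma toMat_val {n : ℕ} (x : Arc (Fin n) → Frac) (u v : Fin n) :
    toMat (fun a => (x a).val) u v = (fracAt x u v).val := by
  unfold toMat fracAt
  split_ifs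
  · rfl
  · simp [Frac.val]

/-! ### The initial memory on an encoded input -/

lemma init_arr_aIn (l : List ℤ) (j : ℕ) : (Mem.init l).arr aIn j = l.getD j 0 := by
  simp [Mem.init]

lemma init_arr_of_ne (l : List ℤ) {a : ℕ} (ha : a ≠ 0) : (Mem.init l).arr a = fun _ => 0 := by
  funext j; simp [Mem.init, ha]

lemma init_var_of_ne (l : List ℤ) {i : ℕ} (hi : i ≠ 0) : (Mem.init l).var i = 0 := by
  simp [Mem.init, hi]

/-- A function on `Fin n` extended to the natural numbers. -/
def extendFin {n : ℕ} (f : Fin n → Fin n → ℤ) (u v : ℕ) : ℤ :=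
  if h : u < n ∧ v < n then f ⟨u, h.1⟩ ⟨v, h.2⟩ else 0

lemma extendFin_apply {n : ℕ} (f : Fin n → Fin n → ℤ) {u v : ℕ} (hu : u < n) (hv : v < n) :
    extendFin f u v = f ⟨u, hu⟩ ⟨v, hv⟩ := dif_pos ⟨hu, hv⟩

lemma hasInput_init {n : ℕ} (s t : Fin n) (τ : Frac) (x : Arc (Fin n) → Frac) :
    HasInput (Mem.init (encodeInput s t τ x)) n s t τ.num τ.den
      (extendFin fun u v => (fracAt x u v).num) (extendFin fun u v => (fracAt x u v).den) := by
  have key : ∀ (u v : Fin n) (e : ℕ), e < 2 →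
      (Mem.init (encodeInput s t τ x)).arr aIn ((((u : ℕ) : ℤ) * n + (v : ℕ)) * 2 + 5 + e) =
      [(fracAt x u v).num, (fracAt x u v).den].getD e 0 := by
    intro u v e he
    have h1 : (((u : ℕ) : ℤ) * n + (v : ℕ)) * 2 + 5 + e =
        ((5 + (((u : ℕ) * n + v) * 2 + e) : ℕ) : ℤ) := by push_cast; ring
    rw [h1, init_arr_aIn, List.getD_eq_getElem?_getD, encodeInput,
      List.getElem?_append_right (by simp), List.getD_eq_getElem?_getD]
    simp only [List.length_cons, List.length_nil]
    rw [show 5 + (((u : ℕ) * n + v) * 2 + e) - (0 + 1 + 1 + 1 + 1 + 1) =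
      ((u : ℕ) * n + v) * 2 + e by omega, encodeVec_getElem? x u v he]
  refine ⟨?_, ?_, ?_, ?_, ?_, fun u hu v hv => ?_, fun u hu v hv => ?_⟩
  · exact init_arr_aIn _ 0
  · exact init_arr_aIn _ 1
  · exact init_arr_aIn _ 2
  · exact init_arr_aIn _ 3
  · exact init_arr_aIn _ 4
  · rw [extendFin_apply _ hu hv]
    simpa using key ⟨u, hu⟩ ⟨v, hv⟩ 0 (by omega)
  · rw [extendFin_apply _ hu hv]
    have := key ⟨u, hu⟩ ⟨v, hv⟩ 1 (by omega)
    rw [add_assoc] at this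
    simpa using this

lemma bits_le_inputSize {l : List ℤ} {z : ℤ} (h : z ∈ l) : bits z ≤ inputSize l := by
  have : 1 + bits z ≤ inputSize l :=
    List.single_le_sum (by simp) _ (List.mem_map.2 ⟨z, h, rfl⟩)
  omega

lemma length_le_inputSize (l : List ℤ) : l.length ≤ inputSize l := by
  unfold inputSize
  induction l with
  | nil => simp
  | cons a l ih => simp only [List.map_cons, List.sum_cons, List.length_cons]; omega

lemma init_bounded (l : List ℤ) : (Mem.init l).Bounded (inputSize l) := by
  have h0 : bits 0 = 0 := by simp [bits]
  refine ⟨fun i => ?_, fun a j => ?_⟩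
  · by_cases hi : i = 0
    · subst hi
      refine bits_le_of_le (by simp [Mem.init]) ?_
      simpa [Mem.init] using length_le_inputSize l
    · rw [init_var_of_ne l hi, h0]; omega
  · simp only [Mem.init]
    split_ifs with h
    · by_cases hj : j.toNat < l.length
      · rw [List.getD_eq_getElem _ _ hj]
        exact bits_le_inputSize (List.getElem_mem hj)
      · rw [List.getD_eq_default _ _ (by omega), h0]; omega
    · rw [h0]; omega

/-! ### Writing the output -/

/-- Write the entries of `aZ` as fractions with the denominator `vScale`. -/
def Code.writeOut : Code :=
  .seq (.loop vy vn (.loop vz vn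
    (.seq (.store aOut (slot 0) (.get aZ (ix (.var vy) (.var vz))))
      -- The encoding prescribes 0/1 on the diagonal, so the denominator there is 1; two positivity
      -- tests detect y = z.
      (.ite (.sub (.var vy) (.var vz)) (.store aOut (slot 1) (.var vScale))
        (.ite (.sub (.var vz) (.var vy)) (.store aOut (slot 1) (.var vScale))
          (.store aOut (slot 1) (.lit 1)))))))
    -- The output has the length of the input without its five header entries.
    (.assign vLen (.sub (.var vLen) (.lit 5)))

lemma writeOut_spec {m : Mem} {n : ℕ} {M : ℤ} (hn : m.var vn = n) (hN : m.var vN = (n + 2 : ℕ))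
    (hM : m.var vScale = M) :
    (Code.writeOut.den m).var vLen = m.var vLen - 5 ∧
    ∀ u < n, ∀ v < n,
      (Code.writeOut.den m).arr aOut (((u : ℤ) * n + v) * 2) = mat (m.arr aZ) (n + 2) u v ∧
      (Code.writeOut.den m).arr aOut (((u : ℤ) * n + v) * 2 + 1) = if u = v then 1 else M := by
  set p : Code := .seq (.store aOut (Code.slot 0) (.get aZ (ix (.var vy) (.var vz))))
      (.ite (.sub (.var vy) (.var vz)) (.store aOut (Code.slot 1) (.var vScale))
        (.ite (.sub (.var vz) (.var vy)) (.store aOut (Code.slot 1) (.var vScale))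
          (.store aOut (Code.slot 1) (.lit 1)))) with hp
  set m₁ := (Code.loop vy vn (.loop vz vn p)).den m with hm₁
  have hden : Code.writeOut.den m = m₁.setVar vLen (m₁.var vLen - 5) := rfl
  have s₁ : SameBut (Code.loop vy vn (.loop vz vn p)).wv (Code.loop vy vn (.loop vz vn p)).wa m m₁ :=
    Code.sameBut _ m
  have main := Code.pairs_inv (i := vy) (j := vz) (b := vn) (p := p) (m := m)
    (fun k l m' => ∀ u < n, ∀ v < n, Before k l u v →
      m'.arr aOut (((u : ℤ) * n + v) * 2) = mat (m.arr aZ) (n + 2) u v ∧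
      m'.arr aOut (((u : ℤ) * n + v) * 2 + 1) = if u = v then 1 else M)
    hn (by decide) (by decide) (by decide) (fun _ _ _ _ h => ⟨h, h⟩) (by simp [Before]) ?_ ?_
  · refine ⟨?_, fun u hu v hv => ?_⟩
    · rw [hden, Mem.var_setVar, if_pos rfl, s₁.1 vLen (by decide)]
    · rw [hden, Mem.arr_setVar]
      exact main u hu v hv (Or.inl hu)
  · intro k m' hk h u hu v hv huv
    refine h u hu v hv ?_
    simp only [Before] at huv ⊢
    omega
  · intro k l m' hk hl hy hz hs hI
    have hn' : m'.var vn = n := (hs.1 vn (by decide)).trans hn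
    have hN' : m'.var vN = (n + 2 : ℕ) := (hs.1 vN (by decide)).trans hN
    have hM' : m'.var vScale = M := (hs.1 vScale (by decide)).trans hM
    have hZ' : m'.arr aZ = m.arr aZ := hs.2 aZ (by decide)
    have e : (p.den m').arr aOut = Function.update (Function.update (m'.arr aOut)
        (((k : ℤ) * n + l) * 2) (mat (m.arr aZ) (n + 2) k l)) (((k : ℤ) * n + l) * 2 + 1)
        (if k = l then 1 else M) := by
      set m₂ := (Code.store aOut (Code.slot 0) (.get aZ (ix (.var vy) (.var vz)))).den m' with hm₂
      have e₂ : m₂.arr aOut = Function.update (m'.arr aOut)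
          (((k : ℤ) * n + l) * 2) (mat (m.arr aZ) (n + 2) k l) := by
        simp only [hm₂, Code.den, Expr.eval, ix, hy, hz, hN', hZ', Mem.arr_setArr, if_true,
          slot_eval hn' hy hz, add_zero]
        rfl
      have hy₂ : m₂.var vy = k := hy
      have hz₂ : m₂.var vz = l := hz
      have hM₂ : m₂.var vScale = M := hM'
      have hd : p.den m' = (Code.ite (.sub (.var vy) (.var vz)) (.store aOut (Code.slot 1) (.var vScale))
        (.ite (.sub (.var vz) (.var vy)) (.store aOut (Code.slot 1) (.var vScale))
          (.store aOut (Code.slot 1) (.lit 1)))).den m₂ := rfl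
      have hs₂ : (Code.slot 1).eval m₂ = ((k : ℤ) * n + l) * 2 + 1 := slot_eval hn' hy hz 1
      rw [hd]
      simp only [Code.den, Expr.eval, hy₂, hz₂, hM₂, hs₂]
      rcases lt_trichotomy k l with hkl | hkl | hkl
      · rw [if_neg (by omega), if_pos (by omega), if_neg (by omega), Mem.arr_setArr, if_pos rfl, e₂]
      · rw [if_neg (by omega), if_neg (by omega), if_pos (by omega), Mem.arr_setArr, if_pos rfl, e₂]
      · rw [if_pos (by omega), if_neg (by omega), Mem.arr_setArr, if_pos rfl, e₂]
    intro u hu v hv huv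
    rw [e]
    by_cases hkl : u = k ∧ v = l
    · obtain ⟨rfl, rfl⟩ := hkl
      rw [Function.update_of_ne (by omega), Function.update_self, Function.update_self]
      exact ⟨rfl, rfl⟩
    · have hne : ((u : ℤ) * n + v) ≠ (k : ℤ) * n + l := fun h => hkl (index_inj hv hl h)
      rw [Function.update_of_ne (by omega), Function.update_of_ne (by omega),
        Function.update_of_ne (by omega), Function.update_of_ne (by omega)]
      refine hI u hu v hv ?_
      simp only [Before] at huv ⊢
      omega

lemma hasOutput_encodeVec {m : Mem} {n : ℕ} (z : Arc (Fin n) → Frac)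
    (hlen : m.var vLen = (n * (n * 2) : ℕ))
    (hnum : ∀ u v : Fin n, m.arr aOut ((((u : ℕ) : ℤ) * n + (v : ℕ)) * 2) = (fracAt z u v).num)
    (hden : ∀ u v : Fin n, m.arr aOut ((((u : ℕ) : ℤ) * n + (v : ℕ)) * 2 + 1) = (fracAt z u v).den) :
    m.HasOutput (encodeVec z) := by
  refine ⟨by rw [length_encodeVec]; exact hlen, fun i hi => ?_⟩
  have hi' := hi
  rw [length_encodeVec] at hi'
  have hn : 0 < n := by
    rcases Nat.eq_zero_or_pos n with rfl | h
    · simp at hi'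
    · exact h
  obtain ⟨u, v, e, he, rfl⟩ : ∃ (u v : Fin n) (e : ℕ), e < 2 ∧ i = ((u : ℕ) * n + v) * 2 + e := by
    refine ⟨⟨i / 2 / n, ?_⟩, ⟨i / 2 % n, Nat.mod_lt _ hn⟩, i % 2, Nat.mod_lt _ (by omega), ?_⟩
    · rw [Nat.div_lt_iff_lt_mul hn, Nat.div_lt_iff_lt_mul (by omega), mul_assoc]; exact hi'
    · have h1 := Nat.div_add_mod' (i / 2) n
      have h2 := Nat.div_add_mod' i 2
      simp only
      rw [h1, h2]
  have h1 := encodeVec_getElem? z u v he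
  rw [List.getElem?_eq_getElem hi] at h1
  interval_cases e
  · have : (encodeVec z)[((u : ℕ) * n + v) * 2 + 0] = (fracAt z u v).num := by simpa using h1
    rw [this, ← hnum]
    push_cast
    rw [add_zero]
  · have : (encodeVec z)[((u : ℕ) * n + v) * 2 + 1] = (fracAt z u v).den := by simpa using h1
    rw [this, ← hden]
    push_cast
    rfl

/-! ### The algorithm -/

/-- The main part of the algorithm, including the output. -/
def Code.solve : Code := .seq .tighten .writeOut

/-- The whole algorithm. -/
def tightenProg : Prog :=
  .seq Code.readHeader.compile (.seq Code.readMatrix.compile (.seq doubling Code.solve.compile))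

/-- A bound for the size of the numbers after reading the input, as a polynomial in the input
size. -/
noncomputable def readSize (d₁ d₂ : ℕ) : Polynomial ℕ :=
  Polynomial.X + (Polynomial.X + 2) ^ d₁ + (Polynomial.X + 4) ^ d₂

/-- A bound for the running time, as a polynomial in the input size. -/
noncomputable def timeBound (d₁ d₂ d₃ : ℕ) : Polynomial ℕ :=
  (Polynomial.X + 1) * (Polynomial.X + 2) ^ d₁ +
    ((Polynomial.X + (Polynomial.X + 2) ^ d₁ + 1) * (Polynomial.X + 4) ^ d₂ +
      (12 * (readSize d₁ d₂ + 3) * (readSize d₁ d₂ + 1) +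
        (readSize d₁ d₂ + 1 + 1) *
          (readSize d₁ d₂ + 2 * (Polynomial.X + 2) * (Polynomial.X + 2) + 2 + 2) ^ d₃))

/-- The memory in which the main part of the algorithm starts. -/
structure Ready (m₀ m : Mem) (n s t : ℕ) (p q : ℤ) (num den : ℕ → ℕ → ℤ) (D : ℤ) (L : ℕ) : Prop where
  den_pos : 0 < D
  dvd : ∀ u < n, ∀ v < n, den u v ∣ D
  env : InstEnv m n L (2 * (n + 2) * (n + 2) + 1) s t (D * q + D * p) (D * q - D * p * 3)
    (capw n D q num den)
  big_le : D * q + D * p ≤ 2 ^ L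
  len : m.var vLen = m₀.var vLen
  total : m.var vTotal = m₀.var vTotal
  mat_eq : m.arr aZ = m₀.arr aZ
  rank_eq : m.arr aRank = m₀.arr aRank
  up_eq : m.arr aUp = m₀.arr aUp

/-- The semantics and the cost of the algorithm. -/
lemma exists_runs_tightenProg : ∃ d₁ d₂ d₃ : ℕ, ∀ {l : List ℤ} {n s t : ℕ} {p q : ℤ}
    {num den : ℕ → ℕ → ℤ}, HasInput (Mem.init l) n s t p q num den → n ≤ inputSize l →
    (∀ u < n, ∀ v < n, 0 < den u v) → 0 ≤ p → 0 ≤ q →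
    ∃ (D : ℤ) (L c : ℕ) (m : Mem), Ready (Mem.init l) m n s t p q num den D L ∧
      Runs tightenProg (Mem.init l) c (Code.solve.den m) ∧
      c ≤ (timeBound d₁ d₂ d₃).eval (inputSize l) := by
  -- Three stages, since a variable can count as read-only only after the stage that computes it: n
  -- and N after the header, and the numbers of phases and tries for the main part.
  obtain ⟨d₁, hd₁⟩ := Code.exists_polyBound [] Code.readHeader (by decide)
  obtain ⟨d₂, hd₂⟩ := Code.exists_polyBound [vn, vN] Code.readMatrix (by decide)
  obtain ⟨d₃, hd₃⟩ := Code.exists_polyBound [vn, vN, vPhases, vTries] Code.solve (by decide)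
  refine ⟨d₁, d₂, d₃, fun {l n s t p q num den} hin hnl hden hp hq => ?_⟩
  set I := inputSize l with hI
  set m₀ := Mem.init l with hm₀
  have hb₀ : m₀.Bounded I := init_bounded l
  obtain ⟨c₁, r₁, hc₁, hb₁⟩ := hd₁ I I m₀ ⟨by simp, fun j => hb₀.2 0 j⟩ hb₀
  obtain ⟨n₁, s₁, t₁, N₁, J₁, D₁⟩ := readHeader_spec hin
  have w₁ : SameBut Code.readHeader.wv Code.readHeader.wa m₀ (Code.readHeader.den m₀) :=
    Code.sameBut _ _
  set m₁ := Code.readHeader.den m₀ with hm₁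
  have hin₁ : HasInput m₁ n s t p q num den := hin.congr (w₁.2 aIn (by decide))
  obtain ⟨c₂, r₂, hc₂, hb₂⟩ := hd₂ (I + 2) _ m₁ (by
    refine ⟨fun i hi => ?_, fun j => ?_⟩
    · simp only [List.mem_cons, List.not_mem_nil, or_false] at hi
      rcases hi with rfl | rfl
      · rw [n₁]; push_cast; omega
      · rw [N₁]; push_cast; omega
    · rw [w₁.2 aIn (by decide)]; exact (hb₀.2 0 j).trans (by omega)) hb₁
  obtain ⟨D, hD, hdvd, cap₂, B₂, M₂, T₂, P₂⟩ := readMatrix_spec hin₁ n₁ N₁ D₁ hden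
    ((w₁.2 aCap (by decide)).trans (init_arr_of_ne l (by decide)))
  have w₂ : SameBut Code.readMatrix.wv Code.readMatrix.wa m₁ (Code.readMatrix.den m₁) :=
    Code.sameBut _ _
  set m₂ := Code.readMatrix.den m₁ with hm₂
  -- The number of bits after both reading stages. It bounds the size of the threshold and hence the
  -- number of scaling phases.
  set b := I + (I + 2) ^ d₁ + (I + 2 + 2) ^ d₂ with hb
  obtain ⟨L, c₃, m₃, r₃, hc₃, hL, hb₃, w₃, T₃, P₃, B₃⟩ := runs_doubling (b := b) b 0 m₂ (by omega)
    (by rw [T₂]; norm_num) (by rw [P₂]; norm_num) (by rw [B₂]; positivity) (hb₂.1 vBig)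
    (hb₂.mono (by omega))
  have n₃ : m₃.var vn = n := (w₃.1 vn (by decide)).trans ((w₂.1 vn (by decide)).trans n₁)
  have N₃ : m₃.var vN = (n + 2 : ℕ) := (w₃.1 vN (by decide)).trans ((w₂.1 vN (by decide)).trans N₁)
  have J₃ : m₃.var vTries = (2 * (n + 2) * (n + 2) + 1 : ℕ) :=
    (w₃.1 vTries (by decide)).trans ((w₂.1 vTries (by decide)).trans J₁)
  have hready : Ready m₀ m₃ n s t p q num den D L := by
    refine ⟨hD, hdvd, ⟨⟨n₃, N₃, P₃, J₃, T₃, le_rfl⟩, ?_, ?_, ?_, ?_, ?_⟩, by rw [← B₂]; exact B₃,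
      ?_, ?_, ?_, ?_, ?_⟩
    · exact (w₃.1 vs (by decide)).trans ((w₂.1 vs (by decide)).trans s₁)
    · exact (w₃.1 vt (by decide)).trans ((w₂.1 vt (by decide)).trans t₁)
    · exact (w₃.1 vBig (by decide)).trans B₂
    · exact (w₃.1 vScale (by decide)).trans M₂
    · rw [w₃.2 aCap (by decide)]; exact cap₂
    · exact (w₃.1 vLen (by decide)).trans ((w₂.1 vLen (by decide)).trans (w₁.1 vLen (by decide)))
    · exact (w₃.1 vTotal (by decide)).trans
        ((w₂.1 vTotal (by decide)).trans (w₁.1 vTotal (by decide)))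
    · exact (w₃.2 aZ (by decide)).trans ((w₂.2 aZ (by decide)).trans (w₁.2 aZ (by decide)))
    · exact (w₃.2 aRank (by decide)).trans ((w₂.2 aRank (by decide)).trans (w₁.2 aRank (by decide)))
    · exact (w₃.2 aUp (by decide)).trans ((w₂.2 aUp (by decide)).trans (w₁.2 aUp (by decide)))
  have hsq : 2 * (n + 2) * (n + 2) ≤ 2 * (I + 2) * (I + 2) :=
    Nat.mul_le_mul (by omega) (by omega)
  have hI₂ : n + 2 ≤ 2 * (I + 2) * (I + 2) := by nlinarith
  obtain ⟨c₄, r₄, hc₄, -⟩ := hd₃ (b + 2 * (I + 2) * (I + 2) + 2) _ m₃ (by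
    refine ⟨fun i hi => ?_, fun j => ?_⟩
    · simp only [List.mem_cons, List.not_mem_nil, or_false] at hi
      rcases hi with rfl | rfl | rfl | rfl
      · rw [n₃]; norm_cast; omega
      · rw [N₃]; norm_cast; omega
      · rw [P₃]; norm_cast; omega
      · rw [J₃]; norm_cast; omega
    · exact (hb₃.2 0 j).trans (by omega)) hb₃
  refine ⟨D, L, _, m₃, hready, .seq r₁ (.seq r₂ (.seq r₃ r₄)), ?_⟩
  have eb : (readSize d₁ d₂).eval I = b := by simp [readSize, hb, show I + 2 + 2 = I + 4 from rfl]
  simp only [timeBound, Polynomial.eval_add, Polynomial.eval_mul, Polynomial.eval_pow, eb,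
    Polynomial.eval_X, Polynomial.eval_one, Polynomial.eval_ofNat]
  exact add_le_add hc₁ (add_le_add hc₂ (add_le_add hc₃ hc₄))

/-- The algorithm solves the problem in polynomial time. -/
theorem exists_computes_isTightened : ∃ (p : Prog) (P : Polynomial ℕ),
    ∀ (n : ℕ) (s t : Fin n) (x : Arc (Fin n) → Frac) (τ : Frac),
      IsFeasible s t (fun a => (x a).val) → 0 ≤ τ.val → τ.val ≤ 1 / 4 →
      ∃ z : Arc (Fin n) → Frac,
        Computes p (encodeInput s t τ x) (encodeVec z) (P.eval (inputSize (encodeInput s t τ x))) ∧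
        IsTightened s t (fun a => (x a).val) τ.val (fun a => (z a).val) := by
  obtain ⟨d₁, d₂, d₃, H⟩ := exists_runs_tightenProg
  refine ⟨tightenProg, timeBound d₁ d₂ d₃, fun n s t x τ hx hτ₀ hτ => ?_⟩
  have hq : (0 : ℝ) < τ.den := by exact_mod_cast τ.den_pos
  have hp₀ : 0 ≤ τ.num := by
    rw [Frac.val, le_div_iff₀ hq, zero_mul] at hτ₀
    exact_mod_cast hτ₀
  have hpq : 4 * τ.num ≤ τ.den := by
    rw [Frac.val, div_le_iff₀ hq] at hτ
    have : (4 : ℝ) * τ.num ≤ τ.den := by linarith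
    exact_mod_cast this
  have hpath := hx.pathLP
  have hnum : ∀ u v, 0 ≤ (fracAt x u v).num := by
    intro u v
    have h1 := hpath.nonneg u v
    have h2 : (0 : ℝ) < (fracAt x u v).den := by exact_mod_cast (fracAt x u v).den_pos
    rw [toMat_val, Frac.val, le_div_iff₀ h2, zero_mul] at h1
    exact_mod_cast h1
  have hlen : (encodeInput s t τ x).length = n * (n * 2) + 5 := by
    rw [encodeInput, List.length_append, length_encodeVec, add_comm]; rfl
  have hnI : n ≤ inputSize (encodeInput s t τ x) := by
    have h1 := length_le_inputSize (encodeInput s t τ x)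
    have h2 : n ≤ n * (n * 2) + 5 := by nlinarith
    omega
  obtain ⟨D, L, c, m, hr, hruns, hc⟩ := H (hasInput_init s t τ x) hnI
    (fun u hu v hv => by rw [extendFin_apply _ hu hv]; exact (fracAt x _ _).den_pos) hp₀
    τ.den_pos.le
  set num := extendFin fun u v => (fracAt x u v).num with hnum'
  set den := extendFin fun u v => (fracAt x u v).den with hden'
  set C := capw n D τ.den num den with hC
  have hD := hr.den_pos
  have hE : 0 < D * τ.den := mul_pos hD τ.den_pos
  have hDp : 0 ≤ D * τ.num := mul_nonneg hD.le hp₀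
  -- D(q - 3p) is positive because 4p ≤ q, that is, because τ ≤ 1/4.
  have hM : 0 < D * τ.den - D * τ.num * 3 := by nlinarith [τ.den_pos]
  have hd : InstData n L s t (D * τ.den + D * τ.num) (D * τ.den - D * τ.num * 3) C := by
    refine ⟨fun u _ v _ huv => if_neg (by omega), fun u _ v _ => ?_, hM, by linarith, hr.big_le,
      s.2, t.2⟩
    rw [hC, capw]
    split_ifs with huv
    · rw [hnum', hden', extendFin_apply _ huv.1 huv.2, extendFin_apply _ huv.1 huv.2]
      exact mul_nonneg (Int.ediv_nonneg (mul_nonneg hD.le (hnum _ _)) (fracAt x _ _).den_pos.le)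
        τ.den_pos.le
    · exact le_rfl
  have hX : scaled n C (D * τ.den) = toMat fun a => (x a).val := by
    funext u v
    rw [toMat_val, Frac.val, scaled, hC, capw, if_pos ⟨u.2, v.2⟩, hnum', hden',
      extendFin_apply _ u.2 v.2, extendFin_apply _ u.2 v.2]
    have h1 := hr.dvd u u.2 v v.2
    rw [hden', extendFin_apply _ u.2 v.2] at h1
    obtain ⟨k, hk⟩ := h1
    have h2 := (fracAt x u v).den_pos
    have h3 : (0 : ℝ) < (fracAt x u v).den := by exact_mod_cast h2
    have h4 : (0 : ℝ) < D := by exact_mod_cast hD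
    have h5 : (D : ℝ) = (fracAt x u v).den * k := by exact_mod_cast hk
    -- The integer division of the program is exact here, since the denominator divides D.
    have h6 : D * (fracAt x u v).num / (fracAt x u v).den = k * (fracAt x u v).num := by
      rw [hk, mul_assoc, Int.mul_ediv_cancel_left _ h2.ne']
    simp only [Fin.eta]
    rw [h6]
    push_cast
    rw [div_eq_div_iff (by positivity) h3.ne', h5]
    ring
  have hB : ((D * τ.den + D * τ.num : ℤ) : ℝ) = (D * τ.den : ℤ) * (1 + τ.val) := by
    rw [Frac.val]; push_cast; field_simp
  have hM' : ((D * τ.den - D * τ.num * 3 : ℤ) : ℝ) = (D * τ.den : ℤ) * (1 - 3 * τ.val) := by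
    rw [Frac.val]; push_cast; field_simp
  have htight := tighten_spec hd hr.env hE hB hM' hτ₀ hτ (by rw [hX]; exact hpath)
    (hr.total.trans (init_var_of_ne _ (by decide))) (hr.mat_eq.trans (init_arr_of_ne _ (by decide)))
    (hr.rank_eq.trans (init_arr_of_ne _ (by decide))) (hr.up_eq.trans (init_arr_of_ne _ (by decide)))
  rw [hX] at htight
  set m₁ := Code.tighten.den m with hm₁
  have w₁ : SameBut Code.tighten.wv Code.tighten.wa m m₁ := Code.sameBut _ _
  have e₁ := hr.env.of_sameBut w₁ (by decide) (by decide)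
  obtain ⟨o₁, o₂⟩ := writeOut_spec e₁.n_eq e₁.N_eq e₁.scale
  set Z := mat (m₁.arr aZ) (n + 2) with hZ
  have hne : Nonempty (Fin n) := ⟨s⟩
  refine ⟨fun a => ⟨Z a.1.1 a.1.2, _, hM⟩, ⟨c, _, hruns, ?_, hc⟩, htight.isTightened⟩
  -- The program writes the diagonal of the matrix as it finds it; the zero diagonal of x keeps it
  -- at the 0 that the encoding expects.
  have hdiag : ∀ v : Fin n, Z v v = 0 := by
    intro v
    have h1 := htight.le v v
    have h2 := htight.nonneg v v
    rw [toMat_self, mul_zero] at h1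
    have h3 := le_antisymm h1 h2
    rw [scaled, div_eq_zero_iff] at h3
    rcases h3 with h3 | h3
    · exact_mod_cast h3
    · exact absurd (by exact_mod_cast h3) hM.ne'
  refine hasOutput_encodeVec _ ?_ (fun u v => ?_) fun u v => ?_
  · rw [show Code.solve.den m = Code.writeOut.den m₁ from rfl, o₁, w₁.1 vLen (by decide), hr.len]
    simp only [Mem.init, if_true, hlen]
    push_cast
    ring
  · rw [show Code.solve.den m = Code.writeOut.den m₁ from rfl, (o₂ u u.2 v v.2).1, fracAt]
    split_ifs with huv
    · rfl
    · rw [not_not] at huv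
      rw [huv]; exact hdiag v
  · rw [show Code.solve.den m = Code.writeOut.den m₁ from rfl, (o₂ u u.2 v v.2).2, fracAt]
    by_cases huv : u = v
    · rw [if_pos (by rw [huv]), dif_neg (by simpa using huv)]
    · rw [if_neg (fun h => huv (Fin.ext h)), dif_pos huv]

end ATSPP

theorem lemma2 :
    (∀ (V : Type*) [Fintype V] [DecidableEq V] (s t : V) (x : ATSPP.Arc V → ℝ) (τ : ℝ),
      s ≠ t → ATSPP.IsFeasible s t x → 0 ≤ τ → τ ≤ 1 / 4 →
      ∃ z : ATSPP.Arc V → ℝ, ATSPP.IsTightened s t x τ z) ∧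
    (∃ (p : ATSPP.Prog) (P : Polynomial ℕ),
      ∀ (n : ℕ) (s t : Fin n) (x : ATSPP.Arc (Fin n) → ATSPP.Frac) (τ : ATSPP.Frac),
        s ≠ t → ATSPP.IsFeasible s t (fun a => (x a).val) → 0 ≤ τ.val → τ.val ≤ 1 / 4 →
        ∃ z : ATSPP.Arc (Fin n) → ATSPP.Frac,
          ATSPP.Computes p (ATSPP.encodeInput s t τ x) (ATSPP.encodeVec z)
            (P.eval (ATSPP.inputSize (ATSPP.encodeInput s t τ x))) ∧
          ATSPP.IsTightened s t (fun a => (x a).val) τ.val (fun a => (z a).val)) := by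
  exact ⟨fun _ _ _ _ _ _ _ _ h hτ₀ hτ => ATSPP.exists_isTightened h hτ₀ hτ, by
    obtain ⟨p, P, h⟩ := ATSPP.exists_computes_isTightened
    exact ⟨p, P, fun n s t x τ _ => h n s t x τ⟩⟩
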